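/- Let $d\ge 1$ be an integer, $\alpha\in(0,2)$, $\varepsilon\in\mathbb R$, and $$V(x)=\tfrac12(d+\alpha)\log(1+|x|^2)+\varepsilon\log\log(\mathrm e+|x|^2),\qquad x\in\mathbb R^d .$$ Then $\int_{\mathbb R^d}\mathrm e^{-V(x)}\,dx<\infty$; let $\mu_V(dx)=\mathrm e^{-V(x)}dx\big/\int_{\mathbb R^d}\mathrm e^{-V(y)}dy$ and write $\mu_V(f)=\int f\,d\mu_V$. Put $$\mathcal E(f,g)=\iint_{\mathbb R^d\times\mathbb R^d}\frac{(f(x)-f(y))(g(x)-g(y))}{|x-y|^{d+\alpha}}\,dy\,\mu_V(dx),\qquad \mathcal D=\{f\in L^2(\mu_V):\mathcal E(f,f)<\infty\}.$$ There is a strongly continuous semigroup $(P_t)_{t\ge0}$ on $L^2(\mu_V)$ associated with $(\mathcal E,\mathcal D)$, that is, one whose generator $L$ is given by: $f\in\mathcal D(L)$ and $Lf=h$ if and only if $f\in\mathcal D$ and $\mathcal E(f,g)=-\mu_V(hg)$ for all $g\in\mathcal D$. For positive functions $\beta,\tilde\beta$ on $(0,\infty)$ and $C>0$ consider * (SP)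 $\mu_V(f^2)\le r\,\mathcal E(f,f)+\beta(r)\mu_V(|f|)^2$ for all $r>0$, $f\in\mathcal D$; * (LS) $\mu_V(f^2\log f^2)\le C\,\mathcal E(f,f)$ for all $f\in\mathcal D$ with $\mu_V(f^2)=1$; * (P) $\mu_V(f^2)\le C\,\mathcal E(f,f)$ for all $f\in\mathcal D$ with $\mu_V(f)=0$; * (WP) $\mu_V(f^2)\le\tilde\beta(r)\,\mathcal E(f,f)+r\|f\|_\infty^2$ for all $r>0$, $f\in\mathcal D$ with $\mu_V(f)=0$. The constants $c,C,\lambda,\lambda_1,\lambda_2$ below may depend on $d,\alpha,\varepsilon$ only. 1. (SP) holds for some $\beta:(0,\infty)\to(0,\infty)$ if and only if $\varepsilon>0$. In this case it holds with $\beta(r)=\exp[c(1+r^{-1/\varepsilon})]$ for some constant $c>0$. If $\varepsilon>1$, there is a constant $\lambda>0$ such that $$\|P_t\|_{L^1(\mu_V)\to L^\infty(\mu_V)}\le\exp\big[\lambda\big(1+t^{-1/(\varepsilon-1)}\big)\big],\qquad t>0.$$ 2. For $\varepsilon>0$ this is sharp: (SP) does not hold for any $\beta:(0,\infty)\to(0,\infty)$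 with $\lim_{r\to0}r^{1/\varepsilon}\log\beta(r)=0$. 3. (LS) holds for some constant $C>0$ if and only if $\varepsilon\ge1$. 4. (P) holds for some constant $C>0$ if and only if $\varepsilon\ge0$. If $\varepsilon<0$, there is a constant $c>0$ such that (WP) holds with $$\tilde\beta(r)=c\big(1+\log^{-\varepsilon}(1+r^{-1})\big),\qquad r>0,$$ and there are constants $\lambda_1,\lambda_2>0$ such that $$\|P_t-\mu_V\|_{L^\infty(\mu_V)\to L^2(\mu_V)}\le\exp\big[\lambda_1-\lambda_2t^{1/(1-\varepsilon)}\big],\qquad t>0.$$ For $\varepsilon<0$ this is sharp: (WP) does not hold for any $\tilde\beta:(0,\infty)\to(0,\infty)$ with $\lim_{r\to0}\tilde\beta(r)\log^{\varepsilon}(1+r^{-1})=0$. -/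

import Mathlib

open Real Set Filter Topology MeasureTheory
open scoped ENNReal

noncomputable section

/-- The probability measure `μ_V(dx) = e^{-V(x)} dx / ∫ e^{-V}` on `ℝ^d`
(a probability measure as soon as `0 < ∫ e^{-V} < ∞`). -/
def gibbs {d : ℕ} (V : EuclideanSpace ℝ (Fin d) → ℝ) : Measure (EuclideanSpace ℝ (Fin d)) :=
  (∫⁻ x, ENNReal.ofReal (exp (-V x)))⁻¹ •
    (volume : Measure (EuclideanSpace ℝ (Fin d))).withDensity
      (fun x => ENNReal.ofReal (exp (-V x)))

/-- The bilinear form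
`E(f,g) = ∬ (f x - f y) (g x - g y) / |x - y|^(d+α) dy μ_V(dx)`,
for `f`, `g` in the domain `FormDomain α V`. -/
def stableForm {d : ℕ} (α : ℝ) (V : EuclideanSpace ℝ (Fin d) → ℝ)
    (f g : EuclideanSpace ℝ (Fin d) → ℝ) : ℝ :=
  ∫ p : EuclideanSpace ℝ (Fin d) × EuclideanSpace ℝ (Fin d),
    (f p.1 - f p.2) * (g p.1 - g p.2) / ‖p.1 - p.2‖ ^ ((d : ℝ) + α)
      ∂((gibbs V).prod volume)

/-- `f ∈ D(E)`: `f ∈ L²(μ_V)` and `E(f,f) < ∞`. -/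
def FormDomain {d : ℕ} (α : ℝ) (V : EuclideanSpace ℝ (Fin d) → ℝ)
    (f : EuclideanSpace ℝ (Fin d) → ℝ) : Prop :=
  MemLp f 2 (gibbs V) ∧
    ∫⁻ p : EuclideanSpace ℝ (Fin d) × EuclideanSpace ℝ (Fin d),
      ENNReal.ofReal ((f p.1 - f p.2) ^ 2 / ‖p.1 - p.2‖ ^ ((d : ℝ) + α))
        ∂((gibbs V).prod volume) < ∞

/-- Poincaré inequality with constant `C`. -/
def PoincareIneq {d : ℕ} (α : ℝ) (V : EuclideanSpace ℝ (Fin d) → ℝ) (C : ℝ) : Prop :=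
  ∀ f, FormDomain α V f → ∫ x, f x ∂(gibbs V) = 0 →
    ∫ x, f x ^ 2 ∂(gibbs V) ≤ C * stableForm α V f f

/-- Super Poincaré inequality with rate function `β`. -/
def SuperPoincareIneq {d : ℕ} (α : ℝ) (V : EuclideanSpace ℝ (Fin d) → ℝ) (β : ℝ → ℝ) : Prop :=
  ∀ r : ℝ, 0 < r → ∀ f, FormDomain α V f →
    ∫ x, f x ^ 2 ∂(gibbs V) ≤ r * stableForm α V f f + β r * (∫ x, |f x| ∂(gibbs V)) ^ 2

/-- Weak Poincaré inequality with rate function `β`.  (For `‖f‖_∞ = ∞` the inequality is void,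
so it is only required for essentially bounded `f`.) -/
def WeakPoincareIneq {d : ℕ} (α : ℝ) (V : EuclideanSpace ℝ (Fin d) → ℝ) (β : ℝ → ℝ) : Prop :=
  ∀ r : ℝ, 0 < r → ∀ f, FormDomain α V f → MemLp f ∞ (gibbs V) → ∫ x, f x ∂(gibbs V) = 0 →
    ∫ x, f x ^ 2 ∂(gibbs V) ≤
      β r * stableForm α V f f + r * (eLpNorm f ∞ (gibbs V)).toReal ^ 2

/-- Log-Sobolev inequality with constant `C`.  The negative part of `f² log f²` is bounded, so
`μ_V(f² log f²)` is finite exactly when `f² log f²` is integrable. -/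
def LogSobolevIneq {d : ℕ} (α : ℝ) (V : EuclideanSpace ℝ (Fin d) → ℝ) (C : ℝ) : Prop :=
  ∀ f, FormDomain α V f → ∫ x, f x ^ 2 ∂(gibbs V) = 1 →
    Integrable (fun x => f x ^ 2 * log (f x ^ 2)) (gibbs V) ∧
      ∫ x, f x ^ 2 * log (f x ^ 2) ∂(gibbs V) ≤ C * stableForm α V f f

/-- `(P t)_{t ≥ 0}` is the semigroup on `L²(μ_V)` associated with `(E, D(E))`: a strongly
continuous semigroup whose infinitesimal generator is the operator `L` of the form, i.e.
`f ∈ D(L)` and `L f = h` iff `f ∈ D(E)` and `E(f,g) = -⟨h, g⟩` for all `g ∈ D(E)`.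
A strongly continuous semigroup is determined by its generator.  The values `P t` for `t < 0`
play no role. -/
structure IsFormSemigroup {d : ℕ} (α : ℝ) (V : EuclideanSpace ℝ (Fin d) → ℝ)
    (P : ℝ → (Lp ℝ 2 (gibbs V) →L[ℝ] Lp ℝ 2 (gibbs V))) : Prop where
  zero : P 0 = ContinuousLinearMap.id ℝ _
  add : ∀ s t : ℝ, 0 ≤ s → 0 ≤ t → P (s + t) = (P s).comp (P t)
  cont : ∀ f, ContinuousOn (fun t => P t f) (Ici 0)
  generator : ∀ f h : Lp ℝ 2 (gibbs V),
    Tendsto (fun t : ℝ => t⁻¹ • (P t f - f)) (𝓝[>] 0) (𝓝 h) ↔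
      FormDomain α V f ∧ ∀ g : Lp ℝ 2 (gibbs V), FormDomain α V g →
        stableForm α V f g = -inner ℝ h g

/-- The norm `‖T‖_{L^p(μ) → L^q(μ)} ∈ [0,∞]` of a map `T` given on `L²(μ)`: the supremum of
`‖T f‖_q` over `f ∈ L²(μ)` with `‖f‖_p ≤ 1`. -/
def mixedNorm {Ω : Type*} [MeasurableSpace Ω] (μ : Measure Ω) (p q : ℝ≥0∞)
    (T : Lp ℝ 2 μ → Ω → ℝ) : ℝ≥0∞ :=
  ⨆ (f : Lp ℝ 2 μ) (_ : eLpNorm f p μ ≤ 1), eLpNorm (T f) q μ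

/-- `V(x) = (d+α)/2 · log(1+|x|²) + ε log log(e+|x|²)`. -/
def potential (d : ℕ) (α ε : ℝ) (x : EuclideanSpace ℝ (Fin d)) : ℝ :=
  ((d : ℝ) + α) / 2 * log (1 + ‖x‖ ^ 2) + ε * log (log (exp 1 + ‖x‖ ^ 2))

end

section ClosedForms

variable {H : Type*} [NormedAddCommGroup H] [InnerProductSpace ℝ H]

/-- A densely defined nonnegative symmetric bilinear form `a` on a subspace `D` of a Hilbert space
whose resolvent equations are solvable (that is, a closed form). -/
structure IsClosedForm (D : Submodule ℝ H) (a : H → H → ℝ) : Prop where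
  symm : ∀ u ∈ D, ∀ v ∈ D, a u v = a v u
  add_left : ∀ u ∈ D, ∀ v ∈ D, ∀ w ∈ D, a (u + v) w = a u w + a v w
  smul_left : ∀ c : ℝ, ∀ u ∈ D, ∀ w ∈ D, a (c • u) w = c * a u w
  nonneg : ∀ u ∈ D, 0 ≤ a u u
  dense : Dense (D : Set H)
  exists_resolvent : ∀ s : ℝ, 0 < s → ∀ f : H, ∃ u ∈ D, ∀ g ∈ D,
    s * a u g + inner ℝ u g = inner ℝ f g

/-- `u` is in the domain of the generator of the form `a`, which maps it to `h`. -/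
def FormGen (D : Submodule ℝ H) (a : H → H → ℝ) (u h : H) : Prop :=
  u ∈ D ∧ ∀ g ∈ D, a u g = -inner ℝ h g

namespace IsClosedForm

variable {D : Submodule ℝ H} {a : H → H → ℝ}

theorem sub_left (ha : IsClosedForm D a) {u v w : H} (hu : u ∈ D) (hv : v ∈ D) (hw : w ∈ D) :
    a (u - v) w = a u w - a v w := by
  have h1 := ha.add_left u hu ((-1 : ℝ) • v) (D.smul_mem _ hv) w hw
  rw [ha.smul_left _ v hv w hw] at h1
  rw [sub_eq_add_neg, ← neg_one_smul ℝ v, h1]; ring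

theorem sub_right (ha : IsClosedForm D a) {u v w : H} (hu : u ∈ D) (hv : v ∈ D) (hw : w ∈ D) :
    a w (u - v) = a w u - a w v := by
  rw [ha.symm w hw _ (D.sub_mem hu hv), ha.sub_left hu hv hw, ha.symm u hu w hw,
    ha.symm v hv w hw]

theorem gen_add (ha : IsClosedForm D a) {u v h k : H} (hu : FormGen D a u h)
    (hv : FormGen D a v k) : FormGen D a (u + v) (h + k) := by
  refine ⟨D.add_mem hu.1 hv.1, fun g hg => ?_⟩
  rw [ha.add_left _ hu.1 _ hv.1 _ hg, hu.2 g hg, hv.2 g hg, inner_add_left]; ring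

theorem gen_smul (ha : IsClosedForm D a) {u h : H} (c : ℝ) (hu : FormGen D a u h) :
    FormGen D a (c • u) (c • h) := by
  refine ⟨D.smul_mem _ hu.1, fun g hg => ?_⟩
  rw [ha.smul_left _ _ hu.1 _ hg, hu.2 g hg, real_inner_smul_left]; ring

theorem gen_sub (ha : IsClosedForm D a) {u v h k : H} (hu : FormGen D a u h)
    (hv : FormGen D a v k) : FormGen D a (u - v) (h - k) := by
  have := ha.gen_add hu (ha.gen_smul (-1) hv)
  simpa [sub_eq_add_neg] using this

theorem gen_inner_nonpos (ha : IsClosedForm D a) {u h : H} (hu : FormGen D a u h) :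
    inner ℝ h u ≤ 0 := by
  have h1 := hu.2 u hu.1
  have h2 := ha.nonneg u hu.1
  linarith

theorem resolvent_unique (ha : IsClosedForm D a) {s : ℝ} (hs : 0 < s) {u v f : H} (hu : u ∈ D)
    (hv : v ∈ D) (h1 : ∀ g ∈ D, s * a u g + inner ℝ u g = inner ℝ f g)
    (h2 : ∀ g ∈ D, s * a v g + inner ℝ v g = inner ℝ f g) : u = v := by
  have hw := D.sub_mem hu hv
  have e1 := h1 _ hw
  have e2 := h2 _ hw
  have e3 := ha.sub_left hu hv hw
  have e4 := ha.nonneg _ hw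
  have e5 : inner ℝ (u - v) (u - v) = inner ℝ u (u - v) - inner ℝ v (u - v) := inner_sub_left ..
  have e6 : inner ℝ (u - v) (u - v) ≤ (0 : ℝ) := by
    have : s * a (u - v) (u - v) + inner ℝ (u - v) (u - v) = 0 := by
      rw [e3, e5]; linarith
    nlinarith [mul_nonneg hs.le e4]
  rw [real_inner_self_eq_norm_sq] at e6
  have : ‖u - v‖ = 0 := by
    have := sq_nonneg ‖u - v‖
    exact pow_eq_zero_iff (two_ne_zero) |>.1 (le_antisymm e6 this)
  exact sub_eq_zero.1 (norm_eq_zero.1 this)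

theorem exists_resolvent_clm (ha : IsClosedForm D a) {s : ℝ} (hs : 0 < s) :
    ∃ J : H →L[ℝ] H, ∀ f, J f ∈ D ∧ ∀ g ∈ D, s * a (J f) g + inner ℝ (J f) g = inner ℝ f g := by
  choose J hJD hJ using ha.exists_resolvent s hs
  have hadd : ∀ x y, J (x + y) = J x + J y := fun x y => by
    refine ha.resolvent_unique hs (hJD _) (D.add_mem (hJD x) (hJD y)) (hJ _) fun g hg => ?_
    rw [ha.add_left _ (hJD x) _ (hJD y) _ hg, inner_add_left, inner_add_left, ← hJ x g hg,
      ← hJ y g hg]; ring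
  have hsmul : ∀ (c : ℝ) x, J (c • x) = c • J x := fun c x => by
    refine ha.resolvent_unique hs (hJD _) (D.smul_mem _ (hJD x)) (hJ _) fun g hg => ?_
    rw [ha.smul_left _ _ (hJD x) _ hg, real_inner_smul_left, real_inner_smul_left, ← hJ x g hg]
    ring
  have hbd : ∀ x, ‖J x‖ ≤ 1 * ‖x‖ := fun x => by
    have h1 := hJ x _ (hJD x)
    have h2 := mul_nonneg hs.le (ha.nonneg _ (hJD x))
    rw [real_inner_self_eq_norm_sq] at h1
    have h3 := real_inner_le_norm x (J x)
    by_contra! h4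
    rw [one_mul] at h4
    nlinarith [norm_nonneg x, norm_nonneg (J x)]
  exact ⟨LinearMap.mkContinuous ⟨⟨J, hadd⟩, hsmul⟩ 1 hbd, fun f => ⟨hJD f, hJ f⟩⟩

open Classical in
/-- The resolvent `(1 - s L)⁻¹` of the generator `L` of a closed form. -/
noncomputable def res (ha : IsClosedForm D a) (s : ℝ) : H →L[ℝ] H :=
  if hs : 0 < s then (ha.exists_resolvent_clm hs).choose else 0

section resolvent

variable (ha : IsClosedForm D a) {s r : ℝ}

theorem res_mem (hs : 0 < s) (f : H) : ha.res s f ∈ D := by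
  rw [res, dif_pos hs]; exact ((ha.exists_resolvent_clm hs).choose_spec f).1

theorem res_spec (hs : 0 < s) (f : H) {g : H} (hg : g ∈ D) :
    s * a (ha.res s f) g + inner ℝ (ha.res s f) g = inner ℝ f g := by
  rw [res, dif_pos hs]; exact ((ha.exists_resolvent_clm hs).choose_spec f).2 g hg

theorem res_eq (hs : 0 < s) {u h : H} (hu : FormGen D a u h) : ha.res s (u - s • h) = u :=
  ha.resolvent_unique hs (ha.res_mem hs _) hu.1 (fun _ hg => ha.res_spec hs _ hg) fun g hg => by
    rw [hu.2 g hg, inner_sub_left, real_inner_smul_left]; ring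

theorem res_eq_of_gen_zero (hs : 0 < s) {u : H} (hu : FormGen D a u 0) : ha.res s u = u := by
  simpa using ha.res_eq hs hu

theorem gen_res (hs : 0 < s) (f : H) :
    FormGen D a (ha.res s f) (s⁻¹ • (ha.res s f - f)) := by
  refine ⟨ha.res_mem hs f, fun g hg => ?_⟩
  have := ha.res_spec hs f hg
  rw [real_inner_smul_left, inner_sub_left, ← this]
  field_simp; ring

theorem norm_res_le (hs : 0 < s) : ‖ha.res s‖ ≤ 1 := by
  refine ContinuousLinearMap.opNorm_le_bound _ zero_le_one fun x => ?_
  have h1 := ha.res_spec hs x (ha.res_mem hs x)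
  have h2 := mul_nonneg hs.le (ha.nonneg _ (ha.res_mem hs x))
  rw [real_inner_self_eq_norm_sq] at h1
  have h3 := real_inner_le_norm x (ha.res s x)
  by_contra! h4
  rw [one_mul] at h4
  nlinarith [norm_nonneg x, norm_nonneg (ha.res s x)]

theorem inner_res (hs : 0 < s) (f g : H) : inner ℝ (ha.res s f) g = inner ℝ f (ha.res s g) := by
  have h1 := ha.res_spec hs f (ha.res_mem hs g)
  have h2 := ha.res_spec hs g (ha.res_mem hs f)
  rw [ha.symm _ (ha.res_mem hs g) _ (ha.res_mem hs f), real_inner_comm] at h2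
  rw [real_inner_comm g]
  linarith

theorem res_comm (hs : 0 < s) (hr : 0 < r) (f : H) :
    ha.res s (ha.res r f) = ha.res r (ha.res s f) := by
  set v := ha.res r f with hv
  set w := ha.res s v with hw
  have gv : FormGen D a v (r⁻¹ • (v - f)) := ha.gen_res hr f
  have gw : FormGen D a w (s⁻¹ • (w - v)) := ha.gen_res hs v
  have gLw := ha.gen_smul s⁻¹ (ha.gen_sub gw gv)
  have gz := ha.gen_sub gw (ha.gen_smul r gLw)
  have h1 := ha.res_eq hs gz
  have h2 := ha.res_eq hr gw
  rw [← h2]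
  congr 1
  rw [← h1]
  congr 1
  have hs' := hs.ne'
  have hr' := hr.ne'
  simp only [smul_sub, smul_smul]
  rw [mul_inv_cancel₀ hs', one_smul,
    show s * (r * (s⁻¹ * s⁻¹)) = r * s⁻¹ by field_simp,
    show s * (r * (s⁻¹ * r⁻¹)) = 1 by field_simp, one_smul, one_smul]
  abel

theorem norm_res_sub_sq_le (hs : 0 < s) {u : H} (hu : u ∈ D) :
    ‖ha.res s u - u‖ ^ 2 ≤ s * a u u := by
  set w := ha.res s u with hw
  have hwD : w ∈ D := ha.res_mem hs u
  have h1 := ha.res_spec hs u (D.sub_mem hwD hu)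
  have h2 := ha.nonneg _ (D.sub_mem hwD hu)
  have h3 := ha.nonneg _ hu
  have h4 := ha.nonneg _ hwD
  rw [← hw, ha.sub_right hwD hu hwD] at h1
  rw [ha.sub_left hwD hu (D.sub_mem hwD hu), ha.sub_right hwD hu hwD, ha.sub_right hwD hu hu,
    ha.symm u hu w hwD] at h2
  have h5 : ‖w - u‖ ^ 2 = inner ℝ w (w - u) - inner ℝ u (w - u) := by
    rw [← real_inner_self_eq_norm_sq, ← inner_sub_left]
  have h6 : a w u - a w w ≤ a u u := by linarith [h2]
  nlinarith

theorem tendsto_res (f : H) : Tendsto (fun s => ha.res s f) (𝓝[>] 0) (𝓝 f) := by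
  rw [Metric.tendsto_nhds]
  intro η hη
  obtain ⟨u, huf, hu⟩ := Metric.dense_iff.1 ha.dense f (η / 3) (by positivity)
  have huf : ‖u - f‖ < η / 3 := by simpa [dist_eq_norm] using huf
  have ht : Tendsto (fun s : ℝ => s * a u u) (𝓝[>] 0) (𝓝 0) := by
    have : Tendsto (fun s : ℝ => s * a u u) (𝓝 0) (𝓝 (0 * a u u)) :=
      (continuous_id.mul continuous_const).tendsto 0
    rw [zero_mul] at this
    exact this.mono_left nhdsWithin_le_nhds
  have hsm : ∀ᶠ s : ℝ in 𝓝[>] 0, s * a u u < (η / 3) ^ 2 :=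
    ht.eventually (gt_mem_nhds (by positivity))
  filter_upwards [hsm, self_mem_nhdsWithin] with s h1 hs
  have hs : 0 < s := hs
  have h2 : ‖ha.res s u - u‖ < η / 3 := by
    have := ha.norm_res_sub_sq_le hs hu
    exact lt_of_pow_lt_pow_left₀ 2 (by positivity) (this.trans_lt h1)
  have h3 : ‖ha.res s (f - u)‖ ≤ ‖f - u‖ := by
    simpa using (ha.res s).le_of_opNorm_le (ha.norm_res_le hs) (f - u)
  rw [dist_eq_norm]
  have : ha.res s f - f = ha.res s (f - u) + (ha.res s u - u) + (u - f) := by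
    rw [map_sub]; abel
  rw [this]
  calc _ ≤ ‖ha.res s (f - u)‖ + ‖ha.res s u - u‖ + ‖u - f‖ := norm_add₃_le
    _ < η / 3 + η / 3 + η / 3 := by rw [norm_sub_rev f u] at h3; gcongr; linarith
    _ = η := by ring

theorem exists_gen_near (ha : IsClosedForm D a) (f : H) {η : ℝ} (hη : 0 < η) : ∃ u h, FormGen D a u h ∧ ‖u - f‖ < η := by
  have := (Metric.tendsto_nhds.1 (ha.tendsto_res f) η hη).and
    (self_mem_nhdsWithin : Ioi (0 : ℝ) ∈ 𝓝[>] 0)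
  obtain ⟨s, h1, hs⟩ := this.exists
  exact ⟨_, _, ha.gen_res hs f, by simpa [dist_eq_norm] using h1⟩

end resolvent

end IsClosedForm

end ClosedForms

section ClosedFormSemigroup

set_option linter.unusedSectionVars false

variable {H : Type*} [NormedAddCommGroup H] [InnerProductSpace ℝ H] [CompleteSpace H]

/-- The exponential `e^{-τ} e^{τ J}` maps a closed convex set into itself if `J` does. -/
theorem exp_smul_exp_mem_of_convex {C : Set H} (hC : Convex ℝ C) (hC' : IsClosed C)
    {J : H →L[ℝ] H} (hJ : ∀ x ∈ C, J x ∈ C) {τ : ℝ} (hτ : 0 ≤ τ) {x : H} (hx : x ∈ C) :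
    (Real.exp (-τ) • NormedSpace.exp (τ • J)) x ∈ C := by
  have h1 : HasSum (fun k : ℕ => ((k.factorial : ℝ)⁻¹ • (τ • J) ^ k) x)
      (NormedSpace.exp (τ • J) x) := by
    have h := NormedSpace.exp_series_hasSum_exp' (𝕂 := ℝ) (τ • J)
    exact h.mapL (ContinuousLinearMap.apply ℝ H x)
  have h2 : HasSum (fun k : ℕ => (k.factorial : ℝ)⁻¹ • τ ^ k) (Real.exp τ) := by
    rw [Real.exp_eq_exp_ℝ]; exact NormedSpace.exp_series_hasSum_exp' (𝕂 := ℝ) τ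
  have hpow : ∀ k : ℕ, (J ^ k) x ∈ C := fun k => by
    induction k with
    | zero => simpa
    | succ k ih => rw [pow_succ']; exact hJ _ ih
  have h3 : ∀ k : ℕ, ((k.factorial : ℝ)⁻¹ • (τ • J) ^ k) x =
      ((k.factorial : ℝ)⁻¹ • τ ^ k) • (J ^ k) x := fun k => by
    rw [smul_pow, smul_smul]; rfl
  simp_rw [h3] at h1
  have h4 := (h2.tendsto_sum_nat.inv₀ (Real.exp_pos τ).ne').smul h1.tendsto_sum_nat
  rw [smul_apply, Real.exp_neg]
  refine hC'.mem_of_tendsto h4 ?_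
  filter_upwards [eventually_ge_atTop 1] with N hN
  refine hC.centerMass_mem (fun i _ => by simp only [smul_eq_mul]; positivity) ?_
    (fun i _ => hpow i)
  refine Finset.sum_pos' (fun i _ => by simp only [smul_eq_mul]; positivity)
    ⟨0, Finset.mem_range.2 hN, by simp⟩

namespace IsClosedForm

variable {D : Submodule ℝ H} {a : H → H → ℝ} (ha : IsClosedForm D a)

/-- The resolvent `(1 - L/(n+1))⁻¹`. -/
noncomputable def resN (n : ℕ) : H →L[ℝ] H := ha.res (n + 1 : ℝ)⁻¹

/-- The Yosida approximation of the generator. -/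
noncomputable def yosida (n : ℕ) : H →L[ℝ] H := (n + 1 : ℝ) • (ha.resN n - 1)

/-- The semigroup generated by the Yosida approximation. -/
noncomputable def yosidaExp (n : ℕ) (t : ℝ) : H →L[ℝ] H :=
  Real.exp (-(t * (n + 1))) • NormedSpace.exp ((t * (n + 1)) • ha.resN n)

theorem yosidaExp_zero (n : ℕ) : ha.yosidaExp n 0 = 1 := by simp [yosidaExp]

theorem yosidaExp_add (n : ℕ) (s t : ℝ) :
    ha.yosidaExp n (s + t) = ha.yosidaExp n s * ha.yosidaExp n t := by
  let _ : NormedAlgebra ℚ (H →L[ℝ] H) := NormedAlgebra.restrictScalars ℚ ℝ _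
  rw [yosidaExp, yosidaExp, yosidaExp, smul_mul_smul_comm, ← Real.exp_add,
    ← NormedSpace.exp_add_of_commute, ← add_smul]
  · congr 2
    · ring_nf
    · ring_nf
  · exact ((Commute.refl _).smul_left _).smul_right _

theorem yosidaExp_mem (n : ℕ) {C : Set H} (hC : Convex ℝ C) (hC' : IsClosed C)
    (hJ : ∀ s : ℝ, 0 < s → ∀ x ∈ C, ha.res s x ∈ C) {t : ℝ} (ht : 0 ≤ t) {x : H} (hx : x ∈ C) :
    ha.yosidaExp n t x ∈ C :=
  exp_smul_exp_mem_of_convex hC hC' (hJ _ (by positivity)) (by positivity) hx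

theorem norm_yosidaExp_le (n : ℕ) {t : ℝ} (ht : 0 ≤ t) (x : H) : ‖ha.yosidaExp n t x‖ ≤ ‖x‖ := by
  have := ha.yosidaExp_mem n (convex_closedBall (0 : H) ‖x‖) Metric.isClosed_closedBall
    (fun s hs y hy => by
      rw [mem_closedBall_zero_iff] at hy ⊢
      refine le_trans ?_ hy
      simpa using (ha.res s).le_of_opNorm_le (ha.norm_res_le hs) y) ht (x := x) (by simp)
  simpa using this

theorem hasDerivAt_yosidaExp (n : ℕ) (t : ℝ) :
    HasDerivAt (ha.yosidaExp n) (ha.yosidaExp n t * ha.yosida n) t := by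
  have h0 : HasDerivAt (fun t : ℝ => t * (n + 1)) (n + 1 : ℝ) t := by
    simpa using (hasDerivAt_id t).mul_const (n + 1 : ℝ)
  have h1 := h0.neg.exp
  have h2 := (hasDerivAt_exp_smul_const (𝕂 := ℝ) (ha.resN n) (t * (n + 1))).scomp t h0
  have h3 := h1.smul h2
  refine h3.congr_deriv ?_
  simp only [yosidaExp, yosida, Function.comp, mul_smul_comm, smul_mul_assoc, 
    mul_one, smul_smul, mul_neg, neg_smul, sub_eq_add_neg, Pi.neg_apply, mul_add, smul_add, smul_neg]
  ring_nf

theorem commute_resN (n m : ℕ) : Commute (ha.resN n) (ha.resN m) := by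
  ext x
  exact ha.res_comm (by positivity) (by positivity) x

theorem commute_yosida_yosidaExp (n m : ℕ) (t : ℝ) :
    Commute (ha.yosida n) (ha.yosidaExp m t) := by
  let _ : NormedAlgebra ℚ (H →L[ℝ] H) := NormedAlgebra.restrictScalars ℚ ℝ _
  refine Commute.smul_left (Commute.smul_right ?_ _) _
  exact (((ha.commute_resN n m).sub_left (Commute.one_left _)).smul_right _).exp_right

theorem norm_yosidaExp_sub_le (n m : ℕ) {t : ℝ} (ht : 0 ≤ t) (u : H) :
    ‖ha.yosidaExp n t u - ha.yosidaExp m t u‖ ≤ ‖ha.yosida n u - ha.yosida m u‖ * t := by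
  have hd : ∀ r : ℝ, HasDerivAt (fun r => (ha.yosidaExp n r * ha.yosidaExp m (t - r)) u)
      (ha.yosidaExp n r (ha.yosidaExp m (t - r) (ha.yosida n u - ha.yosida m u))) r := fun r => by
    have h1 := ha.hasDerivAt_yosidaExp n r
    have h2 := (ha.hasDerivAt_yosidaExp m (t - r)).scomp r ((hasDerivAt_id r).const_sub t)
    have h3 := (h1.mul h2).clm_apply (hasDerivAt_const r u)
    refine h3.congr_deriv ?_
    have hc : ∀ v, ha.yosida n (ha.yosidaExp m (t - r) v) = ha.yosidaExp m (t - r) (ha.yosida n v) :=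
      fun v => DFunLike.congr_fun (ha.commute_yosida_yosidaExp n m (t - r)) v
    simp [hc, ← sub_eq_add_neg]
  have := norm_image_sub_le_of_norm_deriv_right_le_segment (a := 0) (b := t)
    (C := ‖ha.yosida n u - ha.yosida m u‖)
    (fun r _ => (hd r).continuousAt.continuousWithinAt) (fun r _ => (hd r).hasDerivWithinAt)
    (fun r hr => (ha.norm_yosidaExp_le n hr.1 _).trans
      (ha.norm_yosidaExp_le m (sub_nonneg.2 hr.2.le) _)) t (right_mem_Icc.2 ht)
  simpa [yosidaExp_zero] using this

theorem yosida_tendsto {u h : H} (hu : FormGen D a u h) :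
    Tendsto (fun n => ha.yosida n u) atTop (𝓝 h) := by
  have h1 : ∀ n, ha.yosida n u = ha.res (n + 1 : ℝ)⁻¹ h := fun n => by
    have hp : (0 : ℝ) < (n + 1 : ℝ)⁻¹ := by positivity
    have h2 := ha.res_eq hp hu
    rw [map_sub, map_smul] at h2
    have h3 : ha.resN n u - u = (n + 1 : ℝ)⁻¹ • ha.res (n + 1 : ℝ)⁻¹ h := by
      rw [resN]; nth_rewrite 2 [← h2]; abel
    rw [yosida, smul_apply, sub_apply,
      one_apply_eq_self, h3, smul_smul, mul_inv_cancel₀ (by positivity), one_smul]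
  simp_rw [h1]
  refine (ha.tendsto_res h).comp (tendsto_nhdsWithin_iff.2 ⟨?_, ?_⟩)
  · simpa using tendsto_one_div_add_atTop_nhds_zero_nat (𝕜 := ℝ)
  · exact Eventually.of_forall fun n => by simp only [mem_Ioi]; positivity

theorem cauchySeq_yosidaExp {t : ℝ} (ht : 0 ≤ t) (f : H) :
    CauchySeq (fun n => ha.yosidaExp n t f) := by
  rw [Metric.cauchySeq_iff]
  intro η hη
  obtain ⟨u, h, hu, huf⟩ := ha.exists_gen_near f (η := η / 3) (by positivity)
  obtain ⟨N, hN⟩ := Metric.cauchySeq_iff.1 (ha.yosida_tendsto hu).cauchySeq (η / 3 / (t + 1))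
    (by positivity)
  refine ⟨N, fun n hn m hm => ?_⟩
  have h1 := ha.norm_yosidaExp_sub_le n m ht u
  have h2 := hN n hn m hm
  rw [dist_eq_norm, lt_div_iff₀ (by positivity)] at h2
  have h3 := ha.norm_yosidaExp_le n ht (f - u)
  have h4 := ha.norm_yosidaExp_le m ht (u - f)
  rw [norm_sub_rev] at h3
  rw [dist_eq_norm]
  have e : ha.yosidaExp n t f - ha.yosidaExp m t f = ha.yosidaExp n t (f - u) +
      (ha.yosidaExp n t u - ha.yosidaExp m t u) + ha.yosidaExp m t (u - f) := by
    rw [map_sub, map_sub]; abel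
  rw [e]
  refine norm_add₃_le.trans_lt ?_
  have h5 := norm_nonneg (ha.yosida n u - ha.yosida m u)
  nlinarith

theorem exists_lim_yosidaExp (t : ℝ) :
    ∃ Q : H →L[ℝ] H, 0 ≤ t → ∀ f, Tendsto (fun n => ha.yosidaExp n t f) atTop (𝓝 (Q f)) := by
  by_cases ht : 0 ≤ t
  · choose Q hQ using fun f => cauchySeq_tendsto_of_complete (ha.cauchySeq_yosidaExp ht f)
    exact ⟨continuousLinearMapOfTendsto (fun n => ha.yosidaExp n t)
      (tendsto_pi_nhds.2 hQ), fun _ f => hQ f⟩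
  · exact ⟨0, fun h => absurd h ht⟩

/-- The contraction semigroup associated with a closed form. -/
noncomputable def semigroup (t : ℝ) : H →L[ℝ] H := (ha.exists_lim_yosidaExp t).choose

theorem tendsto_yosidaExp {t : ℝ} (ht : 0 ≤ t) (f : H) :
    Tendsto (fun n => ha.yosidaExp n t f) atTop (𝓝 (ha.semigroup t f)) :=
  (ha.exists_lim_yosidaExp t).choose_spec ht f

theorem semigroup_mem {C : Set H} (hC : Convex ℝ C) (hC' : IsClosed C)
    (hJ : ∀ s : ℝ, 0 < s → ∀ x ∈ C, ha.res s x ∈ C) {t : ℝ} (ht : 0 ≤ t) {x : H} (hx : x ∈ C) :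
    ha.semigroup t x ∈ C :=
  hC'.mem_of_tendsto (ha.tendsto_yosidaExp ht x)
    (Eventually.of_forall fun n => ha.yosidaExp_mem n hC hC' hJ ht hx)

theorem norm_semigroup_le {t : ℝ} (ht : 0 ≤ t) (x : H) : ‖ha.semigroup t x‖ ≤ ‖x‖ :=
  le_of_tendsto (ha.tendsto_yosidaExp ht x).norm
    (Eventually.of_forall fun n => ha.norm_yosidaExp_le n ht x)

theorem semigroup_zero : ha.semigroup 0 = ContinuousLinearMap.id ℝ H := by
  ext x
  refine tendsto_nhds_unique (ha.tendsto_yosidaExp le_rfl x) ?_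
  simp [yosidaExp_zero]

theorem semigroup_add {s t : ℝ} (hs : 0 ≤ s) (ht : 0 ≤ t) :
    ha.semigroup (s + t) = (ha.semigroup s).comp (ha.semigroup t) := by
  ext x
  refine tendsto_nhds_unique (ha.tendsto_yosidaExp (add_nonneg hs ht) x) ?_
  have h1 : ∀ n, ha.yosidaExp n (s + t) x = ha.yosidaExp n s (ha.semigroup t x) +
      ha.yosidaExp n s (ha.yosidaExp n t x - ha.semigroup t x) := fun n => by
    rw [yosidaExp_add, map_sub]; simp
  simp_rw [h1]
  have h2 : Tendsto (fun n => ha.yosidaExp n s (ha.yosidaExp n t x - ha.semigroup t x)) atTop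
      (𝓝 0) :=
    squeeze_zero_norm (fun n => ha.norm_yosidaExp_le n hs _)
      (tendsto_iff_norm_sub_tendsto_zero.1 (ha.tendsto_yosidaExp ht x))
  simpa using (ha.tendsto_yosidaExp hs (ha.semigroup t x)).add h2

theorem inner_semigroup {t : ℝ} (ht : 0 ≤ t) (f g : H) :
    inner ℝ (ha.semigroup t f) g = inner ℝ f (ha.semigroup t g) := by
  refine tendsto_nhds_unique ((ha.tendsto_yosidaExp ht f).inner tendsto_const_nhds)
    ((tendsto_const_nhds.inner (ha.tendsto_yosidaExp ht g)).congr fun n => ?_)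
  have hJ : IsSelfAdjoint (ha.resN n) := by
    rw [ContinuousLinearMap.isSelfAdjoint_iff_isSymmetric]
    intro x y
    exact ha.inner_res (by positivity) x y
  have h1 : IsSelfAdjoint (ha.yosidaExp n t) :=
    (IsSelfAdjoint.all (Real.exp (-(t * (n + 1))))).smul
      ((IsSelfAdjoint.all (t * (n + 1) : ℝ)).smul hJ).exp
  exact ((ContinuousLinearMap.isSelfAdjoint_iff_isSymmetric.1 h1) f g).symm

theorem norm_semigroup_sub_le {u : H} {t : ℝ} (ht : 0 ≤ t) (k : H) {C : ℝ}
    (hC : ∀ᶠ n in atTop, ∀ s ∈ Ico 0 t, ‖ha.yosidaExp n s (ha.yosida n u) - k‖ ≤ C) :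
    ‖ha.semigroup t u - u - t • k‖ ≤ C * t := by
  refine le_of_tendsto (((ha.tendsto_yosidaExp ht u).sub_const u).sub_const (t • k)).norm ?_
  filter_upwards [hC] with n hn
  have hd : ∀ r : ℝ, HasDerivAt (fun r => ha.yosidaExp n r u - r • k)
      (ha.yosidaExp n r (ha.yosida n u) - k) r := fun r => by
    have h3 := (ha.hasDerivAt_yosidaExp n r).clm_apply (hasDerivAt_const r u)
    have h4 := h3.sub ((hasDerivAt_id r).smul_const k)
    refine h4.congr_deriv ?_
    simp
  have := norm_image_sub_le_of_norm_deriv_right_le_segment (a := 0) (b := t) (C := C)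
    (fun r _ => (hd r).continuousAt.continuousWithinAt) (fun r _ => (hd r).hasDerivWithinAt)
    hn t (right_mem_Icc.2 ht)
  simp only [yosidaExp_zero, zero_smul, sub_zero, one_apply_eq_self] at this
  rwa [sub_right_comm]

theorem norm_semigroup_sub_self_le {u h : H} (hu : FormGen D a u h) {t : ℝ} (ht : 0 ≤ t) {C : ℝ}
    (hC : ‖h‖ < C) : ‖ha.semigroup t u - u‖ ≤ C * t := by
  have := ha.norm_semigroup_sub_le (u := u) ht 0 (C := C) ?_
  · simpa using this
  · filter_upwards [(ha.yosida_tendsto hu).norm.eventually (gt_mem_nhds hC)] with n hn s hs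
    rw [sub_zero]
    exact (ha.norm_yosidaExp_le n hs.1 _).trans hn.le

theorem tendsto_semigroup_zero (f : H) :
    Tendsto (fun t => ha.semigroup t f) (𝓝[≥] 0) (𝓝 f) := by
  rw [Metric.tendsto_nhds]
  intro η hη
  obtain ⟨u, h, hu, huf⟩ := ha.exists_gen_near f (η := η / 3) (by positivity)
  have h1 : ∀ᶠ t : ℝ in 𝓝[≥] 0, t < η / 3 / (‖h‖ + 1) :=
    nhdsWithin_le_nhds (gt_mem_nhds (by positivity))
  filter_upwards [h1, self_mem_nhdsWithin] with t ht1 ht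
  have ht : 0 ≤ t := ht
  have h2 := ha.norm_semigroup_sub_self_le hu ht (lt_add_one ‖h‖)
  rw [lt_div_iff₀ (by positivity)] at ht1
  have h3 := ha.norm_semigroup_le ht (f - u)
  rw [norm_sub_rev f u] at h3
  rw [dist_eq_norm, show ha.semigroup t f - f = ha.semigroup t (f - u) +
    (ha.semigroup t u - u) + (u - f) by rw [map_sub]; abel]
  refine norm_add₃_le.trans_lt ?_
  linarith

theorem continuousOn_semigroup (f : H) : ContinuousOn (fun t => ha.semigroup t f) (Ici 0) := by
  have key : ∀ s t : ℝ, 0 ≤ s → 0 ≤ t →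
      ‖ha.semigroup s f - ha.semigroup t f‖ ≤ ‖ha.semigroup |s - t| f - f‖ := by
    intro s t hs ht
    rcases le_total s t with h | h
    · have h1 := ha.semigroup_add hs (sub_nonneg.2 h)
      rw [add_sub_cancel] at h1
      rw [abs_sub_comm, abs_of_nonneg (sub_nonneg.2 h), h1, norm_sub_rev,
        ContinuousLinearMap.comp_apply, ← map_sub]
      exact ha.norm_semigroup_le hs _
    · have h1 := ha.semigroup_add ht (sub_nonneg.2 h)
      rw [add_sub_cancel] at h1
      rw [abs_of_nonneg (sub_nonneg.2 h), h1, ContinuousLinearMap.comp_apply, ← map_sub]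
      exact ha.norm_semigroup_le ht _
  intro t ht
  rw [ContinuousWithinAt, tendsto_iff_norm_sub_tendsto_zero]
  refine squeeze_zero' (Eventually.of_forall fun s => norm_nonneg _)
    (by filter_upwards [self_mem_nhdsWithin] with s hs using key s t hs ht) ?_
  have h2 : Tendsto (fun s : ℝ => |s - t|) (𝓝[Ici 0] t) (𝓝[≥] 0) := by
    refine tendsto_nhdsWithin_iff.2 ⟨?_, Eventually.of_forall fun s => mem_Ici.2 (abs_nonneg _)⟩
    have : Tendsto (fun s : ℝ => |s - t|) (𝓝 t) (𝓝 |t - t|) :=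
      (continuous_id.sub continuous_const).abs.tendsto t
    simp only [sub_self, abs_zero] at this
    exact this.mono_left nhdsWithin_le_nhds
  exact (tendsto_iff_norm_sub_tendsto_zero.1 (ha.tendsto_semigroup_zero f)).comp h2

theorem tendsto_slope_of_gen {u h : H} (hu : FormGen D a u h) :
    Tendsto (fun t : ℝ => t⁻¹ • (ha.semigroup t u - u)) (𝓝[>] 0) (𝓝 h) := by
  rw [Metric.tendsto_nhds]
  intro η hη
  obtain ⟨v, k, hv, hvh⟩ := ha.exists_gen_near h (η := η / 5) (by positivity)
  have h1 : ∀ᶠ t : ℝ in 𝓝[>] 0, t < η / 5 / (‖k‖ + 1) :=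
    nhdsWithin_le_nhds (gt_mem_nhds (by positivity))
  filter_upwards [h1, self_mem_nhdsWithin] with t ht1 ht
  have ht : 0 < t := ht
  rw [lt_div_iff₀ (by positivity)] at ht1
  have h2 := ha.norm_semigroup_sub_le (u := u) ht.le h (C := 4 * (η / 5)) ?_
  · rw [dist_eq_norm, show t⁻¹ • (ha.semigroup t u - u) - h =
      t⁻¹ • (ha.semigroup t u - u - t • h) by
        rw [smul_sub t⁻¹ _ (t • h), smul_smul, inv_mul_cancel₀ ht.ne', one_smul], norm_smul,
      norm_inv, Real.norm_of_nonneg ht.le, inv_mul_lt_iff₀ ht]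
    nlinarith
  · have e1 : ∀ᶠ n in atTop, ‖ha.yosida n u - h‖ < η / 5 := by
      simpa [dist_eq_norm] using
        Metric.tendsto_nhds.1 (ha.yosida_tendsto hu) (η / 5) (by positivity)
    have e2 : ∀ᶠ n in atTop, ‖ha.yosida n v‖ < ‖k‖ + 1 :=
      (ha.yosida_tendsto hv).norm.eventually (gt_mem_nhds (lt_add_one _))
    filter_upwards [e1, e2] with n hn1 hn2 s hs
    have a1 := ha.norm_yosidaExp_le n hs.1 (ha.yosida n u - h)
    have a2 := ha.norm_yosidaExp_le n hs.1 (h - v)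
    rw [norm_sub_rev h v] at a2
    have a3 : ‖ha.yosidaExp n s v - v‖ ≤ ‖ha.yosida n v‖ * s := by
      have hd : ∀ r : ℝ, HasDerivAt (fun r => ha.yosidaExp n r v)
          (ha.yosidaExp n r (ha.yosida n v)) r := fun r => by
        have h3 := (ha.hasDerivAt_yosidaExp n r).clm_apply (hasDerivAt_const r v)
        refine h3.congr_deriv ?_
        simp
      have := norm_image_sub_le_of_norm_deriv_right_le_segment (a := 0) (b := s)
        (fun r _ => (hd r).continuousAt.continuousWithinAt) (fun r _ => (hd r).hasDerivWithinAt)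
        (fun r hr => ha.norm_yosidaExp_le n hr.1 (ha.yosida n v)) s (right_mem_Icc.2 hs.1)
      simpa [yosidaExp_zero] using this
    have a4 : ‖ha.yosidaExp n s v - v‖ ≤ η / 5 := by
      refine a3.trans (le_trans ?_ ht1.le)
      rw [mul_comm]
      exact mul_le_mul hs.2.le hn2.le (norm_nonneg _) ht.le
    rw [show ha.yosidaExp n s (ha.yosida n u) - h = ha.yosidaExp n s (ha.yosida n u - h) +
      ha.yosidaExp n s (h - v) + (ha.yosidaExp n s v - v) + (v - h) by
        rw [map_sub, map_sub]; abel]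
    refine norm_add₄_le.trans ?_
    linarith

theorem gen_of_tendsto_slope {f k : H}
    (hf : Tendsto (fun t : ℝ => t⁻¹ • (ha.semigroup t f - f)) (𝓝[>] 0) (𝓝 k)) :
    FormGen D a f k := by
  have gu := ha.gen_res one_pos (f - k)
  set u := ha.res 1 (f - k) with hu
  rw [inv_one, one_smul] at gu
  have h1 := (ha.tendsto_slope_of_gen gu).sub hf
  have h2 : Tendsto (fun t : ℝ => t⁻¹ • (ha.semigroup t (u - f) - (u - f))) (𝓝[>] 0)
      (𝓝 (u - f)) := by
    rw [show u - (f - k) - k = u - f by abel] at h1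
    refine h1.congr fun t => ?_
    rw [← smul_sub, map_sub]; congr 1; abel
  have h3 : inner ℝ (u - f) (u - f) ≤ (0 : ℝ) := by
    refine le_of_tendsto (h2.inner tendsto_const_nhds) ?_
    filter_upwards [self_mem_nhdsWithin] with t ht
    have ht : 0 < t := ht
    rw [real_inner_smul_left, inner_sub_left, real_inner_self_eq_norm_sq]
    have h4 := (real_inner_le_norm (ha.semigroup t (u - f)) (u - f)).trans
      (mul_le_mul_of_nonneg_right (ha.norm_semigroup_le ht.le _) (norm_nonneg _))
    refine mul_nonpos_of_nonneg_of_nonpos (inv_nonneg.2 ht.le) ?_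
    nlinarith
  have h4 : u = f := by
    rw [real_inner_self_eq_norm_sq] at h3
    exact sub_eq_zero.1 (norm_eq_zero.1
      (pow_eq_zero_iff two_ne_zero |>.1 (le_antisymm h3 (sq_nonneg _))))
  rw [h4] at gu
  rwa [show f - (f - k) = k by abel] at gu

/-- A strongly continuous semigroup whose generator is that of the form. -/
structure _root_.IsSemigroupOf (D : Submodule ℝ H) (a : H → H → ℝ) (P : ℝ → H →L[ℝ] H) :
    Prop where
  zero : P 0 = ContinuousLinearMap.id ℝ H
  add : ∀ s t : ℝ, 0 ≤ s → 0 ≤ t → P (s + t) = (P s).comp (P t)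
  cont : ∀ f, ContinuousOn (fun t => P t f) (Ici 0)
  gen : ∀ f h, Tendsto (fun t : ℝ => t⁻¹ • (P t f - f)) (𝓝[>] 0) (𝓝 h) ↔ FormGen D a f h

theorem isSemigroupOf_semigroup : IsSemigroupOf D a ha.semigroup where
  zero := ha.semigroup_zero
  add _ _ hs ht := ha.semigroup_add hs ht
  cont := ha.continuousOn_semigroup
  gen _ _ := ⟨ha.gen_of_tendsto_slope, ha.tendsto_slope_of_gen⟩

theorem _root_.IsSemigroupOf.gen_apply {P : ℝ → H →L[ℝ] H} (hP : IsSemigroupOf D a P) {u h : H}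
    (hu : FormGen D a u h) {t : ℝ} (ht : 0 ≤ t) : FormGen D a (P t u) (P t h) := by
  rw [← hP.gen]
  have h1 := ((P t).continuous.tendsto h).comp ((hP.gen u h).2 hu)
  refine h1.congr' ?_
  filter_upwards [self_mem_nhdsWithin] with s hs
  have hs : 0 < s := hs
  have h2 := hP.add s t hs.le ht
  have h3 := hP.add t s ht hs.le
  rw [add_comm, h3] at h2
  have h4 := DFunLike.congr_fun h2 u
  simp only [ContinuousLinearMap.comp_apply] at h4
  rw [Function.comp, map_smul, map_sub, h4]

theorem _root_.IsSemigroupOf.hasDerivWithinAt {P : ℝ → H →L[ℝ] H} (hP : IsSemigroupOf D a P)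
    {u h : H} (hu : FormGen D a u h) {t : ℝ} (ht : 0 ≤ t) :
    HasDerivWithinAt (fun t => P t u) (P t h) (Ici t) t := by
  rw [hasDerivWithinAt_iff_tendsto_slope, Ici_sdiff_left]
  have h1 := (hP.gen _ _).2 (hP.gen_apply hu ht)
  have h2 : Tendsto (fun s : ℝ => s - t) (𝓝[>] t) (𝓝[>] 0) := by
    refine tendsto_nhdsWithin_iff.2 ⟨?_, ?_⟩
    · have : Tendsto (fun s : ℝ => s - t) (𝓝 t) (𝓝 (t - t)) :=
        (continuous_id.sub continuous_const).tendsto t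
      rw [sub_self] at this
      exact this.mono_left nhdsWithin_le_nhds
    · filter_upwards [self_mem_nhdsWithin] with s hs using mem_Ioi.2 (sub_pos.2 (mem_Ioi.1 hs))
  refine (h1.comp h2).congr' ?_
  filter_upwards [self_mem_nhdsWithin] with s hs
  have hs : 0 ≤ s - t := (sub_pos.2 hs).le
  have h3 := hP.add (s - t) t hs ht
  rw [sub_add_cancel] at h3
  simp only [Function.comp, slope_def_module, h3, ContinuousLinearMap.comp_apply]

theorem _root_.IsSemigroupOf.hasDerivWithinAt_norm_sq {P : ℝ → H →L[ℝ] H}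
    (hP : IsSemigroupOf D a P) {u h : H} (hu : FormGen D a u h) {t : ℝ} (ht : 0 ≤ t) :
    HasDerivWithinAt (fun t => ‖P t u‖ ^ 2) (-2 * a (P t u) (P t u)) (Ici t) t := by
  have h1 := (hP.hasDerivWithinAt hu ht).norm_sq
  refine h1.congr_deriv ?_
  have h2 := hP.gen_apply hu ht
  rw [h2.2 _ h2.1, real_inner_comm]; ring

/-- A semigroup is determined by its generator. -/
theorem eq_semigroup {P : ℝ → H →L[ℝ] H} (hP : IsSemigroupOf D a P) {t : ℝ} (ht : 0 ≤ t) :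
    P t = ha.semigroup t := by
  have hQ := ha.isSemigroupOf_semigroup
  have key : ∀ u h, FormGen D a u h → P t u = ha.semigroup t u := by
    intro u h hu
    have h1 := image_le_of_deriv_right_le_deriv_boundary (a := 0) (b := t)
      (f := fun r => ‖P r u - ha.semigroup r u‖ ^ 2) (B := fun _ => 0) (B' := fun _ => 0)
      ((((hP.cont u).sub (hQ.cont u)).norm.pow 2).mono Icc_subset_Ici_self)
      (fun r hr => ((hP.hasDerivWithinAt hu hr.1).sub (hQ.hasDerivWithinAt hu hr.1)).norm_sq)
      (by simp [hP.zero, hQ.zero]) continuousOn_const (fun _ _ => hasDerivWithinAt_const _ _ _)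
      (fun r hr => by
        have := ha.gen_inner_nonpos (ha.gen_sub (hP.gen_apply hu hr.1) (hQ.gen_apply hu hr.1))
        rw [real_inner_comm]
        simp only [Pi.sub_apply]
        linarith) (right_mem_Icc.2 ht)
    have h2 : ‖P t u - ha.semigroup t u‖ = 0 :=
      pow_eq_zero_iff two_ne_zero |>.1 (le_antisymm h1 (sq_nonneg _))
    exact sub_eq_zero.1 (norm_eq_zero.1 h2)
  have hd : Dense {u : H | ∃ h, FormGen D a u h} := by
    refine Metric.dense_iff.2 fun f η hη => ?_
    obtain ⟨u, h, hu, huf⟩ := ha.exists_gen_near f hη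
    exact ⟨u, by simpa [dist_eq_norm] using huf, h, hu⟩
  exact DFunLike.coe_injective
    (Continuous.ext_on hd (P t).continuous (ha.semigroup t).continuous
      fun u ⟨h, hu⟩ => key u h hu)

end IsClosedForm

end ClosedFormSemigroup

section StableForm

variable {d : ℕ} {α : ℝ} {V : EuclideanSpace ℝ (Fin d) → ℝ}

/-- The energy `E(f,f) ∈ [0,∞]`. -/
noncomputable def energy (α : ℝ) (V : EuclideanSpace ℝ (Fin d) → ℝ)
    (f : EuclideanSpace ℝ (Fin d) → ℝ) : ℝ≥0∞ :=
  ∫⁻ p : EuclideanSpace ℝ (Fin d) × EuclideanSpace ℝ (Fin d),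
    ENNReal.ofReal ((f p.1 - f p.2) ^ 2 / ‖p.1 - p.2‖ ^ ((d : ℝ) + α)) ∂((gibbs V).prod volume)

/-- The difference quotient whose square is the density of the energy. -/
noncomputable def diffQuot (α : ℝ) (f : EuclideanSpace ℝ (Fin d) → ℝ)
    (p : EuclideanSpace ℝ (Fin d) × EuclideanSpace ℝ (Fin d)) : ℝ :=
  (f p.1 - f p.2) / ‖p.1 - p.2‖ ^ (((d : ℝ) + α) / 2)

theorem diffQuot_mul (f g : EuclideanSpace ℝ (Fin d) → ℝ)
    (p : EuclideanSpace ℝ (Fin d) × EuclideanSpace ℝ (Fin d)) :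
    diffQuot α f p * diffQuot α g p =
      (f p.1 - f p.2) * (g p.1 - g p.2) / ‖p.1 - p.2‖ ^ ((d : ℝ) + α) := by
  rw [diffQuot, diffQuot, div_mul_div_comm, ← pow_two (‖p.1 - p.2‖ ^ _), ← Real.rpow_natCast,
    ← Real.rpow_mul (norm_nonneg _)]
  congr 2
  push_cast; ring

theorem stableForm_eq (f g : EuclideanSpace ℝ (Fin d) → ℝ) :
    stableForm α V f g = ∫ p, diffQuot α f p * diffQuot α g p ∂((gibbs V).prod volume) := by
  simp_rw [diffQuot_mul]; rfl

theorem energy_eq (f : EuclideanSpace ℝ (Fin d) → ℝ) :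
    energy α V f = ∫⁻ p, ENNReal.ofReal (diffQuot α f p ^ 2) ∂((gibbs V).prod volume) := by
  simp_rw [pow_two, diffQuot_mul, ← pow_two]; rfl

theorem diffQuot_add (f g : EuclideanSpace ℝ (Fin d) → ℝ) :
    diffQuot α (f + g) = diffQuot α f + diffQuot α g := by
  ext p; simp only [diffQuot, Pi.add_apply]; ring

theorem diffQuot_smul (c : ℝ) (f : EuclideanSpace ℝ (Fin d) → ℝ) :
    diffQuot α (c • f) = c • diffQuot α f := by
  ext p; simp only [diffQuot, Pi.smul_apply, smul_eq_mul]; ring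

theorem diffQuot_congr (hV : volume ≪ gibbs V) {f g : EuclideanSpace ℝ (Fin d) → ℝ} (h : f =ᵐ[gibbs V] g) :
    diffQuot α f =ᵐ[(gibbs V).prod volume] diffQuot α g := by
  have h1 := Measure.quasiMeasurePreserving_fst (μ := gibbs V)
    (ν := (volume : Measure (EuclideanSpace ℝ (Fin d)))) |>.ae_eq_comp h
  have h2 := Measure.quasiMeasurePreserving_snd (μ := gibbs V)
    (ν := (volume : Measure (EuclideanSpace ℝ (Fin d)))) |>.ae_eq_comp (hV.ae_le h)
  filter_upwards [h1, h2] with p e1 e2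
  simp only [Function.comp] at e1 e2
  simp only [diffQuot, e1, e2]

theorem aestronglyMeasurable_diffQuot (hV : volume ≪ gibbs V) {f : EuclideanSpace ℝ (Fin d) → ℝ}
    (hf : AEStronglyMeasurable f (gibbs V)) :
    AEStronglyMeasurable (diffQuot α f) ((gibbs V).prod volume) := by
  have hm : Measurable fun p : EuclideanSpace ℝ (Fin d) × EuclideanSpace ℝ (Fin d) =>
      ‖p.1 - p.2‖ ^ (((d : ℝ) + α) / 2) :=
    (measurable_fst.sub measurable_snd).norm.pow_const _
  exact ((hf.comp_fst.sub (hf.mono_ac hV).comp_snd).aemeasurable.div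
    hm.aemeasurable).aestronglyMeasurable

theorem energy_congr (hV : volume ≪ gibbs V) {f g : EuclideanSpace ℝ (Fin d) → ℝ} (h : f =ᵐ[gibbs V] g) :
    energy α V f = energy α V g := by
  rw [energy_eq, energy_eq]
  refine lintegral_congr_ae ?_
  filter_upwards [diffQuot_congr hV (α := α) h] with p hp
  rw [hp]

theorem stableForm_congr (hV : volume ≪ gibbs V) {f f' g g' : EuclideanSpace ℝ (Fin d) → ℝ} (h : f =ᵐ[gibbs V] f')
    (h' : g =ᵐ[gibbs V] g') : stableForm α V f g = stableForm α V f' g' := by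
  rw [stableForm_eq, stableForm_eq]
  refine integral_congr_ae ?_
  filter_upwards [diffQuot_congr hV (α := α) h, diffQuot_congr hV (α := α) h'] with p hp hp'
  rw [hp, hp']

theorem formDomain_congr (hV : volume ≪ gibbs V) {f g : EuclideanSpace ℝ (Fin d) → ℝ} (h : f =ᵐ[gibbs V] g) :
    FormDomain α V f ↔ FormDomain α V g := by
  have h1 : energy α V f < ∞ ↔ energy α V g < ∞ := by rw [energy_congr hV h]
  exact and_congr (memLp_congr_ae h) h1

theorem formDomain_iff (hV : volume ≪ gibbs V) {f : EuclideanSpace ℝ (Fin d) → ℝ} :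
    FormDomain α V f ↔ MemLp f 2 (gibbs V) ∧ MemLp (diffQuot α f) 2 ((gibbs V).prod volume) := by
  refine and_congr_right fun hf => ?_
  change energy α V f < ∞ ↔ _
  have hm := aestronglyMeasurable_diffQuot hV (α := α) hf.1
  rw [memLp_two_iff_integrable_sq hm, energy_eq, Integrable, hasFiniteIntegral_iff_ofReal (Eventually.of_forall fun p => sq_nonneg _)]
  exact (and_iff_right (hm.pow 2)).symm

theorem FormDomain.ofReal_stableForm (hV : volume ≪ gibbs V) {f : EuclideanSpace ℝ (Fin d) → ℝ} (hf : FormDomain α V f) :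
    ENNReal.ofReal (stableForm α V f f) = energy α V f := by
  have h := (formDomain_iff hV).1 hf
  rw [stableForm_eq, energy_eq]
  simp_rw [← pow_two]
  exact ofReal_integral_eq_lintegral_ofReal
    ((memLp_two_iff_integrable_sq h.2.1).1 h.2) (Eventually.of_forall fun p => sq_nonneg _)

theorem stableForm_self_nonneg (f : EuclideanSpace ℝ (Fin d) → ℝ) : 0 ≤ stableForm α V f f := by
  rw [stableForm_eq]; exact integral_nonneg fun p => mul_self_nonneg _

/-- The domain of the form as a subspace of `L²`. -/
noncomputable def formDom (α : ℝ) (hV : volume ≪ gibbs V) : Submodule ℝ (Lp ℝ 2 (gibbs V)) where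
  carrier := {f | FormDomain α V f}
  zero_mem' := by
    rw [mem_ofPred_eq, formDomain_congr hV (Lp.coeFn_zero _ _ _), formDomain_iff hV]
    refine ⟨MemLp.zero, ?_⟩
    have : diffQuot α (0 : EuclideanSpace ℝ (Fin d) → ℝ) = 0 := by ext p; simp [diffQuot]
    rw [this]; exact MemLp.zero
  add_mem' := fun {f g} hf hg => by
    rw [mem_ofPred_eq, formDomain_iff hV] at *
    refine ⟨Lp.memLp _, ?_⟩
    rw [memLp_congr_ae (diffQuot_congr hV (Lp.coeFn_add f g)), diffQuot_add]
    exact hf.2.add hg.2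
  smul_mem' := fun c f hf => by
    rw [mem_ofPred_eq, formDomain_iff hV] at *
    refine ⟨Lp.memLp _, ?_⟩
    rw [memLp_congr_ae (diffQuot_congr hV (Lp.coeFn_smul c f)), diffQuot_smul]
    exact hf.2.const_smul c

theorem mem_formDom (hV : volume ≪ gibbs V) {f : Lp ℝ 2 (gibbs V)} : f ∈ formDom α hV ↔ FormDomain α V f := Iff.rfl

theorem stableForm_add_left (hV : volume ≪ gibbs V) {f g h : Lp ℝ 2 (gibbs V)} (hf : FormDomain α V f)
    (hg : FormDomain α V g) (hh : FormDomain α V h) :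
    stableForm α V (f + g : Lp ℝ 2 (gibbs V)) h = stableForm α V f h + stableForm α V g h := by
  rw [formDomain_iff hV] at hf hg hh
  rw [stableForm_congr hV (Lp.coeFn_add f g) ae_eq_rfl, stableForm_eq, stableForm_eq,
    stableForm_eq]
  simp_rw [diffQuot_add, Pi.add_apply, add_mul]
  exact integral_add (hf.2.integrable_mul hh.2) (hg.2.integrable_mul hh.2)

theorem stableForm_smul_left (hV : volume ≪ gibbs V) (c : ℝ) (f h : Lp ℝ 2 (gibbs V)) :
    stableForm α V (c • f : Lp ℝ 2 (gibbs V)) h = c * stableForm α V f h := by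
  rw [stableForm_congr hV (Lp.coeFn_smul c f) ae_eq_rfl, stableForm_eq, stableForm_eq,
    ← integral_const_mul]
  simp_rw [diffQuot_smul, Pi.smul_apply, smul_eq_mul, mul_assoc]

theorem stableForm_comm (f g : EuclideanSpace ℝ (Fin d) → ℝ) :
    stableForm α V f g = stableForm α V g f := by
  rw [stableForm_eq, stableForm_eq]; simp_rw [mul_comm]

/-- The graph of `s` times the difference quotient map, in `L²(μ) × L²(μ ⊗ dy)`. -/
noncomputable def diffQuotGraph (α : ℝ) (hV : volume ≪ gibbs V) (s : ℝ) :
    Submodule ℝ (WithLp 2 (Lp ℝ 2 (gibbs V) × Lp ℝ 2 ((gibbs V).prod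
      (volume : Measure (EuclideanSpace ℝ (Fin d)))))) where
  carrier := {p | p.snd =ᵐ[(gibbs V).prod volume] s • diffQuot α p.fst}
  zero_mem' := by
    have h1 := diffQuot_congr hV (α := α) (Lp.coeFn_zero ℝ 2 (gibbs V))
    have h2 := Lp.coeFn_zero ℝ 2 ((gibbs V).prod (volume : Measure (EuclideanSpace ℝ (Fin d))))
    filter_upwards [h1, h2] with p e1 e2
    simp only [WithLp.zero_snd, WithLp.zero_fst, Pi.smul_apply, e1, e2]
    simp [diffQuot]
  add_mem' := fun {p q} hp hq => by
    change (p + q).snd =ᵐ[(gibbs V).prod volume] s • diffQuot α (p + q).fst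
    have h1 := diffQuot_congr hV (α := α) (Lp.coeFn_add p.fst q.fst)
    have h2 := Lp.coeFn_add p.snd q.snd
    filter_upwards [h1, h2, hp, hq] with x e1 e2 e3 e4
    simp only [WithLp.add_snd, WithLp.add_fst, Pi.smul_apply, e1, e2, diffQuot_add, Pi.add_apply,
      e3, e4, smul_add]
  smul_mem' := fun c p hp => by
    change (c • p).snd =ᵐ[(gibbs V).prod volume] s • diffQuot α (c • p).fst
    have h1 := diffQuot_congr hV (α := α) (Lp.coeFn_smul c p.fst)
    have h2 := Lp.coeFn_smul c p.snd
    filter_upwards [h1, h2, hp] with x e1 e2 e3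
    simp only [WithLp.smul_snd, WithLp.smul_fst, Pi.smul_apply, e1, e2, diffQuot_smul, e3]
    rw [smul_comm]

theorem isClosed_diffQuotGraph (hV : volume ≪ gibbs V) (s : ℝ) :
    IsClosed (diffQuotGraph α hV s : Set (WithLp 2 (Lp ℝ 2 (gibbs V) × Lp ℝ 2 ((gibbs V).prod
      (volume : Measure (EuclideanSpace ℝ (Fin d))))))) := by
  refine IsSeqClosed.isClosed fun p q hp hpq => ?_
  have c1 : Tendsto (fun n => (p n).fst) atTop (𝓝 q.fst) :=
    ((WithLp.prod_continuous_ofLp 2 _ _).fst.tendsto q).comp hpq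
  have c2 : Tendsto (fun n => (p n).snd) atTop (𝓝 q.snd) :=
    ((WithLp.prod_continuous_ofLp 2 _ _).snd.tendsto q).comp hpq
  obtain ⟨n1, hn1, h1⟩ := (tendstoInMeasure_of_tendsto_Lp c1).exists_seq_tendsto_ae
  obtain ⟨n2, hn2, h2⟩ :=
    (tendstoInMeasure_of_tendsto_Lp (c2.comp hn1.tendsto_atTop)).exists_seq_tendsto_ae
  have h3 := Measure.quasiMeasurePreserving_fst (μ := gibbs V)
    (ν := (volume : Measure (EuclideanSpace ℝ (Fin d)))) |>.ae h1
  have h4 := Measure.quasiMeasurePreserving_snd (μ := gibbs V)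
    (ν := (volume : Measure (EuclideanSpace ℝ (Fin d)))) |>.ae (hV.ae_le h1)
  have h5 : ∀ᵐ x ∂(gibbs V).prod volume, ∀ n, (p n).snd x = (s • diffQuot α (p n).fst) x :=
    ae_all_iff.2 hp
  change q.snd =ᵐ[(gibbs V).prod volume] s • diffQuot α q.fst
  filter_upwards [h2, h3, h4, h5] with x e2 e3 e4 e5
  refine tendsto_nhds_unique e2 ?_
  simp only [Function.comp, e5]
  simp only [Pi.smul_apply, diffQuot]
  exact (((e3.comp hn2.tendsto_atTop).sub (e4.comp hn2.tendsto_atTop)).div_const _).const_smul s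

theorem exists_stableForm_resolvent (hV : volume ≪ gibbs V) [SigmaFinite (gibbs V)] {s : ℝ} (hs : 0 < s)
    (f : Lp ℝ 2 (gibbs V)) :
    ∃ u ∈ formDom α hV, ∀ g ∈ formDom α hV,
      s * stableForm α V u g + inner ℝ u g = inner ℝ f g := by
  set G := diffQuotGraph α hV (√s) with hG
  have hs' : √s ≠ 0 := (Real.sqrt_pos.2 hs).ne'
  have : CompleteSpace G := (isClosed_diffQuotGraph hV (√s)).completeSpace_coe
  set q := G.starProjection (WithLp.toLp 2 (f, 0)) with hq
  have hqG : q ∈ G := G.starProjection_apply_mem _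
  have hqG' : q.snd =ᵐ[(gibbs V).prod volume] √s • diffQuot α q.fst := hqG
  refine ⟨q.fst, ?_, fun g hg => ?_⟩
  · rw [mem_formDom, formDomain_iff hV]
    refine ⟨Lp.memLp _, ?_⟩
    have h1 : MemLp ((√s)⁻¹ • (q.snd : _ → ℝ)) 2 ((gibbs V).prod volume) :=
      (Lp.memLp q.snd).const_smul _
    refine (memLp_congr_ae ?_).1 h1
    filter_upwards [hqG'] with x hx
    simp [hx, hs']
  · have hg' := ((formDomain_iff hV).1 hg).2
    have hgm : MemLp (√s • diffQuot α g) 2 ((gibbs V).prod volume) := hg'.const_smul _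
    have hgG : (WithLp.toLp 2 (g, hgm.toLp) : WithLp 2 (Lp ℝ 2 (gibbs V) × Lp ℝ 2 ((gibbs V).prod
      (volume : Measure (EuclideanSpace ℝ (Fin d)))))) ∈ G := hgm.coeFn_toLp
    have h2 := (Submodule.mem_orthogonal' _ _).1
      (G.sub_starProjection_mem_orthogonal (WithLp.toLp 2 (f, 0))) _ hgG
    rw [← hq, inner_sub_left, WithLp.prod_inner_apply, WithLp.prod_inner_apply] at h2
    simp only [inner_zero_left, add_zero] at h2
    have h3 : inner ℝ q.snd hgm.toLp = s * stableForm α V q.fst g := by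
      rw [L2.inner_def, stableForm_eq, ← integral_const_mul]
      refine integral_congr_ae ?_
      filter_upwards [hqG', hgm.coeFn_toLp] with x e1 e2
      simp only [e1, e2, Pi.smul_apply, smul_eq_mul]
      rw [real_inner_eq_re_inner]
      simp only [RCLike.inner_apply, conj_trivial, RCLike.re_to_real]
      linear_combination (diffQuot α q.fst x * diffQuot α g x) * Real.mul_self_sqrt hs.le
    rw [← h3]
    change inner ℝ q.snd hgm.toLp + inner ℝ q.fst g = _
    change inner ℝ f g - (inner ℝ q.fst g + inner ℝ q.snd hgm.toLp) = 0 at h2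
    linarith

/-- The integrable kernel `min(1, |z|²) / |z|^(d+α)`. -/
noncomputable def levyKernel (d : ℕ) (α : ℝ) (z : EuclideanSpace ℝ (Fin d)) : ℝ :=
  min 1 (‖z‖ ^ 2) / ‖z‖ ^ ((d : ℝ) + α)

theorem levyKernel_nonneg (z : EuclideanSpace ℝ (Fin d)) : 0 ≤ levyKernel d α z := by
  rw [levyKernel]; positivity

theorem integrable_levyKernel (hd : 1 ≤ d) (hα0 : 0 < α) (hα2 : α < 2) :
    Integrable (levyKernel d α) := by
  have : Nonempty (Fin d) := ⟨⟨0, hd⟩⟩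
  have : Nontrivial (EuclideanSpace ℝ (Fin d)) :=
    Module.nontrivial_of_finrank_pos (R := ℝ) (by rw [finrank_euclideanSpace_fin]; omega)
  have h := (integrable_fun_norm_addHaar (E := EuclideanSpace ℝ (Fin d)) volume
    (f := fun r : ℝ => min 1 (r ^ 2) / r ^ ((d : ℝ) + α))).2 ?_
  · exact h
  rw [finrank_euclideanSpace_fin, ← Ioc_union_Ioi_eq_Ioi zero_le_one]
  have key : ∀ y : ℝ, 0 < y → y ^ (d - 1) / y ^ ((d : ℝ) + α) = y ^ (-1 - α) := fun y hy => by
    rw [← Real.rpow_natCast, ← Real.rpow_sub hy, Nat.cast_sub hd]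
    congr 1; push_cast; ring
  refine IntegrableOn.union ?_ ?_
  · have h1 : IntegrableOn (fun y : ℝ => y ^ (1 - α)) (Ioc 0 1) := by
      have := intervalIntegral.intervalIntegrable_rpow' (a := 0) (b := 1) (r := 1 - α)
        (by linarith)
      rwa [intervalIntegrable_iff_integrableOn_Ioc_of_le zero_le_one] at this
    refine h1.congr_fun (fun y hy => ?_) measurableSet_Ioc
    have h2 : min 1 (y ^ 2) = y ^ 2 := min_eq_right (by nlinarith [hy.1, hy.2])
    simp only [h2, smul_eq_mul]
    rw [mul_div_left_comm, key y hy.1, ← Real.rpow_natCast y 2, ← Real.rpow_add hy.1]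
    congr 1; push_cast; ring
  · refine (integrableOn_Ioi_rpow_of_lt (a := -1 - α) (by linarith) one_pos).congr_fun
      (fun y hy => ?_) measurableSet_Ioi
    have hy : 1 < y := hy
    have h2 : min 1 (y ^ 2) = 1 := min_eq_left (by nlinarith)
    simp only [h2, smul_eq_mul]
    rw [mul_one_div, key y (by linarith)]

theorem lintegral_levyKernel_smul (hd : 1 ≤ d) (hα0 : 0 < α) (hα2 : α < 2) {R : ℝ} (hR : 0 < R) :
    ∫⁻ z : EuclideanSpace ℝ (Fin d),
        ENNReal.ofReal (min 1 (‖R⁻¹ • z‖ ^ 2) / ‖z‖ ^ ((d : ℝ) + α)) =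
      ENNReal.ofReal (R ^ (-α) * ∫ z, levyKernel d α z) := by
  have h1 : ∀ z : EuclideanSpace ℝ (Fin d), min 1 (‖R⁻¹ • z‖ ^ 2) / ‖z‖ ^ ((d : ℝ) + α) =
      R ^ (-((d : ℝ) + α)) * levyKernel d α (R⁻¹ • z) := fun z => by
    rw [levyKernel, norm_smul, norm_inv, Real.norm_of_nonneg hR.le,
      Real.mul_rpow (by positivity) (norm_nonneg _), Real.inv_rpow hR.le, Real.rpow_neg hR.le]
    have := Real.rpow_pos_of_pos hR ((d : ℝ) + α)
    field_simp
  simp_rw [h1]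
  have hint := ((integrable_levyKernel hd hα0 hα2).comp_smul (inv_ne_zero hR.ne')).const_mul
    (R ^ (-((d : ℝ) + α)))
  rw [← ofReal_integral_eq_lintegral_ofReal hint (Eventually.of_forall fun z =>
    mul_nonneg (by positivity) (levyKernel_nonneg _)), integral_const_mul,
    Measure.integral_comp_inv_smul, finrank_euclideanSpace_fin, abs_of_pos (pow_pos hR _),
    smul_eq_mul, ← mul_assoc, ← Real.rpow_natCast, ← Real.rpow_add hR]
  congr 3; ring

/-- Energy bound for functions that are bounded and Lipschitz on the scale `R`. -/
theorem energy_le_of_lipschitz [IsProbabilityMeasure (gibbs V)] (hd : 1 ≤ d) (hα0 : 0 < α)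
    (hα2 : α < 2) {R A : ℝ} (hR : 0 < R) (hA : 0 ≤ A) {f : EuclideanSpace ℝ (Fin d) → ℝ}
    (hf : ∀ x y, (f x - f y) ^ 2 ≤ A * min 1 (‖R⁻¹ • (x - y)‖ ^ 2)) :
    energy α V f ≤ ENNReal.ofReal (A * (R ^ (-α) * ∫ z, levyKernel d α z)) := by
  have hm : Measurable fun p : EuclideanSpace ℝ (Fin d) × EuclideanSpace ℝ (Fin d) =>
      ENNReal.ofReal A *
        ENNReal.ofReal (min 1 (‖R⁻¹ • (p.1 - p.2)‖ ^ 2) / ‖p.1 - p.2‖ ^ ((d : ℝ) + α)) := by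
    fun_prop
  calc energy α V f ≤ ∫⁻ p : EuclideanSpace ℝ (Fin d) × EuclideanSpace ℝ (Fin d),
      ENNReal.ofReal A * ENNReal.ofReal
        (min 1 (‖R⁻¹ • (p.1 - p.2)‖ ^ 2) / ‖p.1 - p.2‖ ^ ((d : ℝ) + α))
        ∂((gibbs V).prod volume) := by
        refine lintegral_mono fun p => ?_
        rw [← ENNReal.ofReal_mul hA]
        refine ENNReal.ofReal_le_ofReal ?_
        rw [← mul_div_assoc]
        exact div_le_div_of_nonneg_right (hf _ _) (by positivity)
    _ = _ := by
        rw [lintegral_prod _ hm.aemeasurable]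
        have h1 : ∀ x : EuclideanSpace ℝ (Fin d), ∫⁻ y : EuclideanSpace ℝ (Fin d),
            ENNReal.ofReal A * ENNReal.ofReal
              (min 1 (‖R⁻¹ • (x - y)‖ ^ 2) / ‖x - y‖ ^ ((d : ℝ) + α)) =
            ENNReal.ofReal (A * (R ^ (-α) * ∫ z, levyKernel d α z)) := fun x => by
          rw [ENNReal.ofReal_mul hA, ← lintegral_levyKernel_smul hd hα0 hα2 hR,
            lintegral_const_mul _ (by fun_prop)]
          congr 1
          exact lintegral_sub_left_eq_self (fun z => ENNReal.ofReal
            (min 1 (‖R⁻¹ • z‖ ^ 2) / ‖z‖ ^ ((d : ℝ) + α))) x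
        simp_rw [h1]
        simp

theorem formDomain_of_lipschitz [IsProbabilityMeasure (gibbs V)] (hd : 1 ≤ d) (hα0 : 0 < α)
    (hα2 : α < 2) {R A : ℝ} (hR : 0 < R) (hA : 0 ≤ A) {f : EuclideanSpace ℝ (Fin d) → ℝ}
    (hf : ∀ x y, (f x - f y) ^ 2 ≤ A * min 1 (‖R⁻¹ • (x - y)‖ ^ 2))
    (hfm : MemLp f 2 (gibbs V)) : FormDomain α V f :=
  ⟨hfm, (energy_le_of_lipschitz hd hα0 hα2 hR hA hf).trans_lt ENNReal.ofReal_lt_top⟩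

theorem dense_formDom [IsProbabilityMeasure (gibbs V)] (hV : volume ≪ gibbs V) (hd : 1 ≤ d)
    (hα0 : 0 < α) (hα2 : α < 2) : Dense (formDom α hV : Set (Lp ℝ 2 (gibbs V))) := by
  refine (Lp.dense_hasCompactSupport_contDiff (μ := gibbs V) (p := 2) (F := ℝ)
    ENNReal.ofNat_ne_top).mono ?_
  rintro f ⟨g, hfg, hgc, hgd⟩
  rw [SetLike.mem_coe, mem_formDom, formDomain_congr hV hfg]
  obtain ⟨K, hK⟩ := hgd.lipschitzWith_of_hasCompactSupport hgc (by simp)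
  obtain ⟨C, hC⟩ := hgc.exists_bound_of_continuous hgd.continuous
  refine formDomain_of_lipschitz hd hα0 hα2 one_pos
    (A := (2 * C) ^ 2 + (K : ℝ) ^ 2) (by positivity) (fun x y => ?_)
    ((memLp_congr_ae hfg).1 (Lp.memLp f))
  have h1 : |g x - g y| ≤ 2 * C := by
    have := abs_sub (g x) (g y)
    have h1 := hC x
    have h2 := hC y
    rw [Real.norm_eq_abs] at h1 h2
    linarith
  have h2 : |g x - g y| ≤ K * ‖x - y‖ := by
    simpa [Real.dist_eq, dist_eq_norm] using hK.dist_le_mul x y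
  have h3 : (g x - g y) ^ 2 ≤ (2 * C) ^ 2 := by
    rw [← sq_abs]; exact pow_le_pow_left₀ (abs_nonneg _) h1 2
  have h4 : (g x - g y) ^ 2 ≤ (K : ℝ) ^ 2 * ‖x - y‖ ^ 2 := by
    rw [← sq_abs, ← mul_pow]; exact pow_le_pow_left₀ (abs_nonneg _) h2 2
  rw [inv_one, one_smul]
  rcases min_choice (1 : ℝ) (‖x - y‖ ^ 2) with h | h <;> rw [h] <;>
    nlinarith [sq_nonneg (2 * C), sq_nonneg (K : ℝ), sq_nonneg ‖x - y‖,
      mul_nonneg (sq_nonneg (2 * C)) (sq_nonneg ‖x - y‖)]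

theorem isClosedForm_stableForm [IsProbabilityMeasure (gibbs V)] (hV : volume ≪ gibbs V)
    (hd : 1 ≤ d) (hα0 : 0 < α) (hα2 : α < 2) :
    IsClosedForm (formDom α hV) (fun f g => stableForm α V f g) where
  symm u _ v _ := stableForm_comm u v
  add_left _ hu _ hv _ hw := stableForm_add_left hV hu hv hw
  smul_left c u _ w _ := stableForm_smul_left hV c u w
  nonneg _ _ := stableForm_self_nonneg _
  dense := dense_formDom hV hd hα0 hα2
  exists_resolvent _ hs f := exists_stableForm_resolvent hV hs f

theorem isFormSemigroup_iff (hV : volume ≪ gibbs V)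
    (P : ℝ → (Lp ℝ 2 (gibbs V) →L[ℝ] Lp ℝ 2 (gibbs V))) :
    IsFormSemigroup α V P ↔
      IsSemigroupOf (formDom α hV) (fun f g => stableForm α V f g) P :=
  ⟨fun h => ⟨h.zero, h.add, h.cont, h.generator⟩, fun h => ⟨h.zero, h.add, h.cont, h.gen⟩⟩

end StableForm

section Markov

set_option linter.unusedSectionVars false

/-- The part of `a` exceeding the interval `[-M, M]`. -/
noncomputable def excess (M a : ℝ) : ℝ := a - max (-M) (min M a)

theorem excess_cases {M : ℝ} (hM : 0 ≤ M) (a : ℝ) :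
    (M < a ∧ excess M a = a - M) ∨ (a < -M ∧ excess M a = a + M) ∨ (|a| ≤ M ∧ excess M a = 0) := by
  unfold excess
  rcases lt_or_ge M a with h | h
  · left; refine ⟨h, ?_⟩
    rw [min_eq_left h.le, max_eq_right (by linarith)]
  · rcases lt_or_ge a (-M) with h' | h'
    · right; left; refine ⟨h', ?_⟩
      rw [min_eq_right h, max_eq_left h'.le]; ring
    · right; right; refine ⟨abs_le.2 ⟨h', h⟩, ?_⟩
      rw [min_eq_right h, max_eq_right h']; ring

theorem excess_zero {M : ℝ} (hM : 0 ≤ M) : excess M 0 = 0 := by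
  simp [excess, hM]

theorem abs_le_of_excess_eq_zero {M : ℝ} (hM : 0 ≤ M) {a : ℝ} (h : excess M a = 0) : |a| ≤ M := by
  rcases excess_cases hM a with ⟨h1, h2⟩ | ⟨h1, h2⟩ | ⟨h1, -⟩
  · linarith
  · linarith
  · exact h1

theorem excess_sub_mul_nonneg {M : ℝ} (hM : 0 ≤ M) (a b : ℝ) :
    0 ≤ (a - b) * (excess M a - excess M b) := by
  rcases excess_cases hM a with ⟨h1, h2⟩ | ⟨h1, h2⟩ | ⟨h1, h2⟩ <;>
  rcases excess_cases hM b with ⟨h3, h4⟩ | ⟨h3, h4⟩ | ⟨h3, h4⟩ <;> rw [h2, h4] <;>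
  (try rw [abs_le] at *) <;> nlinarith [mul_self_nonneg (a - b)]

theorem abs_excess_sub_le {M : ℝ} (hM : 0 ≤ M) (a b : ℝ) :
    |excess M a - excess M b| ≤ |a - b| := by
  rw [← sq_le_sq]
  rcases excess_cases hM a with ⟨h1, h2⟩ | ⟨h1, h2⟩ | ⟨h1, h2⟩ <;>
  rcases excess_cases hM b with ⟨h3, h4⟩ | ⟨h3, h4⟩ | ⟨h3, h4⟩ <;> rw [h2, h4] <;>
  (try rw [abs_le] at *) <;> nlinarith

theorem excess_sq_le {M : ℝ} (hM : 0 ≤ M) (a : ℝ) {b : ℝ} (hb : |b| ≤ M) :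
    excess M a ^ 2 ≤ (a - b) * excess M a := by
  rw [abs_le] at hb
  rcases excess_cases hM a with ⟨h1, h2⟩ | ⟨h1, h2⟩ | ⟨h1, h2⟩ <;> rw [h2] <;> nlinarith

theorem excess_sq_eq {M : ℝ} (hM : 0 ≤ M) (a : ℝ) :
    excess M a ^ 2 = a * excess M a - M * |excess M a| := by
  rcases excess_cases hM a with ⟨h1, h2⟩ | ⟨h1, h2⟩ | ⟨h1, h2⟩ <;> rw [h2]
  · rw [abs_of_pos (by linarith)]; ring
  · rw [abs_of_neg (by linarith)]; ring
  · simp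

theorem continuous_excess (M : ℝ) : Continuous (excess M) := by
  unfold excess; fun_prop

variable {d : ℕ} {α : ℝ} {V : EuclideanSpace ℝ (Fin d) → ℝ}

theorem energy_comp_le {φ : ℝ → ℝ} (hφ : ∀ a b, |φ a - φ b| ≤ |a - b|)
    (f : EuclideanSpace ℝ (Fin d) → ℝ) : energy α V (φ ∘ f) ≤ energy α V f := by
  refine lintegral_mono fun p => ENNReal.ofReal_le_ofReal ?_
  exact div_le_div_of_nonneg_right (sq_le_sq.2 (hφ _ _)) (by positivity)

theorem FormDomain.comp {φ : ℝ → ℝ} (hφc : Continuous φ)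
    (hφ : ∀ a b, |φ a - φ b| ≤ |a - b|) (hφ0 : φ 0 = 0)
    {f : EuclideanSpace ℝ (Fin d) → ℝ} (hf : FormDomain α V f) : FormDomain α V (φ ∘ f) := by
  refine ⟨hf.1.mono (hφc.comp_aestronglyMeasurable hf.1.1)
    (Eventually.of_forall fun x => ?_), (energy_comp_le hφ f).trans_lt hf.2⟩
  have := hφ (f x) 0
  simpa [hφ0] using this

theorem ae_eq_zero_of_integral_sq_nonpos {Ω : Type*} [MeasurableSpace Ω] {μ : Measure Ω}
    {g : Ω → ℝ} (hg : MemLp g 2 μ) (h : ∫ x, g x ^ 2 ∂μ ≤ 0) : ∀ᵐ x ∂μ, g x = 0 := by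
  have h1 := (integral_eq_zero_iff_of_nonneg (fun x => sq_nonneg (g x))
    ((memLp_two_iff_integrable_sq hg.1).1 hg)).1
    (le_antisymm h (integral_nonneg fun x => sq_nonneg _))
  filter_upwards [h1] with x hx
  exact pow_eq_zero_iff two_ne_zero |>.1 hx

variable [IsProbabilityMeasure (gibbs V)]

theorem inner_Lp_two {Ω : Type*} [MeasurableSpace Ω] {μ : Measure Ω} (f g : Lp ℝ 2 μ) :
    inner ℝ f g = ∫ x, f x * g x ∂μ := by
  rw [L2.inner_def]
  simp [mul_comm]

theorem integrable_mul_Lp_two {Ω : Type*} [MeasurableSpace Ω] {μ : Measure Ω} (f g : Lp ℝ 2 μ) :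
    Integrable (fun x => f x * g x) μ :=
  (Lp.memLp f).integrable_mul (Lp.memLp g)

section probability

variable {Ω : Type*} [MeasurableSpace Ω] {μ : Measure Ω} [IsProbabilityMeasure μ]

theorem integrable_Lp_two (f : Lp ℝ 2 μ) : Integrable f μ :=
  (Lp.memLp f).integrable one_le_two

/-- The closed ball of `L^∞` inside `L²`. -/
def supBall (μ : Measure Ω) (M : ℝ) : Set (Lp ℝ 2 μ) := {f | ∀ᵐ x ∂μ, |f x| ≤ M}

theorem convex_supBall (M : ℝ) : Convex ℝ (supBall μ M) := by
  intro f hf g hg a b ha hb hab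
  have hf : ∀ᵐ x ∂μ, |f x| ≤ M := hf
  have hg : ∀ᵐ x ∂μ, |g x| ≤ M := hg
  change ∀ᵐ x ∂μ, _
  filter_upwards [Lp.coeFn_add (a • f) (b • g), Lp.coeFn_smul a f, Lp.coeFn_smul b g, hf, hg] with
    x e1 e2 e3 e4 e5
  rw [e1, Pi.add_apply, e2, e3, Pi.smul_apply, Pi.smul_apply, smul_eq_mul, smul_eq_mul]
  rw [abs_le] at *
  have : b = 1 - a := by linarith
  subst this
  constructor <;> nlinarith

theorem isClosed_supBall (M : ℝ) : IsClosed (supBall μ M) := by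
  refine IsSeqClosed.isClosed fun f g hf hfg => ?_
  obtain ⟨ns, -, h⟩ := (tendstoInMeasure_of_tendsto_Lp hfg).exists_seq_tendsto_ae
  have hf' : ∀ᵐ x ∂μ, ∀ n, |f n x| ≤ M := ae_all_iff.2 hf
  change ∀ᵐ x ∂μ, _
  filter_upwards [h, hf'] with x h1 h2
  exact le_of_tendsto h1.abs (Eventually.of_forall fun i => h2 _)

/-- The `L¹` norm of an `L²` function. -/
noncomputable def normOne (f : Lp ℝ 2 μ) : ℝ := ∫ x, |f x| ∂μ

theorem normOne_nonneg (f : Lp ℝ 2 μ) : 0 ≤ normOne f := integral_nonneg fun _ => abs_nonneg _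

theorem normOne_le_norm (f : Lp ℝ 2 μ) : normOne f ≤ ‖f‖ := by
  have h1 := (integrable_Lp_two f).abs
  have h2 : Integrable (fun x => f x ^ 2) μ := (memLp_two_iff_integrable_sq (Lp.memLp f).1).1
    (Lp.memLp f)
  have h3 : ‖f‖ ^ 2 = ∫ x, f x ^ 2 ∂μ := by
    rw [← real_inner_self_eq_norm_sq, inner_Lp_two]; simp_rw [pow_two]
  have h4 : (0 : ℝ) ≤ ∫ x, (|f x| - normOne f) ^ 2 ∂μ := integral_nonneg fun x => sq_nonneg _
  have h5 : ∫ x, (|f x| - normOne f) ^ 2 ∂μ = ‖f‖ ^ 2 - normOne f ^ 2 := by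
    have : ∀ x, (|f x| - normOne f) ^ 2 = f x ^ 2 - 2 * normOne f * |f x| + normOne f ^ 2 :=
      fun x => by rw [sub_sq, sq_abs]; ring
    simp_rw [this]
    have i1 : Integrable (fun x => 2 * normOne f * |f x|) μ := h1.const_mul _
    have i2 : Integrable (fun x => f x ^ 2 - 2 * normOne f * |f x|) μ := h2.sub i1
    rw [integral_add i2 (integrable_const _), integral_sub h2 i1, integral_const_mul, ← h3]
    simp only [integral_const, probReal_univ, one_smul]
    change _ - 2 * normOne f * normOne f + _ = _
    ring
  exact le_of_sq_le_sq (by linarith) (norm_nonneg _)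

theorem normOne_le_add (f g : Lp ℝ 2 μ) : normOne f ≤ normOne g + ‖f - g‖ := by
  refine le_trans ?_ (add_le_add_right (normOne_le_norm (f - g)) _)
  rw [normOne, normOne, normOne, ← integral_add (integrable_Lp_two g).abs
    (integrable_Lp_two (f - g)).abs]
  refine integral_mono_ae (integrable_Lp_two f).abs ((integrable_Lp_two g).abs.add
    (integrable_Lp_two (f - g)).abs) ?_
  filter_upwards [Lp.coeFn_sub f g] with x hx
  simp only [hx, Pi.sub_apply]
  have := abs_add_le (g x) (f x - g x)
  simpa using this

theorem exists_normOne_eq_inner (f : Lp ℝ 2 μ) :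
    ∃ σ ∈ supBall μ 1, normOne f = inner ℝ f σ := by
  have hm : AEStronglyMeasurable (fun x => if 0 ≤ f x then (1 : ℝ) else -1) μ :=
    (Measurable.ite (measurableSet_le measurable_const (Lp.stronglyMeasurable f).measurable)
      measurable_const measurable_const).aestronglyMeasurable
  have hM : MemLp (fun x => if 0 ≤ f x then (1 : ℝ) else -1) 2 μ :=
    MemLp.of_bound hm 1 (Eventually.of_forall fun x => by split_ifs <;> simp)
  refine ⟨hM.toLp, ?_, ?_⟩
  · change ∀ᵐ x ∂μ, _
    filter_upwards [hM.coeFn_toLp] with x hx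
    rw [hx]; split_ifs <;> simp
  · rw [normOne, inner_Lp_two]
    refine integral_congr_ae ?_
    filter_upwards [hM.coeFn_toLp] with x hx
    rw [hx]
    split_ifs with h
    · rw [abs_of_nonneg h, mul_one]
    · rw [abs_of_neg (not_le.1 h)]; ring

theorem mem_supBall_of_inner_le {u : Lp ℝ 2 μ} {K : ℝ} (hK : 0 ≤ K)
    (h : ∀ g : Lp ℝ 2 μ, inner ℝ u g ≤ K * normOne g) : u ∈ supBall μ K := by
  have hM : MemLp (excess K ∘ u) 2 μ := (Lp.memLp u).mono
    ((continuous_excess K).comp_aestronglyMeasurable (Lp.memLp u).1)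
    (Eventually.of_forall fun x => by
      simpa [excess_zero hK] using abs_excess_sub_le hK (u x) 0)
  have h1 := h hM.toLp
  have e1 : inner ℝ u hM.toLp = ∫ x, u x * excess K (u x) ∂μ := by
    rw [inner_Lp_two]
    refine integral_congr_ae ?_
    filter_upwards [hM.coeFn_toLp] with x hx
    rw [hx]; rfl
  have e2 : normOne hM.toLp = ∫ x, |excess K (u x)| ∂μ := by
    refine integral_congr_ae ?_
    filter_upwards [hM.coeFn_toLp] with x hx
    rw [hx]; rfl
  have i1 : Integrable (fun x => u x * excess K (u x)) μ := (Lp.memLp u).integrable_mul hM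
  have i2 : Integrable (fun x => |excess K (u x)|) μ := (hM.integrable one_le_two).abs
  have h2 : ∀ᵐ x ∂μ, (excess K ∘ u) x = 0 := by
    refine ae_eq_zero_of_integral_sq_nonpos hM ?_
    simp_rw [Function.comp, excess_sq_eq hK]
    rw [integral_sub i1 (i2.const_mul K), integral_const_mul, ← e1, ← e2]
    linarith
  change ∀ᵐ x ∂μ, _
  filter_upwards [h2] with x hx
  exact abs_le_of_excess_eq_zero hK hx

theorem inner_le_of_mem_supBall {f g : Lp ℝ 2 μ} {M : ℝ} (hg : g ∈ supBall μ M) :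
    inner ℝ f g ≤ M * normOne f := by
  have hg : ∀ᵐ x ∂μ, |g x| ≤ M := hg
  rw [inner_Lp_two, normOne, ← integral_const_mul]
  refine integral_mono_ae (integrable_mul_Lp_two f g)
    ((integrable_Lp_two f).abs.const_mul M) ?_
  filter_upwards [hg] with x hx
  calc f x * g x ≤ |f x * g x| := le_abs_self _
    _ = |g x| * |f x| := by rw [abs_mul, mul_comm]
    _ ≤ M * |f x| := mul_le_mul_of_nonneg_right hx (abs_nonneg _)

/-- The constant function `1` in `L²`. -/
noncomputable def oneL2 (μ : Measure Ω) [IsProbabilityMeasure μ] : Lp ℝ 2 μ :=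
  (memLp_const (1 : ℝ)).toLp (fun _ => (1 : ℝ))

theorem coeFn_oneL2 : oneL2 μ =ᵐ[μ] fun _ => (1 : ℝ) := MemLp.coeFn_toLp _

theorem inner_oneL2 (f : Lp ℝ 2 μ) : inner ℝ f (oneL2 μ) = ∫ x, f x ∂μ := by
  rw [inner_Lp_two]
  refine integral_congr_ae ?_
  filter_upwards [coeFn_oneL2] with x hx
  rw [hx, mul_one]

end probability

section res

variable (hV : volume ≪ gibbs V)
  (ha : IsClosedForm (formDom α hV) (fun f g => stableForm α V f g))

theorem res_mem_supBall {M s : ℝ} (hM : 0 ≤ M) (hs : 0 < s) {f : Lp ℝ 2 (gibbs V)}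
    (hf : f ∈ supBall (gibbs V) M) : ha.res s f ∈ supBall (gibbs V) M := by
  have hf : ∀ᵐ x ∂(gibbs V), |f x| ≤ M := hf
  set u := ha.res s f with hu
  have huD : FormDomain α V u := ha.res_mem hs f
  have hgD : FormDomain α V (excess M ∘ u) :=
    huD.comp (continuous_excess M) (abs_excess_sub_le hM) (excess_zero hM)
  set g := hgD.1.toLp with hg
  have hgu : g =ᵐ[gibbs V] excess M ∘ u := hgD.1.coeFn_toLp
  have hgD' : FormDomain α V g := (formDomain_congr hV hgu).2 hgD
  have h1 := ha.res_spec hs f (g := g) hgD'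
  have h2 : 0 ≤ stableForm α V u g := by
    rw [stableForm_congr hV ae_eq_rfl hgu, stableForm_eq]
    refine integral_nonneg fun p => ?_
    rw [Pi.zero_apply, diffQuot_mul]
    exact div_nonneg (excess_sub_mul_nonneg hM _ _) (by positivity)
  have h3 : inner ℝ u g - inner ℝ f g ≤ 0 := by
    have := mul_nonneg hs.le h2
    simp only [← hu] at h1
    linarith
  have h4 : inner ℝ u g - inner ℝ f g = ∫ x, (u x - f x) * excess M (u x) ∂(gibbs V) := by
    rw [inner_Lp_two, inner_Lp_two, ← integral_sub (integrable_mul_Lp_two u g)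
      (integrable_mul_Lp_two f g)]
    refine integral_congr_ae ?_
    filter_upwards [hgu] with x hx
    rw [hx, Function.comp]; ring
  have hint : Integrable (fun x => (u x - f x) * excess M (u x)) (gibbs V) :=
    ((Lp.memLp u).sub (Lp.memLp f)).integrable_mul hgD.1
  have h5 : ∀ᵐ x ∂(gibbs V), (excess M ∘ u) x = 0 := by
    refine ae_eq_zero_of_integral_sq_nonpos hgD.1 (le_trans ?_ h3)
    rw [h4]
    refine integral_mono_ae ((memLp_two_iff_integrable_sq hgD.1.1).1 hgD.1) hint ?_
    filter_upwards [hf] with x hx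
    exact excess_sq_le hM _ hx
  change ∀ᵐ x ∂(gibbs V), _
  filter_upwards [h5] with x hx
  exact abs_le_of_excess_eq_zero hM hx

theorem formGen_oneL2 :
    FormGen (formDom α hV) (fun f g => stableForm α V f g) (oneL2 (gibbs V)) 0 := by
  have hz : ∀ g : EuclideanSpace ℝ (Fin d) → ℝ,
      stableForm α V (fun _ => (1 : ℝ)) g = 0 := fun g => by simp [stableForm]
  refine ⟨?_, fun g _ => ?_⟩
  · rw [mem_formDom, formDomain_congr hV coeFn_oneL2]
    exact ⟨memLp_const _, by simp⟩
  · change stableForm α V (oneL2 (gibbs V)) g = _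
    rw [stableForm_congr hV coeFn_oneL2 ae_eq_rfl, hz]; simp

theorem res_oneL2 {s : ℝ} (hs : 0 < s) : ha.res s (oneL2 (gibbs V)) = oneL2 (gibbs V) :=
  ha.res_eq_of_gen_zero hs (formGen_oneL2 hV)

theorem integral_res {s : ℝ} (hs : 0 < s) (f : Lp ℝ 2 (gibbs V)) :
    ∫ x, ha.res s f x ∂(gibbs V) = ∫ x, f x ∂(gibbs V) := by
  rw [← inner_oneL2, ha.inner_res hs, res_oneL2 hV ha hs, inner_oneL2]

variable {t : ℝ}

theorem semigroup_mem_supBall {M : ℝ} (hM : 0 ≤ M) (ht : 0 ≤ t) {f : Lp ℝ 2 (gibbs V)}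
    (hf : f ∈ supBall (gibbs V) M) : ha.semigroup t f ∈ supBall (gibbs V) M :=
  ha.semigroup_mem (convex_supBall M) (isClosed_supBall M)
    (fun _ hs _ hx => res_mem_supBall hV ha hM hs hx) ht hf

theorem semigroup_oneL2 (ht : 0 ≤ t) :
    ha.semigroup t (oneL2 (gibbs V)) = oneL2 (gibbs V) := by
  refine ha.semigroup_mem (convex_singleton _) isClosed_singleton (fun s hs x hx => ?_) ht rfl
  rw [mem_singleton_iff] at hx ⊢
  rw [hx, res_oneL2 hV ha hs]

theorem integral_semigroup (ht : 0 ≤ t) (f : Lp ℝ 2 (gibbs V)) :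
    ∫ x, ha.semigroup t f x ∂(gibbs V) = ∫ x, f x ∂(gibbs V) := by
  rw [← inner_oneL2, ha.inner_semigroup ht, semigroup_oneL2 hV ha ht, inner_oneL2]

theorem normOne_semigroup_le (ht : 0 ≤ t) (f : Lp ℝ 2 (gibbs V)) :
    normOne (ha.semigroup t f) ≤ normOne f := by
  obtain ⟨σ, hσ, h⟩ := exists_normOne_eq_inner (ha.semigroup t f)
  rw [h, ha.inner_semigroup ht]
  simpa using inner_le_of_mem_supBall (f := f) (semigroup_mem_supBall hV ha zero_le_one ht hσ)

end res

end Markov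

section Rates

set_option linter.unusedSectionVars false

variable {d : ℕ} {α : ℝ} {V : EuclideanSpace ℝ (Fin d) → ℝ} [IsProbabilityMeasure (gibbs V)]

theorem integral_sq_Lp_two {Ω : Type*} [MeasurableSpace Ω] {μ : Measure Ω} (f : Lp ℝ 2 μ) :
    ∫ x, f x ^ 2 ∂μ = ‖f‖ ^ 2 := by
  rw [← real_inner_self_eq_norm_sq, inner_Lp_two]; simp_rw [pow_two]

theorem toReal_eLpNorm_le_of_mem_supBall {M : ℝ} (hM : 0 ≤ M) {f : Lp ℝ 2 (gibbs V)}
    (hf : f ∈ supBall (gibbs V) M) :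
    MemLp f ∞ (gibbs V) ∧ (eLpNorm f ∞ (gibbs V)).toReal ≤ M := by
  have h : eLpNorm f ∞ (gibbs V) ≤ ENNReal.ofReal M := by
    rw [eLpNorm_exponent_top]
    exact eLpNormEssSup_le_of_ae_bound hf
  exact ⟨⟨(Lp.memLp f).1, h.trans_lt ENNReal.ofReal_lt_top⟩, ENNReal.toReal_le_of_le_ofReal hM h⟩

section

variable (hV : volume ≪ gibbs V)
  (ha : IsClosedForm (formDom α hV) (fun f g => stableForm α V f g))

/-- Decay of the `L²` norm along the semigroup under a weak Poincaré inequality. -/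
theorem norm_semigroup_sq_le_of_weakPoincare {β : ℝ → ℝ} (hβ : WeakPoincareIneq α V β) {r : ℝ}
    (hr : 0 < r) (hβr : 0 < β r) {M : ℝ} (hM : 0 ≤ M) {f : Lp ℝ 2 (gibbs V)}
    (hf : f ∈ supBall (gibbs V) M) (hf0 : ∫ x, f x ∂(gibbs V) = 0) {t : ℝ} (ht : 0 ≤ t) :
    ‖ha.semigroup t f‖ ^ 2 ≤ r * M ^ 2 + exp (-(2 / β r * t)) * ‖f‖ ^ 2 := by
  have hS := ha.isSemigroupOf_semigroup
  have key : ∀ u h, FormGen (formDom α hV) (fun f g => stableForm α V f g) u h →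
      u ∈ supBall (gibbs V) M → ∫ x, u x ∂(gibbs V) = 0 →
      ‖ha.semigroup t u‖ ^ 2 ≤ r * M ^ 2 + exp (-(2 / β r * t)) * ‖u‖ ^ 2 := by
    intro u h hu huM hu0
    have hd : ∀ x : ℝ, HasDerivAt (fun x : ℝ => exp (2 / β r * x))
        (exp (2 / β r * x) * (2 / β r)) x := fun x => by
      simpa using ((hasDerivAt_id x).const_mul (2 / β r)).exp
    have h1 := image_le_of_deriv_right_le_deriv_boundary (a := 0) (b := t)
      (f := fun x => exp (2 / β r * x) * (‖ha.semigroup x u‖ ^ 2 - r * M ^ 2))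
      (B := fun _ => ‖u‖ ^ 2 - r * M ^ 2) (B' := fun _ => 0)
      ((by fun_prop : Continuous fun x => exp (2 / β r * x)).continuousOn.mul
        ((((hS.cont u).norm.pow 2).mono Icc_subset_Ici_self).sub continuousOn_const))
      (fun x hx => (hd x).hasDerivWithinAt.mul
        ((hS.hasDerivWithinAt_norm_sq hu hx.1).sub_const (r * M ^ 2)))
      (by simp [hS.zero]) continuousOn_const (fun _ _ => hasDerivWithinAt_const _ _ _)
      (fun x hx => by
        have hm := semigroup_mem_supBall hV ha hM hx.1 huM
        obtain ⟨hm1, hm2⟩ := toReal_eLpNorm_le_of_mem_supBall hM hm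
        have h2 := hβ r hr _ (hS.gen_apply hu hx.1).1 hm1
          (by rw [integral_semigroup hV ha hx.1, hu0])
        rw [integral_sq_Lp_two] at h2
        have h3 : r * (eLpNorm (ha.semigroup x u) ∞ (gibbs V)).toReal ^ 2 ≤ r * M ^ 2 := by
          gcongr
        have h4 : ‖ha.semigroup x u‖ ^ 2 - r * M ^ 2 ≤
            β r * stableForm α V (ha.semigroup x u) (ha.semigroup x u) := by linarith
        have h5 : 2 / β r * (‖ha.semigroup x u‖ ^ 2 - r * M ^ 2) ≤
            2 * stableForm α V (ha.semigroup x u) (ha.semigroup x u) := by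
          rw [div_mul_eq_mul_div, div_le_iff₀ hβr]; linarith
        have h6 := exp_pos (2 / β r * x)
        nlinarith) (right_mem_Icc.2 ht)
    rw [exp_neg]
    have h6 := exp_pos (2 / β r * t)
    have h7 : ‖ha.semigroup t u‖ ^ 2 - r * M ^ 2 ≤
        (exp (2 / β r * t))⁻¹ * (‖u‖ ^ 2 - r * M ^ 2) := by
      rw [← div_eq_inv_mul, le_div_iff₀ h6]; linarith
    have h8 : 0 ≤ (exp (2 / β r * t))⁻¹ * (r * M ^ 2) := by positivity
    linarith
  have h1 := ha.tendsto_res f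
  refine le_of_tendsto_of_tendsto
    ((((ha.semigroup t).continuous.tendsto f).comp h1).norm.pow 2)
    (((h1.norm.pow 2).const_mul _).const_add _) ?_
  filter_upwards [self_mem_nhdsWithin] with s hs
  exact key _ _ (ha.gen_res hs f) (res_mem_supBall hV ha hM hs hf)
    (by rw [integral_res hV ha hs, hf0])

theorem mul_exp_neg_le_of_superPoincare_rate {c ε l x h e : ℝ} (hε : 1 < ε) (hc : 0 < c)
    (hx : 0 < x) (hl1 : c + 1 ≤ l) (hl2 : 1 / (ε - 1) * (2 * c) ^ ε < l ^ (ε - 1)) {m : ℝ}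
    (hm : 0 < m) (hh : h = exp (l * (1 + x ^ (-1 / (ε - 1)))) * m)
    (hSP : ∀ r : ℝ, 0 < r → h ≤ r * e + exp (c * (1 + r ^ (-1 / ε))) * m) :
    -2 * e < exp (l * (1 + x ^ (-1 / (ε - 1)))) *
      (l * (-1 / (ε - 1) * x ^ (-1 / (ε - 1) - 1))) * m := by
  have hl : 0 < l := by linarith
  have hε1 : 0 < ε - 1 := by linarith
  set y := x ^ (-1 / (ε - 1)) with hy
  have hy0 : 0 < y := rpow_pos_of_pos hx _
  set q := l / (2 * c) * y with hq
  have hq0 : 0 < q := by positivity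
  have h1 := hSP (q ^ (-ε)) (rpow_pos_of_pos hq0 _)
  rw [← rpow_mul hq0.le, show -ε * (-1 / ε) = 1 by field_simp, rpow_one] at h1
  have h2 : exp (c * (1 + q)) * m ≤ h / 2 := by
    rw [hh, mul_div_right_comm]
    refine mul_le_mul_of_nonneg_right ?_ hm.le
    rw [le_div_iff₀ two_pos]
    calc exp (c * (1 + q)) * 2 ≤ exp (c * (1 + q)) * exp 1 := by
          gcongr; have := add_one_le_exp (1 : ℝ); linarith
      _ = exp (c * (1 + q) + 1) := (exp_add _ _).symm
      _ ≤ exp (l * (1 + y)) := by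
          refine exp_le_exp.2 ?_
          have : c * q = l / 2 * y := by rw [hq]; field_simp
          nlinarith
  have h3 : h / 2 ≤ q ^ (-ε) * e := by linarith
  have h4 : h * q ^ ε ≤ 2 * e := by
    rw [rpow_neg hq0.le, ← div_eq_inv_mul, le_div_iff₀ (rpow_pos_of_pos hq0 _)] at h3
    linarith
  have h5 : q ^ ε = l ^ ε / (2 * c) ^ ε * y ^ ε := by
    rw [hq, mul_rpow (by positivity) hy0.le, div_rpow hl.le (by positivity)]
  have h6 : y ^ ε = x ^ (-1 / (ε - 1) - 1) := by
    rw [hy, ← rpow_mul hx.le]; congr 1; field_simp; ring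
  have h7 : l * (1 / (ε - 1)) < l ^ ε / (2 * c) ^ ε := by
    rw [lt_div_iff₀ (by positivity)]
    have : l ^ ε = l * l ^ (ε - 1) := by
      rw [mul_comm, ← rpow_add_one hl.ne']; congr 1; ring
    rw [this]
    nlinarith
  have hpos : 0 < exp (l * (1 + y)) * m * x ^ (-1 / (ε - 1) - 1) := by positivity
  rw [h5, h6, hh] at h4
  have := mul_lt_mul_of_pos_right h7 hpos
  have e1 : -1 / (ε - 1) = -(1 / (ε - 1)) := by ring
  have e2 : exp (l * (1 + y)) * (l * (-1 / (ε - 1) * x ^ (-1 / (ε - 1) - 1))) * m =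
      -(l * (1 / (ε - 1)) * (exp (l * (1 + y)) * m * x ^ (-1 / (ε - 1) - 1))) := by
    rw [e1]; ring
  rw [e2]
  linarith

/-- The `L¹ → L²` bound of the semigroup under a super Poincaré inequality. -/
theorem norm_semigroup_sq_le_of_superPoincare {c ε l : ℝ} (hε : 1 < ε) (hc : 0 < c)
    (hl1 : c + 1 ≤ l) (hl2 : 1 / (ε - 1) * (2 * c) ^ ε < l ^ (ε - 1))
    (hSP : SuperPoincareIneq α V (fun r => exp (c * (1 + r ^ (-1 / ε)))))
    (f : Lp ℝ 2 (gibbs V)) {t : ℝ} (ht : 0 < t) :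
    ‖ha.semigroup t f‖ ^ 2 ≤ exp (l * (1 + t ^ (-1 / (ε - 1)))) * normOne f ^ 2 := by
  have hS := ha.isSemigroupOf_semigroup
  have hl : 0 < l := by linarith
  have hε1 : 0 < ε - 1 := by linarith
  have key : ∀ u h, FormGen (formDom α hV) (fun f g => stableForm α V f g) u h → ∀ m : ℝ, 0 < m →
      normOne u ≤ m →
      ‖ha.semigroup t u‖ ^ 2 ≤ exp (l * (1 + t ^ (-1 / (ε - 1)))) * m ^ 2 := by
    intro u h hu m hm hum
    set z := ‖u‖ ^ 2 / (l * m ^ 2) + 1 with hz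
    have hz0 : 0 < z := by positivity
    set a := min t (z ^ (-(ε - 1))) with hadef
    have ha0 : 0 < a := lt_min ht (rpow_pos_of_pos hz0 _)
    have haz : z ≤ a ^ (-1 / (ε - 1)) := by
      have h1 : (z ^ (-(ε - 1))) ^ (-1 / (ε - 1)) ≤ a ^ (-1 / (ε - 1)) := by
        refine rpow_le_rpow_of_nonpos ha0 (min_le_right _ _) ?_
        rw [neg_div]; exact neg_nonpos.2 (by positivity)
      rwa [← rpow_mul hz0.le, show -(ε - 1) * (-1 / (ε - 1)) = 1 by field_simp, rpow_one] at h1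
    have hd : ∀ x : ℝ, 0 < x → HasDerivAt (fun x : ℝ => exp (l * (1 + x ^ (-1 / (ε - 1)))) * m ^ 2)
        (exp (l * (1 + x ^ (-1 / (ε - 1)))) *
          (l * (-1 / (ε - 1) * x ^ (-1 / (ε - 1) - 1))) * m ^ 2) x := fun x hx =>
      ((((hasDerivAt_rpow_const (Or.inl hx.ne')).const_add 1).const_mul l).exp).mul_const (m ^ 2)
    refine image_le_of_deriv_right_lt_deriv_boundary' (a := a) (b := t)
      (f := fun x => ‖ha.semigroup x u‖ ^ 2)
      (((hS.cont u).norm.pow 2).mono fun x hx => ha0.le.trans hx.1)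
      (fun x hx => hS.hasDerivWithinAt_norm_sq hu (ha0.le.trans hx.1)) ?_
      (fun x hx => (hd x (ha0.trans_le hx.1)).continuousAt.continuousWithinAt)
      (fun x hx => (hd x (ha0.trans_le hx.1)).hasDerivWithinAt) (fun x hx hxe => ?_)
      (right_mem_Icc.2 (min_le_left _ _))
    · have h1 := pow_le_pow_left₀ (norm_nonneg _) (ha.norm_semigroup_le ha0.le u) 2
      have h2 : ‖u‖ ^ 2 ≤ l * z * m ^ 2 := by
        have : l * z * m ^ 2 = ‖u‖ ^ 2 + l * m ^ 2 := by rw [hz]; field_simp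
        rw [this]; linarith [show 0 < l * m ^ 2 by positivity]
      have h3 : l * z ≤ exp (l * (1 + a ^ (-1 / (ε - 1)))) := by
        have := add_one_le_exp (l * (1 + a ^ (-1 / (ε - 1))))
        nlinarith
      calc _ ≤ _ := h1
        _ ≤ _ := h2
        _ ≤ _ := mul_le_mul_of_nonneg_right h3 (sq_nonneg m)
    · have hx0 : 0 < x := ha0.trans_le hx.1
      refine mul_exp_neg_le_of_superPoincare_rate hε hc hx0 hl1 hl2 (by positivity) hxe
        fun r hr => ?_
      have h2 := hSP r hr _ (hS.gen_apply hu hx0.le).1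
      rw [integral_sq_Lp_two] at h2
      refine h2.trans (add_le_add_right ?_ _)
      refine mul_le_mul_of_nonneg_left ?_ (exp_pos _).le
      exact pow_le_pow_left₀ (normOne_nonneg _)
        ((normOne_semigroup_le hV ha hx0.le u).trans hum) 2
  have hlim : ∀ m : ℝ, normOne f < m →
      ‖ha.semigroup t f‖ ^ 2 ≤ exp (l * (1 + t ^ (-1 / (ε - 1)))) * m ^ 2 := by
    intro m hm
    have h1 := ha.tendsto_res f
    refine le_of_tendsto ((((ha.semigroup t).continuous.tendsto f).comp h1).norm.pow 2) ?_
    have h2 : Tendsto (fun s => normOne f + ‖ha.res s f - f‖) (𝓝[>] 0) (𝓝 (normOne f + 0)) :=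
      (tendsto_iff_norm_sub_tendsto_zero.1 h1).const_add _
    rw [add_zero] at h2
    filter_upwards [self_mem_nhdsWithin, h2.eventually (gt_mem_nhds hm)] with s hs hsm
    exact key _ _ (ha.gen_res hs f) m ((normOne_nonneg f).trans_lt hm)
      ((normOne_le_add _ _).trans hsm.le)
  have h3 : Tendsto (fun m : ℝ => exp (l * (1 + t ^ (-1 / (ε - 1)))) * m ^ 2) (𝓝[>] (normOne f))
      (𝓝 (exp (l * (1 + t ^ (-1 / (ε - 1)))) * normOne f ^ 2)) :=
    ((continuous_const.mul (continuous_pow 2)).tendsto _).mono_left nhdsWithin_le_nhds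
  exact ge_of_tendsto h3 (by filter_upwards [self_mem_nhdsWithin] with m hm using hlim m hm)

theorem mem_supBall_semigroup {K t : ℝ} (hK : 0 ≤ K) (ht : 0 ≤ t)
    (h : ∀ f : Lp ℝ 2 (gibbs V), ‖ha.semigroup t f‖ ^ 2 ≤ K * normOne f ^ 2)
    (f : Lp ℝ 2 (gibbs V)) : ha.semigroup (t + t) f ∈ supBall (gibbs V) (K * normOne f) := by
  refine mem_supBall_of_inner_le (mul_nonneg hK (normOne_nonneg f)) fun g => ?_
  rw [ha.semigroup_add ht ht, ContinuousLinearMap.comp_apply, ha.inner_semigroup ht]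
  refine (real_inner_le_norm _ _).trans (le_of_sq_le_sq ?_
    (mul_nonneg (mul_nonneg hK (normOne_nonneg f)) (normOne_nonneg g)))
  calc (‖ha.semigroup t f‖ * ‖ha.semigroup t g‖) ^ 2
      = ‖ha.semigroup t f‖ ^ 2 * ‖ha.semigroup t g‖ ^ 2 := by ring
    _ ≤ (K * normOne f ^ 2) * (K * normOne g ^ 2) :=
      mul_le_mul (h f) (h g) (by positivity) (by positivity)
    _ = _ := by ring

end

theorem normOne_le_one_of_eLpNorm_le {f : Lp ℝ 2 (gibbs V)} (hf : eLpNorm f 1 (gibbs V) ≤ 1) :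
    normOne f ≤ 1 := by
  rw [eLpNorm_one_eq_lintegral_enorm, ← ofReal_integral_norm_eq_lintegral_enorm
    (integrable_Lp_two f)] at hf
  exact ENNReal.ofReal_le_one.1 hf

/-- Ultracontractivity from a super Poincaré inequality of rate `exp (c (1 + r^(-1/ε)))`, `ε > 1`. -/
theorem exists_mixedNorm_one_top_le (hV : volume ≪ gibbs V) (hd : 1 ≤ d) (hα0 : 0 < α)
    (hα2 : α < 2) {c ε : ℝ} (hε : 1 < ε) (hc : 0 < c)
    (hSP : SuperPoincareIneq α V (fun r => exp (c * (1 + r ^ (-1 / ε))))) :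
    ∃ l : ℝ, 0 < l ∧ ∀ P, IsFormSemigroup α V P → ∀ t : ℝ, 0 < t →
      mixedNorm (gibbs V) 1 ∞ (fun f => P t f) ≤
        ENNReal.ofReal (exp (l * (1 + t ^ (-1 / (ε - 1))))) := by
  have ha := isClosedForm_stableForm hV hd hα0 hα2
  have hε1 : 0 < ε - 1 := by linarith
  set A := 1 / (ε - 1) * (2 * c) ^ ε with hA
  have hA0 : 0 < A := by positivity
  set l := max (c + 1) (A ^ (1 / (ε - 1)) + 1) with hl
  have hl1 : c + 1 ≤ l := le_max_left _ _
  have hl0 : 0 < l := by linarith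
  have hl2 : A < l ^ (ε - 1) := by
    have h1 : A ^ (1 / (ε - 1)) < l := (lt_add_one _).trans_le (le_max_right _ _)
    have h2 := rpow_lt_rpow (by positivity) h1 hε1
    rwa [← rpow_mul hA0.le, one_div_mul_cancel hε1.ne', rpow_one] at h2
  have hB : (1 : ℝ) ≤ (2 : ℝ) ^ (1 / (ε - 1)) := one_le_rpow one_le_two (by positivity)
  refine ⟨l * 2 ^ (1 / (ε - 1)), by positivity, fun P hP t ht => ?_⟩
  rw [isFormSemigroup_iff hV] at hP
  refine iSup₂_le fun f hf => ?_
  have hf1 := normOne_le_one_of_eLpNorm_le hf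
  have h1 := mem_supBall_semigroup hV ha (exp_pos _).le (half_pos ht).le
    (fun f => norm_semigroup_sq_le_of_superPoincare hV ha hε hc hl1 hl2 hSP f (half_pos ht)) f
  rw [add_halves, ← ha.eq_semigroup hP ht.le] at h1
  rw [eLpNorm_exponent_top]
  refine eLpNormEssSup_le_of_ae_bound ?_
  have h1 : ∀ᵐ x ∂(gibbs V), _ := h1
  filter_upwards [h1] with x hx
  refine hx.trans ((mul_le_of_le_one_right (exp_pos _).le hf1).trans (exp_le_exp.2 ?_))
  have h2 : (t / 2) ^ (-1 / (ε - 1)) = 2 ^ (1 / (ε - 1)) * t ^ (-1 / (ε - 1)) := by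
    rw [div_rpow ht.le zero_le_two, neg_div, rpow_neg zero_le_two, div_inv_eq_mul, mul_comm]
  rw [h2, mul_assoc]
  refine mul_le_mul_of_nonneg_left ?_ hl0.le
  linarith

theorem weakPoincare_rate_bound {c κ t : ℝ} (hc : 0 < c) (hκ : 0 < κ) (ht : 1 ≤ t) :
    2 / (c * (1 + 2 ^ κ)) * t ^ (1 / (1 + κ)) ≤
      2 / (c * (1 + log (1 + (exp (-t ^ (1 / (1 + κ))))⁻¹) ^ κ)) * t := by
  have ht0 : 0 < t := by linarith
  set s := t ^ (1 / (1 + κ)) with hs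
  have hs1 : 1 ≤ s := one_le_rpow ht (by positivity)
  have hlog : log (1 + (exp (-s))⁻¹) ≤ 2 * s := by
    rw [exp_neg, inv_inv]
    have h1 : 1 + exp s ≤ exp 1 * exp s := by
      have := add_one_le_exp (1 : ℝ)
      have h2 : 1 ≤ exp s := one_le_exp (by linarith)
      nlinarith
    have h3 := log_le_log (by positivity) h1
    rw [← exp_add, log_exp] at h3
    linarith
  have hlog0 : 0 ≤ log (1 + (exp (-s))⁻¹) := log_nonneg (by
    have : 0 < (exp (-s))⁻¹ := by positivity
    linarith)
  have h1 : log (1 + (exp (-s))⁻¹) ^ κ ≤ 2 ^ κ * s ^ κ := by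
    rw [← mul_rpow zero_le_two (by linarith)]
    exact rpow_le_rpow hlog0 hlog hκ.le
  have hsκ : 1 ≤ s ^ κ := one_le_rpow hs1 hκ.le
  have h2 : c * (1 + log (1 + (exp (-s))⁻¹) ^ κ) ≤ c * (1 + 2 ^ κ) * s ^ κ := by
    rw [mul_assoc]
    refine mul_le_mul_of_nonneg_left ?_ hc.le
    linarith
  have h3 : t = s * s ^ κ := by
    rw [hs, ← rpow_mul ht0.le, ← rpow_add ht0,
      show 1 / (1 + κ) + 1 / (1 + κ) * κ = 1 by field_simp, rpow_one]
  have hden : 0 < c * (1 + log (1 + (exp (-s))⁻¹) ^ κ) := by positivity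
  rw [div_mul_eq_mul_div, div_mul_eq_mul_div, div_le_div_iff₀ (by positivity) hden]
  calc 2 * s * (c * (1 + log (1 + (exp (-s))⁻¹) ^ κ)) ≤ 2 * s * (c * (1 + 2 ^ κ) * s ^ κ) := by
        gcongr
    _ = 2 * (s * s ^ κ) * (c * (1 + 2 ^ κ)) := by ring
    _ = _ := by rw [← h3]

/-- Decay of the semigroup from a weak Poincaré inequality of logarithmic rate. -/
theorem exists_mixedNorm_top_two_le (hV : volume ≪ gibbs V) (hd : 1 ≤ d) (hα0 : 0 < α)
    (hα2 : α < 2) {c ε : ℝ} (hε : ε < 0) (hc : 0 < c)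
    (hWP : WeakPoincareIneq α V (fun r => c * (1 + log (1 + r⁻¹) ^ (-ε)))) :
    ∃ l₁ l₂ : ℝ, 0 < l₁ ∧ 0 < l₂ ∧ ∀ P, IsFormSemigroup α V P → ∀ t : ℝ, 0 < t →
      mixedNorm (gibbs V) ∞ 2 (fun f x => P t f x - ∫ y, f y ∂(gibbs V)) ≤
        ENNReal.ofReal (exp (l₁ - l₂ * t ^ (1 / (1 - ε)))) := by
  have ha := isClosedForm_stableForm hV hd hα0 hα2
  obtain ⟨κ, rfl⟩ : ∃ κ, ε = -κ := ⟨-ε, by ring⟩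
  have hκ : 0 < κ := by linarith
  simp only [neg_neg, sub_neg_eq_add] at hWP ⊢
  set b := 2 / (c * (1 + 2 ^ κ)) with hb
  have hb0 : 0 < b := by positivity
  refine ⟨2, min 1 b / 2, two_pos, by positivity, fun P hP t ht => ?_⟩
  rw [isFormSemigroup_iff hV] at hP
  refine iSup₂_le fun f hf => ?_
  have hf1 : ∀ᵐ x ∂(gibbs V), |f x| ≤ 1 := by
    have h1 := ae_le_eLpNormEssSup (f := f) (μ := gibbs V)
    rw [eLpNorm_exponent_top] at hf
    filter_upwards [h1] with x hx
    have h2 := hx.trans hf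
    rw [← ofReal_norm] at h2
    exact ENNReal.ofReal_le_one.1 h2
  set m := ∫ y, f y ∂(gibbs V) with hm
  have hm1 : |m| ≤ 1 := by
    have := norm_integral_le_of_norm_le_const (μ := gibbs V) (f := fun x => f x) (C := 1) hf1
    simpa using this
  set g : Lp ℝ 2 (gibbs V) := f - m • oneL2 (gibbs V) with hg
  have hgx : ∀ᵐ x ∂(gibbs V), g x = f x - m := by
    filter_upwards [Lp.coeFn_sub f (m • oneL2 (gibbs V)), Lp.coeFn_smul m (oneL2 (gibbs V)),
      coeFn_oneL2 (μ := gibbs V)] with x e1 e2 e3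
    rw [hg, e1, Pi.sub_apply, e2, Pi.smul_apply, e3, smul_eq_mul, mul_one]
  have hg2 : g ∈ supBall (gibbs V) 2 := by
    change ∀ᵐ x ∂(gibbs V), _
    filter_upwards [hgx, hf1] with x e1 e2
    rw [e1]
    have := abs_sub (f x) m
    linarith
  have hg0 : ∫ x, g x ∂(gibbs V) = 0 := by
    rw [integral_congr_ae hgx, integral_sub (integrable_Lp_two f) (integrable_const _)]
    simp [hm]
  have hgn : ‖g‖ ^ 2 ≤ 4 := by
    rw [← integral_sq_Lp_two]
    have : ∫ x, g x ^ 2 ∂(gibbs V) ≤ ∫ _, (4 : ℝ) ∂(gibbs V) := by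
      refine integral_mono_ae ((memLp_two_iff_integrable_sq (Lp.memLp g).1).1 (Lp.memLp g))
        (integrable_const _) ?_
      filter_upwards [show ∀ᵐ x ∂(gibbs V), |g x| ≤ 2 from hg2] with x hx
      rw [abs_le] at hx
      nlinarith [hx.1, hx.2]
    simpa using this
  have hPg : (fun x => P t f x - m) =ᵐ[gibbs V] ha.semigroup t g := by
    have h1 : ha.semigroup t g = P t f - m • oneL2 (gibbs V) := by
      rw [hg, map_sub, map_smul, semigroup_oneL2 hV ha ht.le, ha.eq_semigroup hP ht.le]
    rw [h1]
    filter_upwards [Lp.coeFn_sub (P t f) (m • oneL2 (gibbs V)),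
      Lp.coeFn_smul m (oneL2 (gibbs V)), coeFn_oneL2 (μ := gibbs V)] with x e1 e2 e3
    rw [e1, Pi.sub_apply, e2, Pi.smul_apply, e3, smul_eq_mul, mul_one]
  rw [eLpNorm_congr_ae hPg, ← ENNReal.ofReal_toReal (Lp.eLpNorm_ne_top (ha.semigroup t g)),
    ← Lp.norm_def]
  refine ENNReal.ofReal_le_ofReal (le_of_sq_le_sq ?_ (exp_pos _).le)
  rw [← exp_nat_mul]
  push_cast
  set s := t ^ (1 / (1 + κ)) with hs
  have hs0 : 0 < s := rpow_pos_of_pos ht _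
  have hmin1 : min 1 b ≤ 1 := min_le_left _ _
  have hmin2 : min 1 b ≤ b := min_le_right _ _
  have he1 : (2.7 : ℝ) < exp 1 := by linarith [exp_one_gt_d9]
  rcases lt_or_ge t 1 with ht1 | ht1
  · have hs1 : s ≤ 1 := rpow_le_one ht.le ht1.le (by positivity)
    have h2 := pow_le_pow_left₀ (norm_nonneg _) (ha.norm_semigroup_le ht.le g) 2
    have h3 : exp 2 ≤ exp (2 * (2 - min 1 b / 2 * s)) := by
      refine exp_le_exp.2 ?_
      have : min 1 b * s ≤ 1 * 1 := mul_le_mul hmin1 hs1 hs0.le zero_le_one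
      linarith
    have h4 : exp 2 = exp 1 * exp 1 := by rw [← exp_add]; norm_num
    nlinarith
  · have h1 := norm_semigroup_sq_le_of_weakPoincare hV ha hWP (r := exp (-s)) (exp_pos _)
      (by
        have : 0 < log (1 + (exp (-s))⁻¹) := log_pos (by
          have : 0 < (exp (-s))⁻¹ := by positivity
          linarith)
        positivity) zero_le_two hg2 hg0 ht.le
    have h2 := weakPoincare_rate_bound hc hκ ht1
    have h3 : exp (-(2 / (c * (1 + log (1 + (exp (-s))⁻¹) ^ κ)) * t)) ≤ exp (-(min 1 b * s)) := by
      refine exp_le_exp.2 (neg_le_neg (le_trans ?_ h2))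
      exact mul_le_mul_of_nonneg_right hmin2 hs0.le
    have h4 : exp (-s) ≤ exp (-(min 1 b * s)) := by
      refine exp_le_exp.2 (neg_le_neg ?_)
      nlinarith
    have h5 : exp (2 * (2 - min 1 b / 2 * s)) = exp 1 ^ 4 * exp (-(min 1 b * s)) := by
      rw [← exp_nat_mul, ← exp_add]; congr 1; push_cast; ring
    have h6 : (8 : ℝ) ≤ exp 1 ^ 4 := by
      have := pow_le_pow_left₀ (by norm_num) he1.le 4
      norm_num at this ⊢
      linarith
    rw [h5]
    have h7 := exp_pos (-(min 1 b * s))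
    have h8 := exp_pos (-(2 / (c * (1 + log (1 + (exp (-s))⁻¹) ^ κ)) * t))
    nlinarith
end Rates

section Potential

variable {d : ℕ} {α ε : ℝ}

/-- The logarithmic weight `log(e + |x|²)`. -/
noncomputable def ell (x : EuclideanSpace ℝ (Fin d)) : ℝ := log (exp 1 + ‖x‖ ^ 2)

theorem one_le_ell (x : EuclideanSpace ℝ (Fin d)) : 1 ≤ ell x := by
  rw [ell, le_log_iff_exp_le (by positivity)]
  exact le_add_of_nonneg_right (sq_nonneg _)

theorem ell_pos (x : EuclideanSpace ℝ (Fin d)) : 0 < ell x := one_pos.trans_le (one_le_ell x)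

theorem measurable_ell : Measurable (ell (d := d)) := by unfold ell; fun_prop

theorem exp_neg_potential (x : EuclideanSpace ℝ (Fin d)) :
    exp (-potential d α ε x) = (1 + ‖x‖ ^ 2) ^ (-((d : ℝ) + α) / 2) * ell x ^ (-ε) := by
  rw [rpow_def_of_pos (by positivity), rpow_def_of_pos (ell_pos x), ← exp_add, potential, ell]
  congr 1; ring

theorem measurable_potential : Measurable (potential d α ε) := by unfold potential; fun_prop

theorem exists_ell_rpow_le (p : ℝ) {η : ℝ} (hη : 0 < η) :
    ∃ C : ℝ, 0 < C ∧ ∀ x : EuclideanSpace ℝ (Fin d), ell x ^ p ≤ C * (1 + ‖x‖ ^ 2) ^ η := by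
  set q := |p| + 1 with hq
  have hq0 : 0 < q := by positivity
  set δ := η / q with hδ
  have hδ0 : 0 < δ := by positivity
  refine ⟨3 ^ η / δ ^ q, by positivity, fun x => ?_⟩
  have h1 : ell x ≤ (3 * (1 + ‖x‖ ^ 2)) ^ δ / δ := by
    refine (log_le_log (by positivity) ?_).trans (log_le_rpow_div (by positivity) hδ0)
    have := exp_one_lt_d9
    nlinarith [sq_nonneg ‖x‖]
  calc ell x ^ p ≤ ell x ^ q := rpow_le_rpow_of_exponent_le (one_le_ell x)
        (by have := le_abs_self p; linarith)
    _ ≤ ((3 * (1 + ‖x‖ ^ 2)) ^ δ / δ) ^ q := rpow_le_rpow (ell_pos x).le h1 hq0.le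
    _ = _ := by
      rw [div_rpow (by positivity) hδ0.le, ← rpow_mul (by positivity),
        mul_rpow (by norm_num) (by positivity), show δ * q = η by rw [hδ]; field_simp]
      ring

theorem integrable_rpow_mul_exp_neg_potential (hα0 : 0 < α) :
    Integrable (fun x : EuclideanSpace ℝ (Fin d) =>
      (1 + ‖x‖ ^ 2) ^ (α / 4) * exp (-potential d α ε x)) := by
  obtain ⟨C, hC, h⟩ := exists_ell_rpow_le (d := d) (-ε) (η := α / 8) (by positivity)
  have h1 : Integrable (fun x : EuclideanSpace ℝ (Fin d) =>
      C * (1 + ‖x‖ ^ 2) ^ (-((d : ℝ) + α / 4) / 2)) :=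
    (integrable_rpow_neg_one_add_norm_sq (by
      rw [finrank_euclideanSpace_fin]; linarith)).const_mul C
  refine h1.mono' ?_ (Eventually.of_forall fun x => ?_)
  · have := measurable_potential (d := d) (α := α) (ε := ε)
    exact Measurable.aestronglyMeasurable (by fun_prop)
  · have hp : 0 < 1 + ‖x‖ ^ 2 := by positivity
    rw [norm_of_nonneg (by positivity), exp_neg_potential]
    calc (1 + ‖x‖ ^ 2) ^ (α / 4) * ((1 + ‖x‖ ^ 2) ^ (-((d : ℝ) + α) / 2) * ell x ^ (-ε))
        ≤ (1 + ‖x‖ ^ 2) ^ (α / 4) * ((1 + ‖x‖ ^ 2) ^ (-((d : ℝ) + α) / 2) *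
          (C * (1 + ‖x‖ ^ 2) ^ (α / 8))) := by gcongr; exact h x
      _ = C * ((1 + ‖x‖ ^ 2) ^ (α / 4) * (1 + ‖x‖ ^ 2) ^ (-((d : ℝ) + α) / 2) *
          (1 + ‖x‖ ^ 2) ^ (α / 8)) := by ring
      _ = _ := by rw [← rpow_add hp, ← rpow_add hp]; congr 2; ring

theorem integrable_exp_neg_potential (hα0 : 0 < α) :
    Integrable (fun x : EuclideanSpace ℝ (Fin d) => exp (-potential d α ε x)) := by
  refine (integrable_rpow_mul_exp_neg_potential hα0 (ε := ε)).mono'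
    (Measurable.aestronglyMeasurable (measurable_exp.comp measurable_potential.neg))
    (Eventually.of_forall fun x => ?_)
  rw [norm_of_nonneg (exp_pos _).le]
  refine le_mul_of_one_le_left (exp_pos _).le (one_le_rpow ?_ (by positivity))
  linarith [sq_nonneg ‖x‖]

/-- The normalising constant of the Gibbs measure. -/
noncomputable def gibbsMass (d : ℕ) (α ε : ℝ) : ℝ :=
  ∫ x : EuclideanSpace ℝ (Fin d), exp (-potential d α ε x)

theorem gibbsMass_pos (hα0 : 0 < α) : 0 < gibbsMass d α ε := by
  rw [gibbsMass, integral_pos_iff_support_of_nonneg (fun x => (exp_pos _).le)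
    (integrable_exp_neg_potential hα0)]
  have : Function.support (fun x : EuclideanSpace ℝ (Fin d) => exp (-potential d α ε x)) = univ := by
    ext x; simp [(exp_pos _).ne']
  rw [this]
  exact isOpen_univ.measure_pos _ univ_nonempty

theorem ofReal_gibbsMass (hα0 : 0 < α) : ENNReal.ofReal (gibbsMass d α ε) =
    ∫⁻ x : EuclideanSpace ℝ (Fin d), ENNReal.ofReal (exp (-potential d α ε x)) :=
  ofReal_integral_eq_lintegral_ofReal (integrable_exp_neg_potential hα0)
    (Eventually.of_forall fun _ => (exp_pos _).le)

/-- The density of the Gibbs measure. -/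
noncomputable def gibbsDensity (d : ℕ) (α ε : ℝ) (x : EuclideanSpace ℝ (Fin d)) : ℝ :=
  (gibbsMass d α ε)⁻¹ * exp (-potential d α ε x)

theorem gibbsDensity_pos (hα0 : 0 < α) (x : EuclideanSpace ℝ (Fin d)) :
    0 < gibbsDensity d α ε x := mul_pos (inv_pos.2 (gibbsMass_pos hα0)) (exp_pos _)

theorem measurable_gibbsDensity : Measurable (gibbsDensity d α ε) :=
  (measurable_exp.comp measurable_potential.neg).const_mul _

theorem inv_gibbsDensity (x : EuclideanSpace ℝ (Fin d)) : (gibbsDensity d α ε x)⁻¹ =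
    gibbsMass d α ε * ((1 + ‖x‖ ^ 2) ^ (((d : ℝ) + α) / 2) * ell x ^ ε) := by
  have h1 : (0 : ℝ) ≤ 1 + ‖x‖ ^ 2 := by positivity
  rw [gibbsDensity, exp_neg_potential, mul_inv, inv_inv, mul_inv, neg_div, rpow_neg h1,
    rpow_neg (ell_pos x).le, inv_inv, inv_inv]

theorem gibbs_potential (hα0 : 0 < α) : gibbs (potential d α ε) =
    volume.withDensity (fun x => ENNReal.ofReal (gibbsDensity d α ε x)) := by
  have hm : Measurable fun x : EuclideanSpace ℝ (Fin d) =>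
      ENNReal.ofReal (exp (-potential d α ε x)) :=
    (measurable_exp.comp measurable_potential.neg).ennreal_ofReal
  rw [gibbs, ← ofReal_gibbsMass hα0, ← withDensity_smul _ hm]
  congr 1; ext x
  rw [gibbsDensity, ENNReal.ofReal_mul (inv_nonneg.2 (gibbsMass_pos hα0).le),
    ENNReal.ofReal_inv_of_pos (gibbsMass_pos hα0)]
  rfl

theorem isProbabilityMeasure_gibbs (hα0 : 0 < α) :
    IsProbabilityMeasure (gibbs (potential d α ε)) := by
  have h := gibbsMass_pos (d := d) (ε := ε) hα0
  refine ⟨?_⟩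
  rw [gibbs, Measure.smul_apply, withDensity_apply _ MeasurableSet.univ, Measure.restrict_univ,
    ← ofReal_gibbsMass hα0, smul_eq_mul]
  exact ENNReal.inv_mul_cancel (by simpa using h) ENNReal.ofReal_ne_top

theorem lintegral_gibbs (hα0 : 0 < α) {g : EuclideanSpace ℝ (Fin d) → ℝ≥0∞} (hg : Measurable g) :
    ∫⁻ x, g x ∂(gibbs (potential d α ε)) =
      ∫⁻ x, ENNReal.ofReal (gibbsDensity d α ε x) * g x := by
  rw [gibbs_potential hα0,
    lintegral_withDensity_eq_lintegral_mul _ measurable_gibbsDensity.ennreal_ofReal hg]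
  rfl

theorem lintegral_volume (hα0 : 0 < α) {g : EuclideanSpace ℝ (Fin d) → ℝ≥0∞}
    (hg : Measurable g) : ∫⁻ x, g x =
      ∫⁻ x, ENNReal.ofReal (gibbsDensity d α ε x)⁻¹ * g x ∂(gibbs (potential d α ε)) := by
  have hm : Measurable fun x : EuclideanSpace ℝ (Fin d) =>
      ENNReal.ofReal (gibbsDensity d α ε x)⁻¹ * g x :=
    measurable_gibbsDensity.inv.ennreal_ofReal.mul hg
  rw [lintegral_gibbs hα0 hm]
  refine lintegral_congr fun x => ?_
  have h := gibbsDensity_pos (d := d) (ε := ε) hα0 x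
  rw [← mul_assoc, ← ENNReal.ofReal_mul h.le, mul_inv_cancel₀ h.ne', ENNReal.ofReal_one, one_mul]

theorem volume_absolutelyContinuous_gibbs (hα0 : 0 < α) :
    (volume : Measure (EuclideanSpace ℝ (Fin d))) ≪ gibbs (potential d α ε) := by
  rw [gibbs_potential hα0]
  refine withDensity_absolutelyContinuous' measurable_gibbsDensity.ennreal_ofReal.aemeasurable ?_
  refine Eventually.of_forall fun x => ?_
  simpa using gibbsDensity_pos hα0 x

theorem exists_gibbs_tail_le (d : ℕ) (hα0 : 0 < α) (ε : ℝ) : ∃ C : ℝ, 0 < C ∧ ∀ R : ℝ, 0 < R →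
    gibbs (potential d α ε) {x | R ≤ ‖x‖} ≤ ENNReal.ofReal (C * R ^ (-(α / 2))) := by
  set μ := gibbs (potential d α ε) with hμ
  set g : EuclideanSpace ℝ (Fin d) → ℝ := fun x => (1 + ‖x‖ ^ 2) ^ (α / 4) with hg
  have hgm : Measurable g := by rw [hg]; fun_prop
  have h1 : ∫⁻ x, ENNReal.ofReal (g x) ∂μ = ENNReal.ofReal ((gibbsMass d α ε)⁻¹ *
      ∫ x : EuclideanSpace ℝ (Fin d), g x * exp (-potential d α ε x)) := by
    rw [lintegral_gibbs hα0 hgm.ennreal_ofReal, ← integral_const_mul,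
      ofReal_integral_eq_lintegral_ofReal
        ((integrable_rpow_mul_exp_neg_potential hα0).const_mul _)
        (Eventually.of_forall fun x => by
          have := gibbsMass_pos (d := d) (ε := ε) hα0
          simp only [Pi.zero_apply]; positivity)]
    refine lintegral_congr fun x => ?_
    rw [← ENNReal.ofReal_mul (gibbsDensity_pos hα0 x).le, gibbsDensity]
    congr 1; ring
  set M := (gibbsMass d α ε)⁻¹ *
      ∫ x : EuclideanSpace ℝ (Fin d), g x * exp (-potential d α ε x) with hM
  have hM0 : 0 ≤ M := mul_nonneg (inv_nonneg.2 (gibbsMass_pos hα0).le)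
    (integral_nonneg fun x => by simp only [Pi.zero_apply, hg]; positivity)
  refine ⟨M + 1, by positivity, fun R hR => ?_⟩
  have hRp : 0 < R ^ (α / 2) := rpow_pos_of_pos hR _
  have h2 : ENNReal.ofReal (R ^ (α / 2)) * μ {x | R ≤ ‖x‖} ≤ ENNReal.ofReal M := by
    rw [← h1]
    refine le_trans (mul_le_mul_right (measure_mono fun x hx => ?_) _)
      (mul_meas_ge_le_lintegral hgm.ennreal_ofReal (ENNReal.ofReal (R ^ (α / 2))))
    have hx : R ≤ ‖x‖ := hx
    refine ENNReal.ofReal_le_ofReal ?_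
    calc R ^ (α / 2) = (R ^ 2) ^ (α / 4) := by
          rw [← rpow_natCast, ← rpow_mul hR.le]; congr 1; push_cast; ring
      _ ≤ (1 + ‖x‖ ^ 2) ^ (α / 4) := by
          refine rpow_le_rpow (sq_nonneg R) ?_ (by positivity)
          nlinarith
  rw [rpow_neg hR.le, ← div_eq_mul_inv, ENNReal.ofReal_div_of_pos hRp]
  rw [ENNReal.le_div_iff_mul_le (by left; simpa using hRp) (by left; simp), mul_comm]
  exact h2.trans (ENNReal.ofReal_le_ofReal (by linarith))

theorem rpow_ge_of_le_five_mul {a b : ℝ} (ha : 0 < a) (hab : a ≤ b) (hb : b ≤ 5 * a) (p : ℝ) :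
    5 ^ (-|p|) * a ^ p ≤ b ^ p := by
  rcases le_total 0 p with hp | hp
  · calc 5 ^ (-|p|) * a ^ p ≤ 1 * a ^ p := by
          gcongr; exact rpow_le_one_of_one_le_of_nonpos (by norm_num) (by simp)
      _ ≤ b ^ p := by rw [one_mul]; exact rpow_le_rpow ha.le hab hp
  · rw [abs_of_nonpos hp, neg_neg, ← mul_rpow (by norm_num) ha.le]
    exact rpow_le_rpow_of_nonpos (ha.trans_le hab) hb hp

theorem exists_le_gibbs_tail (hd : 1 ≤ d) (hα0 : 0 < α) (ε : ℝ) : ∃ c : ℝ, 0 < c ∧ ∀ R : ℝ, 3 ≤ R →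
    ENNReal.ofReal (c * (R ^ (-α) * log R ^ (-ε))) ≤
      gibbs (potential d α ε) {x | 2 * R ≤ ‖x‖} := by
  set v := (volume (Metric.ball (0 : EuclideanSpace ℝ (Fin d)) 1)).toReal with hv
  have hv0 : 0 < v := ENNReal.toReal_pos (Metric.measure_ball_pos _ _ one_pos).ne'
    measure_ball_lt_top.ne
  have hZ := gibbsMass_pos (d := d) (ε := ε) hα0
  have : Nonempty (Fin d) := ⟨⟨0, hd⟩⟩
  have : Nontrivial (EuclideanSpace ℝ (Fin d)) :=
    Module.nontrivial_of_finrank_pos (R := ℝ) (by rw [finrank_euclideanSpace_fin]; omega)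
  refine ⟨(gibbsMass d α ε)⁻¹ * 17 ^ (-((d : ℝ) + α) / 2) * 5 ^ (-|-ε|) * v, by positivity,
    fun R hR => ?_⟩
  have hR0 : 0 < R := by linarith
  have hlog : 0 < log R := log_pos (by linarith)
  set e : EuclideanSpace ℝ (Fin d) := PiLp.single 2 ⟨0, hd⟩ (3 * R) with he
  have hen : ‖e‖ = 3 * R := by
    rw [he, PiLp.norm_single, norm_of_nonneg (by positivity)]
  have hball : ∀ x ∈ Metric.ball e R, 2 * R ≤ ‖x‖ ∧ ‖x‖ ≤ 4 * R := fun x hx => by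
    rw [mem_ball_iff_norm] at hx
    have h1 := norm_sub_norm_le e x
    have h2 := norm_sub_norm_le x e
    rw [norm_sub_rev] at h1
    constructor <;> linarith
  refine le_trans ?_ (measure_mono fun x hx => (hball x hx).1)
  rw [gibbs_potential hα0, withDensity_apply _ Metric.isOpen_ball.measurableSet]
  have hlow : ∀ x ∈ Metric.ball e R, (gibbsMass d α ε)⁻¹ * (17 ^ (-((d : ℝ) + α) / 2) *
      R ^ (-((d : ℝ) + α)) * (5 ^ (-|-ε|) * log R ^ (-ε))) ≤ gibbsDensity d α ε x := by
    intro x hx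
    obtain ⟨h1, h2⟩ := hball x hx
    rw [gibbsDensity, exp_neg_potential]
    have h3 : (17 : ℝ) ^ (-((d : ℝ) + α) / 2) * R ^ (-((d : ℝ) + α)) ≤
        (1 + ‖x‖ ^ 2) ^ (-((d : ℝ) + α) / 2) := by
      have : R ^ (-((d : ℝ) + α)) = (R ^ 2) ^ (-((d : ℝ) + α) / 2) := by
        rw [← rpow_natCast, ← rpow_mul hR0.le]; congr 1; push_cast; ring
      rw [this, ← mul_rpow (by norm_num) (sq_nonneg R)]
      refine rpow_le_rpow_of_nonpos (by positivity) (by nlinarith [norm_nonneg x]) ?_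
      rw [neg_div]; exact neg_nonpos.2 (by positivity)
    have hsq : ‖x‖ ^ 2 ≤ 16 * R ^ 2 := by nlinarith [norm_nonneg x]
    have h4 : log R ≤ ell x := log_le_log hR0 (by nlinarith [exp_pos (1 : ℝ), norm_nonneg x])
    have h5 : ell x ≤ 5 * log R := by
      rw [← log_rpow hR0]
      refine log_le_log (by positivity) ?_
      have := exp_one_lt_d9
      have h6 : R ^ (5 : ℝ) = R ^ 5 := by exact_mod_cast rpow_natCast R 5
      have h7 : (3 : ℝ) ^ 3 * R ^ 2 ≤ R ^ 5 := by
        have := pow_le_pow_left₀ (by norm_num) hR 3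
        calc (3 : ℝ) ^ 3 * R ^ 2 ≤ R ^ 3 * R ^ 2 := by gcongr
          _ = R ^ 5 := by ring
      rw [h6]; nlinarith
    have h6 := rpow_ge_of_le_five_mul hlog h4 h5 (-ε)
    gcongr
  calc ENNReal.ofReal _ = ∫⁻ _ in Metric.ball e R, ENNReal.ofReal ((gibbsMass d α ε)⁻¹ *
        (17 ^ (-((d : ℝ) + α) / 2) * R ^ (-((d : ℝ) + α)) * (5 ^ (-|-ε|) * log R ^ (-ε)))) := by
        rw [setLIntegral_const, Measure.addHaar_ball _ _ hR0.le, finrank_euclideanSpace_fin,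
          ← ENNReal.ofReal_toReal (measure_ball_lt_top (x := (0 : EuclideanSpace ℝ (Fin d)))
            (r := 1) (μ := volume)).ne, ← hv, ← ENNReal.ofReal_mul (by positivity),
          ← ENNReal.ofReal_mul (by positivity)]
        have : R ^ (-α) = R ^ (-((d : ℝ) + α)) * R ^ d := by
          rw [← rpow_natCast, ← rpow_add hR0]; congr 1; ring
        rw [this]; congr 1; ring
    _ ≤ _ := setLIntegral_mono' Metric.isOpen_ball.measurableSet
        fun x hx => ENNReal.ofReal_le_ofReal (hlow x hx)

end Potential

section Sharpness

variable {d : ℕ} {α ε : ℝ}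

/-- The radial cutoff vanishing on the ball of radius `R` and equal to `1` off that of radius
`2 R`. -/
noncomputable def radialCutoff (R : ℝ) (x : EuclideanSpace ℝ (Fin d)) : ℝ :=
  max 0 (min 1 (‖x‖ / R - 1))

theorem radialCutoff_nonneg (R : ℝ) (x : EuclideanSpace ℝ (Fin d)) : 0 ≤ radialCutoff R x :=
  le_max_left _ _

theorem radialCutoff_le_one (R : ℝ) (x : EuclideanSpace ℝ (Fin d)) : radialCutoff R x ≤ 1 :=
  max_le zero_le_one (min_le_left _ _)

theorem radialCutoff_of_lt {R : ℝ} (hR : 0 < R) {x : EuclideanSpace ℝ (Fin d)} (hx : ‖x‖ < R) :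
    radialCutoff R x = 0 := by
  have : ‖x‖ / R - 1 ≤ 0 := by rw [sub_nonpos, div_le_one hR]; exact hx.le
  exact max_eq_left ((min_le_right _ _).trans this)

theorem radialCutoff_of_le {R : ℝ} (hR : 0 < R) {x : EuclideanSpace ℝ (Fin d)} (hx : 2 * R ≤ ‖x‖) :
    radialCutoff R x = 1 := by
  have : 1 ≤ ‖x‖ / R - 1 := by rw [le_sub_iff_add_le, le_div_iff₀ hR]; linarith
  rw [radialCutoff, min_eq_left this, max_eq_right zero_le_one]

theorem measurable_radialCutoff (R : ℝ) : Measurable (radialCutoff R (d := d)) := by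
  unfold radialCutoff; fun_prop

theorem radialCutoff_sub_sq_le {R : ℝ} (hR : 0 < R) (x y : EuclideanSpace ℝ (Fin d)) :
    (radialCutoff R x - radialCutoff R y) ^ 2 ≤ 1 * min 1 (‖R⁻¹ • (x - y)‖ ^ 2) := by
  have h1 : |radialCutoff R x - radialCutoff R y| ≤ 1 := by
    rw [abs_le]
    constructor <;> linarith [radialCutoff_nonneg R x, radialCutoff_nonneg R y,
      radialCutoff_le_one R x, radialCutoff_le_one R y]
  have h2 : |radialCutoff R x - radialCutoff R y| ≤ ‖R⁻¹ • (x - y)‖ := by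
    rw [norm_smul, norm_inv, norm_of_nonneg hR.le]
    refine (abs_max_sub_max_le_max _ _ _ _).trans (max_le (by simp; positivity) ?_)
    refine (abs_min_sub_min_le_max _ _ _ _).trans (max_le (by simp; positivity) ?_)
    rw [show ‖x‖ / R - 1 - (‖y‖ / R - 1) = R⁻¹ * (‖x‖ - ‖y‖) by ring, abs_mul,
      abs_of_pos (inv_pos.2 hR)]
    exact mul_le_mul_of_nonneg_left (abs_norm_sub_norm_le x y) (inv_pos.2 hR).le
  rw [one_mul, ← sq_abs]
  refine le_min ?_ (pow_le_pow_left₀ (abs_nonneg _) h2 2)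
  exact pow_le_one₀ (abs_nonneg _) h1

theorem stableForm_sub_const {V : EuclideanSpace ℝ (Fin d) → ℝ}
    (f : EuclideanSpace ℝ (Fin d) → ℝ) (m : ℝ) :
    stableForm α V (fun x => f x - m) (fun x => f x - m) = stableForm α V f f := by
  simp [stableForm]

theorem formDomain_sub_const {V : EuclideanSpace ℝ (Fin d) → ℝ} [IsProbabilityMeasure (gibbs V)]
    {f : EuclideanSpace ℝ (Fin d) → ℝ} (hf : FormDomain α V f) (m : ℝ) :
    FormDomain α V (fun x => f x - m) := by
  refine ⟨hf.1.sub (memLp_const m), ?_⟩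
  simpa using hf.2

theorem stableForm_const_mul {V : EuclideanSpace ℝ (Fin d) → ℝ}
    (f : EuclideanSpace ℝ (Fin d) → ℝ) (m : ℝ) :
    stableForm α V (fun x => m * f x) (fun x => m * f x) = m ^ 2 * stableForm α V f f := by
  rw [stableForm, stableForm, ← integral_const_mul]
  congr 1; ext p; ring

theorem formDomain_const_mul {V : EuclideanSpace ℝ (Fin d) → ℝ} (hV : volume ≪ gibbs V)
    {f : EuclideanSpace ℝ (Fin d) → ℝ} (hf : FormDomain α V f) (m : ℝ) :
    FormDomain α V (fun x => m * f x) := by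
  rw [formDomain_iff hV] at hf ⊢
  refine ⟨hf.1.const_mul m, ?_⟩
  have : diffQuot α (fun x => m * f x) = m • diffQuot α f := diffQuot_smul m f
  rw [this]
  exact hf.2.const_smul m

theorem integral_sub_mean_sq {Ω : Type*} [MeasurableSpace Ω] {μ : Measure Ω}
    [IsProbabilityMeasure μ] {f : Ω → ℝ} (hf : MemLp f 2 μ) :
    ∫ x, (f x - ∫ y, f y ∂μ) ^ 2 ∂μ = ∫ x, f x ^ 2 ∂μ - (∫ x, f x ∂μ) ^ 2 := by
  set m := ∫ y, f y ∂μ with hm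
  have i0 : Integrable f μ := hf.integrable one_le_two
  have i1 : Integrable (fun x => f x ^ 2) μ := (memLp_two_iff_integrable_sq hf.1).1 hf
  have i2 : Integrable (fun x => 2 * m * f x) μ := i0.const_mul _
  have i3 : Integrable (fun x => f x ^ 2 - 2 * m * f x) μ := i1.sub i2
  have : ∀ x, (f x - m) ^ 2 = f x ^ 2 - 2 * m * f x + m ^ 2 := fun x => by ring
  simp_rw [this]
  rw [integral_add i3 (integrable_const _), integral_sub i1 i2, integral_const_mul, ← hm]
  simp only [integral_const, probReal_univ, one_smul]
  ring

theorem integral_sub_mean {Ω : Type*} [MeasurableSpace Ω] {μ : Measure Ω}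
    [IsProbabilityMeasure μ] {f : Ω → ℝ} (hf : MemLp f 2 μ) :
    ∫ x, (f x - ∫ y, f y ∂μ) ∂μ = 0 := by
  rw [integral_sub (hf.integrable one_le_two) (integrable_const _)]; simp

/-- The cutoffs as test functions for the sharpness of the functional inequalities. -/
theorem exists_test_functions (hd : 1 ≤ d) (hα0 : 0 < α) (hα2 : α < 2) (ε : ℝ) :
    ∃ c K C : ℝ, 0 < c ∧ 0 < K ∧ 0 < C ∧ ∀ R : ℝ, 3 ≤ R →
      FormDomain α (potential d α ε) (radialCutoff R) ∧
      stableForm α (potential d α ε) (radialCutoff R) (radialCutoff R) ≤ K * R ^ (-α) ∧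
      c * (R ^ (-α) * log R ^ (-ε)) ≤ ∫ x, radialCutoff R x ^ 2 ∂(gibbs (potential d α ε)) ∧
      ∫ x, radialCutoff R x ^ 2 ∂(gibbs (potential d α ε)) ≤
        (gibbs (potential d α ε)).real {x | R ≤ ‖x‖} ∧
      (∫ x, radialCutoff R x ∂(gibbs (potential d α ε))) ^ 2 ≤
        (∫ x, radialCutoff R x ^ 2 ∂(gibbs (potential d α ε))) * (C * R ^ (-(α / 2))) ∧
      (gibbs (potential d α ε)).real {x | R ≤ ‖x‖} ≤ C * R ^ (-(α / 2)) := by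
  have hprob := isProbabilityMeasure_gibbs (d := d) (ε := ε) hα0
  have hV := volume_absolutelyContinuous_gibbs (d := d) (ε := ε) hα0
  obtain ⟨c, hc, hlow⟩ := exists_le_gibbs_tail hd hα0 ε
  obtain ⟨C, hC, hup⟩ := exists_gibbs_tail_le d hα0 ε
  set μ := gibbs (potential d α ε) with hμ
  have hK0 : 0 ≤ ∫ z, levyKernel d α z := integral_nonneg fun z => levyKernel_nonneg z
  refine ⟨c, (∫ z, levyKernel d α z) + 1, C, hc, by positivity, hC, fun R hR => ?_⟩
  have hR0 : 0 < R := by linarith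
  set b := radialCutoff R (d := d) with hb
  have hlip : ∀ x y, (b x - b y) ^ 2 ≤ 1 * min 1 (‖R⁻¹ • (x - y)‖ ^ 2) :=
    radialCutoff_sub_sq_le hR0
  have hbL : MemLp b 2 μ := MemLp.of_bound (measurable_radialCutoff R).aestronglyMeasurable 1
    (Eventually.of_forall fun x => by
      rw [norm_of_nonneg (radialCutoff_nonneg R x)]; exact radialCutoff_le_one R x)
  have hbD : FormDomain α (potential d α ε) b :=
    formDomain_of_lipschitz hd hα0 hα2 hR0 zero_le_one hlip hbL
  have hA : MeasurableSet {x : EuclideanSpace ℝ (Fin d) | R ≤ ‖x‖} :=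
    measurableSet_le measurable_const measurable_norm
  have hA2 : MeasurableSet {x : EuclideanSpace ℝ (Fin d) | 2 * R ≤ ‖x‖} :=
    measurableSet_le measurable_const measurable_norm
  set q := μ.real {x | R ≤ ‖x‖} with hq
  have hqC : q ≤ C * R ^ (-(α / 2)) :=
    ENNReal.toReal_le_of_le_ofReal (by positivity) (hup R hR0)
  have hi : Integrable (fun x => b x ^ 2) μ := (memLp_two_iff_integrable_sq hbL.1).1 hbL
  have hlow' : c * (R ^ (-α) * log R ^ (-ε)) ≤ ∫ x, b x ^ 2 ∂μ := by
    have h1 : c * (R ^ (-α) * log R ^ (-ε)) ≤ μ.real {x | 2 * R ≤ ‖x‖} :=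
      (ENNReal.ofReal_le_iff_le_toReal (measure_ne_top _ _)).1 (hlow R hR)
    refine h1.trans ?_
    rw [← integral_indicator_one hA2]
    refine integral_mono ((integrable_const (1 : ℝ)).indicator hA2) hi fun x => ?_
    by_cases hx : 2 * R ≤ ‖x‖
    · rw [indicator_of_mem (by exact hx)]; simp [hb, radialCutoff_of_le hR0 hx]
    · rw [indicator_of_notMem (by exact hx)]; exact sq_nonneg _
  have hup' : ∫ x, b x ^ 2 ∂μ ≤ q := by
    rw [hq, ← integral_indicator_one hA]
    refine integral_mono hi ((integrable_const (1 : ℝ)).indicator hA) fun x => ?_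
    by_cases hx : R ≤ ‖x‖
    · rw [indicator_of_mem (by exact hx)]
      exact pow_le_one₀ (radialCutoff_nonneg R x) (radialCutoff_le_one R x)
    · rw [indicator_of_notMem (by exact hx)]; simp [hb, radialCutoff_of_lt hR0 (not_le.1 hx)]
  refine ⟨hbD, ?_, hlow', hup', ?_, hqC⟩
  · have h1 := energy_le_of_lipschitz (V := potential d α ε) hd hα0 hα2 hR0 zero_le_one hlip
    rw [← hbD.ofReal_stableForm hV, ENNReal.ofReal_le_ofReal_iff (by positivity)] at h1
    have := rpow_pos_of_pos hR0 (-α)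
    nlinarith
  · have hlog : 0 < log R := log_pos (by linarith)
    have hs0 : 0 < ∫ x, b x ^ 2 ∂μ := lt_of_lt_of_le (by positivity) hlow'
    have hq0 : 0 < q := hs0.trans_le hup'
    have hib : Integrable b μ := hbL.integrable one_le_two
    set m := ∫ x, b x ∂μ with hm
    have h0 : 0 ≤ ∫ x, (b x ^ 2 - 2 * (m / q) * b x + (m / q) ^ 2 *
        ({x : EuclideanSpace ℝ (Fin d) | R ≤ ‖x‖}.indicator 1 x)) ∂μ := by
      refine integral_nonneg fun x => ?_
      by_cases hx : R ≤ ‖x‖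
      · rw [indicator_of_mem (by exact hx)]
        simp only [Pi.zero_apply, Pi.one_apply]
        nlinarith [sq_nonneg (b x - m / q)]
      · rw [indicator_of_notMem (by exact hx)]; simp [hb, radialCutoff_of_lt hR0 (not_le.1 hx)]
    have i2 : Integrable (fun x => 2 * (m / q) * b x) μ := hib.const_mul _
    have i3 : Integrable (fun x => b x ^ 2 - 2 * (m / q) * b x) μ := hi.sub i2
    have i4 : Integrable (fun x => (m / q) ^ 2 *
        ({x : EuclideanSpace ℝ (Fin d) | R ≤ ‖x‖}.indicator (1 : EuclideanSpace ℝ (Fin d) → ℝ) x)) μ :=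
      ((integrable_const (1 : ℝ)).indicator hA).const_mul _
    rw [integral_add i3 i4, integral_sub hi i2, integral_const_mul, integral_const_mul,
      integral_indicator_one hA, ← hm, ← hq] at h0
    have h1 : m ^ 2 ≤ (∫ x, b x ^ 2 ∂μ) * q := by
      have e : ∫ x, b x ^ 2 ∂μ - 2 * (m / q) * m + (m / q) ^ 2 * q =
          ∫ x, b x ^ 2 ∂μ - m ^ 2 / q := by field_simp; ring
      rw [e, sub_nonneg, div_le_iff₀ hq0] at h0
      exact h0
    exact h1.trans (mul_le_mul_of_nonneg_left hqC hs0.le)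

theorem tendsto_const_mul_rpow_neg (C : ℝ) (hα0 : 0 < α) :
    Tendsto (fun R : ℝ => C * R ^ (-(α / 2))) atTop (𝓝 0) := by
  simpa using (tendsto_rpow_neg_atTop (half_pos hα0)).const_mul C

theorem not_poincareIneq (hd : 1 ≤ d) (hα0 : 0 < α) (hα2 : α < 2) (hε : ε < 0) (C₀ : ℝ) :
    ¬ PoincareIneq α (potential d α ε) C₀ := by
  intro hP
  have hprob := isProbabilityMeasure_gibbs (d := d) (ε := ε) hα0
  obtain ⟨c, K, C, hc, hK, hC, h⟩ := exists_test_functions hd hα0 hα2 ε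
  have h1 : ∀ᶠ R : ℝ in atTop, C * R ^ (-(α / 2)) < 1 / 2 :=
    (tendsto_const_mul_rpow_neg C hα0).eventually (gt_mem_nhds (by norm_num))
  have h2 : Tendsto (fun R : ℝ => log R ^ (-ε)) atTop atTop :=
    (tendsto_rpow_atTop (by linarith)).comp tendsto_log_atTop
  obtain ⟨R, hR1, hR2, hR⟩ := (h1.and ((h2.eventually_gt_atTop (2 * |C₀| * K / c)).and
    (eventually_ge_atTop 3))).exists
  obtain ⟨hD, hE, hlow, -, hm, -⟩ := h R hR
  have hP1 := hP _ (formDomain_sub_const hD _) (integral_sub_mean hD.1)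
  rw [integral_sub_mean_sq hD.1, stableForm_sub_const] at hP1
  have hRα : 0 < R ^ (-α) := rpow_pos_of_pos (by linarith) _
  have hE0 := stableForm_self_nonneg (α := α) (V := potential d α ε) (radialCutoff R)
  rw [div_lt_iff₀ hc] at hR2
  have h3 : C₀ * stableForm α (potential d α ε) (radialCutoff R) (radialCutoff R) ≤
      |C₀| * (K * R ^ (-α)) :=
    (mul_le_mul_of_nonneg_right (le_abs_self C₀) hE0).trans
      (mul_le_mul_of_nonneg_left hE (abs_nonneg _))
  have hs0 : 0 ≤ ∫ x, radialCutoff R x ^ 2 ∂(gibbs (potential d α ε)) :=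
    integral_nonneg fun x => sq_nonneg _
  nlinarith

theorem superPoincareIneq_test {β : ℝ → ℝ} (hSP : SuperPoincareIneq α (potential d α ε) β)
    {c K C R r : ℝ} (hr : 0 < r) (hR : 0 < R)
    (hD : FormDomain α (potential d α ε) (radialCutoff R))
    (hE : stableForm α (potential d α ε) (radialCutoff R) (radialCutoff R) ≤ K * R ^ (-α))
    (hlow : c * (R ^ (-α) * log R ^ (-ε)) ≤
      ∫ x, radialCutoff R x ^ 2 ∂(gibbs (potential d α ε)))
    (hm : (∫ x, radialCutoff R x ∂(gibbs (potential d α ε))) ^ 2 ≤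
        (∫ x, radialCutoff R x ^ 2 ∂(gibbs (potential d α ε))) * (C * R ^ (-(α / 2))))
    (hβ0 : 0 < β r) (hβ : β r * (C * R ^ (-(α / 2))) ≤ 1 / 2) :
    c * log R ^ (-ε) ≤ 2 * (r * K) := by
  have h1 := hSP r hr _ hD
  simp_rw [abs_of_nonneg (radialCutoff_nonneg R _)] at h1
  have hs0 : 0 ≤ ∫ x, radialCutoff R x ^ 2 ∂(gibbs (potential d α ε)) :=
    integral_nonneg fun x => sq_nonneg _
  have h2 := mul_le_mul_of_nonneg_left hm hβ0.le
  have h3 := mul_le_mul_of_nonneg_left hE hr.le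
  have hRα : 0 < R ^ (-α) := rpow_pos_of_pos hR _
  have h4 : c * (R ^ (-α) * log R ^ (-ε)) ≤ 2 * (r * (K * R ^ (-α))) := by nlinarith
  refine le_of_mul_le_mul_right ?_ hRα
  linarith

theorem not_superPoincareIneq (hd : 1 ≤ d) (hα0 : 0 < α) (hα2 : α < 2) (hε : ε ≤ 0) {β : ℝ → ℝ}
    (hβ : ∀ r, 0 < r → 0 < β r) : ¬ SuperPoincareIneq α (potential d α ε) β := by
  intro hSP
  obtain ⟨c, K, C, hc, hK, hC, h⟩ := exists_test_functions hd hα0 hα2 ε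
  have hr : 0 < c / (4 * K) := by positivity
  have h1 : ∀ᶠ R : ℝ in atTop, β (c / (4 * K)) * C * R ^ (-(α / 2)) < 1 / 2 :=
    (tendsto_const_mul_rpow_neg _ hα0).eventually (gt_mem_nhds (by norm_num))
  obtain ⟨R, hR1, hR2, hR⟩ := (h1.and ((tendsto_log_atTop.eventually_ge_atTop 1).and
    (eventually_ge_atTop 3))).exists
  obtain ⟨hD, hE, hlow, -, hm, -⟩ := h R hR
  have h2 := superPoincareIneq_test hSP hr (by linarith) hD hE hlow hm (hβ _ hr)
    (by rw [← mul_assoc]; exact hR1.le)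
  have h3 : 1 ≤ log R ^ (-ε) := one_le_rpow hR2 (by linarith)
  have h4 : 2 * (c / (4 * K) * K) = c / 2 := by field_simp; ring
  rw [h4] at h2
  nlinarith

theorem not_superPoincareIneq_of_tendsto (hd : 1 ≤ d) (hα0 : 0 < α) (hα2 : α < 2) (hε : 0 < ε)
    {β : ℝ → ℝ} (hβ : ∀ r, 0 < r → 0 < β r)
    (hlim : Tendsto (fun r : ℝ => r ^ (1 / ε) * log (β r)) (𝓝[>] 0) (𝓝 0)) :
    ¬ SuperPoincareIneq α (potential d α ε) β := by
  intro hSP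
  obtain ⟨c, K, C, hc, hK, hC, h⟩ := exists_test_functions hd hα0 hα2 ε
  set k := c / (4 * K) with hk
  have hk0 : 0 < k := by positivity
  have hr : Tendsto (fun R : ℝ => k * log R ^ (-ε)) atTop (𝓝[>] 0) := by
    refine tendsto_nhdsWithin_iff.2 ⟨?_, ?_⟩
    · simpa using ((tendsto_rpow_neg_atTop hε).comp tendsto_log_atTop).const_mul k
    · filter_upwards [eventually_gt_atTop 1] with R hR
      exact mul_pos hk0 (rpow_pos_of_pos (log_pos hR) _)
  have h1 : Tendsto (fun R : ℝ => k ^ (1 / ε) * (α / 2 - log (2 * C) / log R)) atTop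
      (𝓝 (k ^ (1 / ε) * (α / 2 - 0))) :=
    ((tendsto_log_atTop.const_div_atTop _).const_sub _).const_mul _
  have h2 : k ^ (1 / ε) * (α / 2 - 0) ≤ 0 := by
    refine le_of_tendsto_of_tendsto h1 (hlim.comp hr) ?_
    filter_upwards [eventually_ge_atTop 3] with R hR
    have hR0 : 0 < R := by linarith
    have hlog : 0 < log R := log_pos (by linarith)
    obtain ⟨hD, hE, hlow, -, hm, -⟩ := h R hR
    set r := k * log R ^ (-ε) with hrdef
    have hr0 : 0 < r := by positivity
    have h3 : 1 / 2 < β r * (C * R ^ (-(α / 2))) := by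
      by_contra! h4
      have h5 := superPoincareIneq_test hSP hr0 hR0 hD hE hlow hm (hβ _ hr0) h4
      have h6 : 2 * (r * K) = c * log R ^ (-ε) / 2 := by rw [hrdef, hk]; field_simp; ring
      have h7 : 0 < c * log R ^ (-ε) := by positivity
      linarith
    have h4 : R ^ (α / 2) < β r * (2 * C) := by
      rw [rpow_neg hR0.le, ← mul_assoc, ← div_eq_mul_inv, lt_div_iff₀ (by positivity)] at h3
      linarith
    have h5 : α / 2 * log R - log (2 * C) ≤ log (β r) := by
      have := log_le_log (by positivity) h4.le
      rw [log_rpow hR0, log_mul (hβ r hr0).ne' (by positivity)] at this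
      linarith
    have h6 : r ^ (1 / ε) = k ^ (1 / ε) * (log R)⁻¹ := by
      rw [hrdef, mul_rpow hk0.le (by positivity), ← rpow_mul hlog.le,
        show -ε * (1 / ε) = -1 by field_simp, rpow_neg_one]
    simp only [Function.comp, ← hrdef]
    rw [h6, mul_assoc]
    refine mul_le_mul_of_nonneg_left ?_ (by positivity)
    rw [← div_eq_inv_mul, le_div_iff₀ hlog, sub_mul, div_mul_cancel₀ _ hlog.ne']
    exact h5
  have h3 : 0 < k ^ (1 / ε) * (α / 2 - 0) := by
    rw [sub_zero]; positivity
  linarith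

theorem mul_log_ge {t T : ℝ} (ht : 0 ≤ t) (hT : 0 < T) : t * log T + t - T ≤ t * log t := by
  rcases ht.eq_or_lt with rfl | ht
  · simp [hT.le]
  · have h1 := log_le_sub_one_of_pos (div_pos hT ht)
    rw [log_div hT.ne' ht.ne'] at h1
    have h2 := mul_le_mul_of_nonneg_left h1 ht.le
    rw [mul_sub, mul_sub, mul_div_cancel₀ _ ht.ne'] at h2
    linarith

theorem not_logSobolevIneq (hd : 1 ≤ d) (hα0 : 0 < α) (hα2 : α < 2) (hε : ε < 1) {C₀ : ℝ}
    (hC₀ : 0 < C₀) : ¬ LogSobolevIneq α (potential d α ε) C₀ := by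
  intro hLS
  have hprob := isProbabilityMeasure_gibbs (d := d) (ε := ε) hα0
  have hV := volume_absolutelyContinuous_gibbs (d := d) (ε := ε) hα0
  obtain ⟨c, K, C, hc, hK, hC, h⟩ := exists_test_functions hd hα0 hα2 ε
  set μ := gibbs (potential d α ε) with hμ
  have key : ∀ R : ℝ, 3 ≤ R → α / 2 * log R - log C ≤ C₀ * K / c * log R ^ ε := by
    intro R hR
    have hR0 : 0 < R := by linarith
    have hlog : 0 < log R := log_pos (by linarith)
    have hRα : 0 < R ^ (-α) := rpow_pos_of_pos hR0 _
    obtain ⟨hD, hE, hlow, hup, -, hq⟩ := h R hR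
    set s := ∫ x, radialCutoff R x ^ 2 ∂μ with hs
    set q := μ.real {x | R ≤ ‖x‖} with hqdef
    have hs0 : 0 < s := lt_of_lt_of_le (by positivity) hlow
    have hq0 : 0 < q := hs0.trans_le hup
    set f : EuclideanSpace ℝ (Fin d) → ℝ := fun x => (√s)⁻¹ * radialCutoff R x with hf
    have hf2 : ∀ x, f x ^ 2 = s⁻¹ * radialCutoff R x ^ 2 := fun x => by
      rw [hf]; simp only; rw [mul_pow, inv_pow, sq_sqrt hs0.le]
    have hfD : FormDomain α (potential d α ε) f := formDomain_const_mul hV hD _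
    have hf1 : ∫ x, f x ^ 2 ∂μ = 1 := by
      simp_rw [hf2]; rw [integral_const_mul, ← hs, inv_mul_cancel₀ hs0.ne']
    obtain ⟨hint, hle⟩ := hLS f hfD hf1
    have hA : MeasurableSet {x : EuclideanSpace ℝ (Fin d) | R ≤ ‖x‖} :=
      measurableSet_le measurable_const measurable_norm
    have i1 : Integrable (fun x => f x ^ 2) μ := (memLp_two_iff_integrable_sq hfD.1.1).1 hfD.1
    have i2 : Integrable (fun x => f x ^ 2 * log q⁻¹) μ := i1.mul_const _
    have i4 : Integrable (fun x => f x ^ 2 * log q⁻¹ + f x ^ 2) μ := i2.add i1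
    have i3 : Integrable (fun x => q⁻¹ *
        ({x : EuclideanSpace ℝ (Fin d) | R ≤ ‖x‖}.indicator (1 : EuclideanSpace ℝ (Fin d) → ℝ) x)) μ :=
      ((integrable_const (1 : ℝ)).indicator hA).const_mul _
    have h1 : log q⁻¹ ≤ ∫ x, f x ^ 2 * log (f x ^ 2) ∂μ := by
      have h2 : ∫ x, (f x ^ 2 * log q⁻¹ + f x ^ 2 - q⁻¹ *
          ({x : EuclideanSpace ℝ (Fin d) | R ≤ ‖x‖}.indicator (1 : EuclideanSpace ℝ (Fin d) → ℝ) x)) ∂μ = log q⁻¹ := by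
        rw [integral_sub i4 i3, integral_add i2 i1, integral_mul_const, integral_const_mul,
          integral_indicator_one hA, hf1, ← hqdef, inv_mul_cancel₀ hq0.ne']
        ring
      rw [← h2]
      refine integral_mono (i4.sub i3) hint fun x => ?_
      by_cases hx : R ≤ ‖x‖
      · simp only
        rw [indicator_of_mem (by exact hx), Pi.one_apply, mul_one]
        exact mul_log_ge (sq_nonneg _) (inv_pos.2 hq0)
      · simp only
        rw [indicator_of_notMem (by exact hx)]
        simp [hf, radialCutoff_of_lt hR0 (not_le.1 hx)]
    have h3 : α / 2 * log R - log C ≤ log q⁻¹ := by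
      rw [log_inv]
      have := log_le_log hq0 hq
      rw [log_mul hC.ne' (by positivity), log_rpow hR0] at this
      linarith
    refine h3.trans (h1.trans (hle.trans ?_))
    rw [hf, stableForm_const_mul, inv_pow, sq_sqrt hs0.le]
    have h4 : C₀ * K / c * log R ^ ε = C₀ * ((c * (R ^ (-α) * log R ^ (-ε)))⁻¹ * (K * R ^ (-α))) := by
      rw [rpow_neg hlog.le]
      have := rpow_pos_of_pos hlog ε
      field_simp
    rw [h4]
    have := stableForm_self_nonneg (α := α) (V := potential d α ε) (radialCutoff R)
    gcongr
  have h1 : Tendsto (fun R : ℝ => α / 2 - log C / log R) atTop (𝓝 (α / 2 - 0)) :=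
    (tendsto_log_atTop.const_div_atTop _).const_sub _
  have h2 : Tendsto (fun R : ℝ => C₀ * K / c * log R ^ (-(1 - ε))) atTop
      (𝓝 (C₀ * K / c * 0)) :=
    ((tendsto_rpow_neg_atTop (by linarith)).comp tendsto_log_atTop).const_mul _
  have h3 := le_of_tendsto_of_tendsto h1 h2 (by
    filter_upwards [eventually_ge_atTop 3] with R hR
    have hlog : 0 < log R := log_pos (by linarith)
    have h4 := key R hR
    have h5 : log R ^ ε = log R ^ (-(1 - ε)) * log R := by
      rw [← rpow_add_one hlog.ne']; congr 1; ring
    rw [h5, ← mul_assoc] at h4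
    have h6 := (div_le_div_iff_of_pos_right hlog).2 h4
    rwa [mul_div_cancel_right₀ _ hlog.ne', sub_div, mul_div_cancel_right₀ _ hlog.ne'] at h6)
  linarith

theorem not_weakPoincareIneq_of_tendsto (hd : 1 ≤ d) (hα0 : 0 < α) (hα2 : α < 2) (hε : ε < 0)
    {β : ℝ → ℝ} (hlim : Tendsto (fun r : ℝ => β r * log (1 + r⁻¹) ^ ε) (𝓝[>] 0) (𝓝 0)) :
    ¬ WeakPoincareIneq α (potential d α ε) β := by
  intro hWP
  have hprob := isProbabilityMeasure_gibbs (d := d) (ε := ε) hα0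
  obtain ⟨c, K, C, hc, hK, hC, h⟩ := exists_test_functions hd hα0 hα2 ε
  set D := log (1 + 4 / c) + α with hDdef
  have hD0 : 0 < D := add_pos (log_pos (by have : 0 < 4 / c := by positivity
                                           linarith)) hα0
  have hr : Tendsto (fun R : ℝ => c / 4 * (R ^ (-α) * log R ^ (-ε))) atTop (𝓝[>] 0) := by
    refine tendsto_nhdsWithin_iff.2 ⟨?_, ?_⟩
    · refine tendsto_of_tendsto_of_tendsto_of_le_of_le' tendsto_const_nhds
        (tendsto_const_mul_rpow_neg C hα0) ?_ ?_
      · filter_upwards [eventually_gt_atTop 1] with R hR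
        have := log_pos hR
        positivity
      · filter_upwards [eventually_ge_atTop 3] with R hR
        obtain ⟨-, -, hlow, hup, -, hq⟩ := h R hR
        have hR0 : 0 < R := by linarith
        have : 0 < log R := log_pos (by linarith)
        have : 0 < c * (R ^ (-α) * log R ^ (-ε)) := by positivity
        linarith
    · filter_upwards [eventually_gt_atTop 1] with R hR
      have := log_pos hR
      simp only [mem_Ioi]; positivity
  have h1 : ∀ᶠ R : ℝ in atTop, C * R ^ (-(α / 2)) < 1 / 2 :=
    (tendsto_const_mul_rpow_neg C hα0).eventually (gt_mem_nhds (by norm_num))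
  have h2 : c / 4 / K * D ^ ε ≤ 0 := by
    refine ge_of_tendsto (hlim.comp hr) ?_
    filter_upwards [h1, tendsto_log_atTop.eventually_ge_atTop 1, eventually_ge_atTop 3] with
      R hR1 hlog hR
    have hR0 : 0 < R := by linarith
    have hlog0 : 0 < log R := by linarith
    have hRα : 0 < R ^ (-α) := rpow_pos_of_pos hR0 _
    have hRα' : 0 < R ^ α := rpow_pos_of_pos hR0 _
    obtain ⟨hD, hE, hlow, -, hm, -⟩ := h R hR
    set r := c / 4 * (R ^ (-α) * log R ^ (-ε)) with hrdef
    have hr0 : 0 < r := by positivity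
    set m := ∫ x, radialCutoff R x ∂(gibbs (potential d α ε)) with hmdef
    have hi : Integrable (radialCutoff R) (gibbs (potential d α ε)) := hD.1.integrable one_le_two
    have hm0 : 0 ≤ m := integral_nonneg fun x => radialCutoff_nonneg R x
    have hm1 : m ≤ 1 := by
      have := integral_mono hi (integrable_const (1 : ℝ)) fun x => radialCutoff_le_one R x
      simpa using this
    have hsup : ∀ x : EuclideanSpace ℝ (Fin d), ‖radialCutoff R x - m‖ ≤ 1 := fun x => by
      rw [Real.norm_eq_abs, abs_le]
      constructor <;> linarith [radialCutoff_nonneg R x, radialCutoff_le_one R x]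
    have hsm : AEStronglyMeasurable (fun x => radialCutoff R x - m)
        (gibbs (potential d α ε)) := hD.1.1.sub aestronglyMeasurable_const
    have hsup' : eLpNorm (fun x => radialCutoff R x - m) ∞ (gibbs (potential d α ε)) ≤
        ENNReal.ofReal 1 := by
      rw [eLpNorm_exponent_top]
      exact eLpNormEssSup_le_of_ae_bound (Eventually.of_forall hsup)
    have h3 := hWP r hr0 _ (formDomain_sub_const hD _)
      ⟨hsm, hsup'.trans_lt ENNReal.ofReal_lt_top⟩ (integral_sub_mean hD.1)
    rw [integral_sub_mean_sq hD.1, stableForm_sub_const] at h3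
    have h4 : r * (eLpNorm (fun x => radialCutoff R x - m) ∞
        (gibbs (potential d α ε))).toReal ^ 2 ≤ r := by
      refine mul_le_of_le_one_right hr0.le (pow_le_one₀ ENNReal.toReal_nonneg ?_)
      exact ENNReal.toReal_le_of_le_ofReal zero_le_one hsup'
    have hs0 : 0 ≤ ∫ x, radialCutoff R x ^ 2 ∂(gibbs (potential d α ε)) :=
      integral_nonneg fun x => sq_nonneg _
    have h5 : r ≤ β r * stableForm α (potential d α ε) (radialCutoff R) (radialCutoff R) := by
      have e : c * (R ^ (-α) * log R ^ (-ε)) = 4 * r := by rw [hrdef]; ring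
      rw [e] at hlow
      nlinarith
    have hE0 := stableForm_self_nonneg (α := α) (V := potential d α ε) (radialCutoff R)
    have hβ0 : 0 ≤ β r := by
      by_contra! hneg
      nlinarith [mul_nonneg_of_nonpos_of_nonpos hneg.le (neg_nonpos.2 hE0)]
    have h6 : c / 4 / K * log R ^ (-ε) ≤ β r := by
      have h7 := h5.trans (mul_le_mul_of_nonneg_left hE hβ0)
      have h8 : c / 4 * log R ^ (-ε) ≤ β r * K := by
        refine le_of_mul_le_mul_right ?_ hRα
        rw [hrdef] at h7
        linarith
      rw [div_mul_eq_mul_div, div_le_iff₀ hK]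
      exact h8
    have h7 : r⁻¹ ≤ 4 / c * R ^ α := by
      rw [hrdef, mul_inv, mul_inv, inv_div, rpow_neg hR0.le, inv_inv, rpow_neg hlog0.le, inv_inv]
      have : log R ^ ε ≤ 1 := rpow_le_one_of_one_le_of_nonpos hlog hε.le
      have h8 : 0 < 4 / c * R ^ α := by positivity
      nlinarith
    have hR1' : 1 ≤ R ^ α := one_le_rpow (by linarith) hα0.le
    have h8 : log (1 + r⁻¹) ≤ D * log R := by
      have h9 : 1 + r⁻¹ ≤ (1 + 4 / c) * R ^ α := by linarith
      have h10 := log_le_log (by positivity) h9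
      rw [log_mul (by positivity) hRα'.ne', log_rpow hR0] at h10
      have h11 : 0 ≤ log (1 + 4 / c) := log_nonneg (by
        have : 0 < 4 / c := by positivity
        linarith)
      rw [hDdef]; nlinarith
    have h9 : 0 < log (1 + r⁻¹) := log_pos (by
      have : 0 < r⁻¹ := by positivity
      linarith)
    have h10 : D ^ ε * log R ^ ε ≤ log (1 + r⁻¹) ^ ε := by
      rw [← mul_rpow hD0.le hlog0.le]
      exact rpow_le_rpow_of_nonpos h9 h8 hε.le
    simp only [Function.comp, ← hrdef]
    calc c / 4 / K * D ^ ε = (c / 4 / K * log R ^ (-ε)) * (D ^ ε * log R ^ ε) := by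
          rw [rpow_neg hlog0.le]
          have := rpow_pos_of_pos hlog0 ε
          field_simp
      _ ≤ _ := mul_le_mul h6 h10 (by positivity) hβ0
  have h3 : 0 < c / 4 / K * D ^ ε := by positivity
  linarith

end Sharpness

section Inequalities

variable {d : ℕ} {α ε : ℝ}

/-- The carré du champ of the form (up to symmetrisation). -/
noncomputable def carre (α : ℝ) (f : EuclideanSpace ℝ (Fin d) → ℝ)
    (x : EuclideanSpace ℝ (Fin d)) : ℝ≥0∞ :=
  ∫⁻ y, ENNReal.ofReal ((f x - f y) ^ 2 / ‖x - y‖ ^ ((d : ℝ) + α))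

theorem measurable_energy_integrand {f : EuclideanSpace ℝ (Fin d) → ℝ} (hf : Measurable f) :
    Measurable fun p : EuclideanSpace ℝ (Fin d) × EuclideanSpace ℝ (Fin d) =>
      ENNReal.ofReal ((f p.1 - f p.2) ^ 2 / ‖p.1 - p.2‖ ^ ((d : ℝ) + α)) := by
  fun_prop

theorem lintegral_carre {V : EuclideanSpace ℝ (Fin d) → ℝ}
    {f : EuclideanSpace ℝ (Fin d) → ℝ} (hf : Measurable f) :
    ∫⁻ x, carre α f x ∂(gibbs V) = energy α V f := by
  rw [energy, lintegral_prod _ (measurable_energy_integrand hf).aemeasurable]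
  rfl

theorem measurable_carre {f : EuclideanSpace ℝ (Fin d) → ℝ} (hf : Measurable f) :
    Measurable (carre α f) :=
  (measurable_energy_integrand hf).lintegral_prod_right'

/-- The constant in the lower bound of the energy by a weighted mean field energy. -/
noncomputable def pairConst (d : ℕ) (α ε : ℝ) : ℝ := (gibbsMass d α ε)⁻¹ * 2 ^ ((d : ℝ) + α)

theorem pairConst_pos (hα0 : 0 < α) : 0 < pairConst d α ε := by
  have := gibbsMass_pos (d := d) (ε := ε) hα0
  rw [pairConst]; positivity

theorem ell_rpow_mul_sq_le (hα0 : 0 < α) {x y : EuclideanSpace ℝ (Fin d)} (h : ‖y‖ ≤ ‖x‖)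
    (f : EuclideanSpace ℝ (Fin d) → ℝ) : ell x ^ ε * (f y - f x) ^ 2 ≤
      pairConst d α ε * ((gibbsDensity d α ε x)⁻¹ *
        ((f y - f x) ^ 2 / ‖y - x‖ ^ ((d : ℝ) + α))) := by
  by_cases hxy : y = x
  · simp [hxy]
  have hn : 0 < ‖y - x‖ := norm_pos_iff.2 (sub_ne_zero.2 hxy)
  have hZ := gibbsMass_pos (d := d) (ε := ε) hα0
  have hβ : 0 ≤ (d : ℝ) + α := by positivity
  have h1 : ‖y - x‖ ^ ((d : ℝ) + α) ≤
      2 ^ ((d : ℝ) + α) * (1 + ‖x‖ ^ 2) ^ (((d : ℝ) + α) / 2) := by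
    have h2 : (1 + ‖x‖ ^ 2) ^ (((d : ℝ) + α) / 2) = √(1 + ‖x‖ ^ 2) ^ ((d : ℝ) + α) := by
      rw [sqrt_eq_rpow, ← rpow_mul (by positivity)]; congr 1; ring
    rw [h2, ← mul_rpow zero_le_two (sqrt_nonneg _)]
    refine rpow_le_rpow hn.le ?_ hβ
    have h3 : ‖x‖ ≤ √(1 + ‖x‖ ^ 2) := le_sqrt_of_sq_le (by linarith)
    linarith [norm_sub_le y x]
  rw [inv_gibbsDensity, pairConst]
  have hp := rpow_pos_of_pos hn ((d : ℝ) + α)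
  have hl := rpow_pos_of_pos (ell_pos x) ε
  rw [show (gibbsMass d α ε)⁻¹ * 2 ^ ((d : ℝ) + α) * (gibbsMass d α ε *
      ((1 + ‖x‖ ^ 2) ^ (((d : ℝ) + α) / 2) * ell x ^ ε) *
      ((f y - f x) ^ 2 / ‖y - x‖ ^ ((d : ℝ) + α))) = ell x ^ ε * (f y - f x) ^ 2 *
      (2 ^ ((d : ℝ) + α) * (1 + ‖x‖ ^ 2) ^ (((d : ℝ) + α) / 2) / ‖y - x‖ ^ ((d : ℝ) + α)) by
    field_simp]
  exact le_mul_of_one_le_right (by positivity) ((one_le_div hp).2 h1)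

/-- The region `|y| ≤ |x|`. -/
def normLE (d : ℕ) : Set (EuclideanSpace ℝ (Fin d) × EuclideanSpace ℝ (Fin d)) :=
  {p | ‖p.1‖ ≤ ‖p.2‖}

theorem measurableSet_normLE : MeasurableSet (normLE d) :=
  measurableSet_le measurable_fst.norm measurable_snd.norm

/-- The energy dominates a weighted mean field energy. -/
theorem lintegral_pair_le (hα0 : 0 < α) {f : EuclideanSpace ℝ (Fin d) → ℝ} (hf : Measurable f) :
    ∫⁻ y, ∫⁻ x, (normLE d).indicator (fun p => ENNReal.ofReal (ell p.2 ^ ε * (f p.1 - f p.2) ^ 2))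
      (y, x) ∂(gibbs (potential d α ε)) ∂(gibbs (potential d α ε)) ≤
      ENNReal.ofReal (pairConst d α ε) * energy α (potential d α ε) f := by
  have hZ := pairConst_pos (d := d) (ε := ε) hα0
  have hm := measurable_carre (α := α) hf
  rw [← lintegral_carre hf, ← lintegral_const_mul _ hm]
  refine lintegral_mono fun y => ?_
  have hmy : Measurable fun x => ENNReal.ofReal ((f y - f x) ^ 2 / ‖y - x‖ ^ ((d : ℝ) + α)) := by
    fun_prop
  have hmm : Measurable fun x => ENNReal.ofReal (gibbsDensity d α ε x)⁻¹ *
      ENNReal.ofReal ((f y - f x) ^ 2 / ‖y - x‖ ^ ((d : ℝ) + α)) :=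
    measurable_gibbsDensity.inv.ennreal_ofReal.mul hmy
  rw [carre, lintegral_volume hα0 (ε := ε) hmy, ← lintegral_const_mul _ hmm]
  refine lintegral_mono fun x => ?_
  by_cases h : ‖y‖ ≤ ‖x‖
  · rw [indicator_of_mem (show (y, x) ∈ normLE d from h)]
    rw [← ENNReal.ofReal_mul (inv_nonneg.2 (gibbsDensity_pos hα0 x).le),
      ← ENNReal.ofReal_mul hZ.le]
    exact ENNReal.ofReal_le_ofReal (ell_rpow_mul_sq_le hα0 h f)
  · rw [indicator_of_notMem (show (y, x) ∉ normLE d from h)]; exact zero_le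

section generalMeasure

variable {Ω : Type*} [MeasurableSpace Ω] {μ : Measure Ω}

theorem lintegral_lintegral_sub_sq [IsProbabilityMeasure μ] {f : Ω → ℝ} (hf : MemLp f 2 μ)
    (hf0 : ∫ x, f x ∂μ = 0) :
    ∫⁻ y, ∫⁻ x, ENNReal.ofReal ((f y - f x) ^ 2) ∂μ ∂μ =
      ENNReal.ofReal (2 * ∫ x, f x ^ 2 ∂μ) := by
  have i0 : Integrable f μ := hf.integrable one_le_two
  have i1 : Integrable (fun x => f x ^ 2) μ := (memLp_two_iff_integrable_sq hf.1).1 hf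
  have h1 : ∀ y, ∫⁻ x, ENNReal.ofReal ((f y - f x) ^ 2) ∂μ =
      ENNReal.ofReal (f y ^ 2 + ∫ x, f x ^ 2 ∂μ) := fun y => by
    have e : ∀ x, (f y - f x) ^ 2 = f y ^ 2 - 2 * f y * f x + f x ^ 2 := fun x => by ring
    have i2 : Integrable (fun x => 2 * f y * f x) μ := i0.const_mul _
    have i3 : Integrable (fun x => f y ^ 2 - 2 * f y * f x) μ := (integrable_const _).sub i2
    have i4 : Integrable (fun x => (f y - f x) ^ 2) μ := by simp_rw [e]; exact i3.add i1
    rw [← ofReal_integral_eq_lintegral_ofReal i4 (Eventually.of_forall fun x => sq_nonneg _)]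
    simp_rw [e]
    rw [integral_add i3 i1, integral_sub (integrable_const _) i2, integral_const_mul, hf0]
    simp
  simp_rw [h1]
  have i5 : Integrable (fun y => f y ^ 2 + ∫ x, f x ^ 2 ∂μ) μ := i1.add (integrable_const _)
  rw [← ofReal_integral_eq_lintegral_ofReal i5
    (Eventually.of_forall fun x => add_nonneg (sq_nonneg _)
      (integral_nonneg fun x => sq_nonneg _)), integral_add i1 (integrable_const _)]
  congr 1
  rw [integral_const]
  simp [two_mul]

theorem ofReal_sq_le_average {ν : Measure Ω} {v σ : ℝ} (hv : 0 < v)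
    (hν : ν univ = ENNReal.ofReal v) (hσ : 0 ≤ σ) (a : ℝ) {g : Ω → ℝ} (hg : Measurable g)
    (hS : ∫⁻ y, ENNReal.ofReal |g y| ∂ν ≤ ENNReal.ofReal σ) :
    ENNReal.ofReal (a ^ 2) ≤ ENNReal.ofReal (2 / v) * ∫⁻ y, ENNReal.ofReal ((a - g y) ^ 2) ∂ν +
      ENNReal.ofReal (4 * (σ / v) ^ 2) := by
  set G := ∫⁻ y, ENNReal.ofReal ((a - g y) ^ 2) ∂ν with hG
  by_cases hGt : G = ∞
  · rw [hGt, ENNReal.mul_top (by simpa using by positivity)]; simp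
  have h1 : ENNReal.ofReal (a ^ 2) * ENNReal.ofReal v ≤
      G + ENNReal.ofReal (2 * |a|) * ENNReal.ofReal σ := by
    rw [← hν, ← lintegral_const]
    calc ∫⁻ _, ENNReal.ofReal (a ^ 2) ∂ν ≤ ∫⁻ y, (ENNReal.ofReal ((a - g y) ^ 2) +
          ENNReal.ofReal (2 * |a|) * ENNReal.ofReal |g y|) ∂ν := by
          refine lintegral_mono fun y => ?_
          rw [← ENNReal.ofReal_mul (by positivity), ← ENNReal.ofReal_add (sq_nonneg _)
            (by positivity)]
          refine ENNReal.ofReal_le_ofReal ?_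
          have := le_abs_self (a * g y)
          rw [abs_mul] at this
          nlinarith [sq_nonneg (g y)]
      _ = G + ENNReal.ofReal (2 * |a|) * ∫⁻ y, ENNReal.ofReal |g y| ∂ν := by
          rw [lintegral_add_left (by fun_prop), lintegral_const_mul _ (by fun_prop)]
      _ ≤ _ := by gcongr
  rw [← ENNReal.ofReal_toReal hGt] at h1 ⊢
  have hγ := ENNReal.toReal_nonneg (a := G)
  rw [← ENNReal.ofReal_mul (by positivity), ← ENNReal.ofReal_mul (by positivity),
    ← ENNReal.ofReal_add hγ (by positivity), ENNReal.ofReal_le_ofReal_iff (by positivity)] at h1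
  rw [← ENNReal.ofReal_mul (by positivity), ← ENNReal.ofReal_add (by positivity) (by positivity)]
  refine ENNReal.ofReal_le_ofReal ?_
  have h2 : a ^ 2 * v ^ 2 ≤ 2 * v * G.toReal + 4 * σ ^ 2 := by
    have h3 := mul_le_mul_of_nonneg_right h1 hv.le
    have h4 := sq_nonneg (|a| * v - 2 * σ)
    have h5 : |a| ^ 2 = a ^ 2 := sq_abs a
    have h6 : |a| ^ 2 * v ^ 2 = a ^ 2 * v ^ 2 := by rw [h5]
    nlinarith
  have h3 : 2 / v * G.toReal + 4 * (σ / v) ^ 2 = (2 * v * G.toReal + 4 * σ ^ 2) / v ^ 2 := by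
    field_simp
  rw [h3, le_div_iff₀ (by positivity)]
  exact h2

theorem ofReal_sq_le_average_sq {ν : Measure Ω} {v : ℝ} (hv : 0 < v)
    (hν : ν univ = ENNReal.ofReal v) (a : ℝ) {g : Ω → ℝ} (hg : Measurable g) :
    ENNReal.ofReal (a ^ 2) ≤ ENNReal.ofReal (2 / v) *
      (∫⁻ y, ENNReal.ofReal ((a - g y) ^ 2) ∂ν + ∫⁻ y, ENNReal.ofReal (g y ^ 2) ∂ν) := by
  have h1 : ENNReal.ofReal v * ENNReal.ofReal (a ^ 2) ≤ ENNReal.ofReal 2 *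
      (∫⁻ y, ENNReal.ofReal ((a - g y) ^ 2) ∂ν + ∫⁻ y, ENNReal.ofReal (g y ^ 2) ∂ν) := by
    rw [← hν, mul_comm, ← lintegral_const, ← lintegral_add_left (by fun_prop),
      ← lintegral_const_mul _ (by fun_prop)]
    refine lintegral_mono fun y => ?_
    rw [← ENNReal.ofReal_add (sq_nonneg _) (sq_nonneg _), ← ENNReal.ofReal_mul zero_le_two]
    exact ENNReal.ofReal_le_ofReal (by nlinarith [sq_nonneg (a - 2 * g y)])
  calc ENNReal.ofReal (a ^ 2) = ENNReal.ofReal v⁻¹ * (ENNReal.ofReal v * ENNReal.ofReal (a ^ 2)) := by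
        rw [← mul_assoc, ← ENNReal.ofReal_mul (by positivity), inv_mul_cancel₀ hv.ne']; simp
    _ ≤ ENNReal.ofReal v⁻¹ * (ENNReal.ofReal 2 * _) := by gcongr
    _ = _ := by
        rw [← mul_assoc, ← ENNReal.ofReal_mul (by positivity)]
        congr 2; field_simp

end generalMeasure

theorem lintegral_sub_sq_le_two_mul {μ : Measure (EuclideanSpace ℝ (Fin d))} [SFinite μ]
    {f : EuclideanSpace ℝ (Fin d) → ℝ} (hf : Measurable f) :
    ∫⁻ y, ∫⁻ x, ENNReal.ofReal ((f y - f x) ^ 2) ∂μ ∂μ ≤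
      2 * ∫⁻ y, ∫⁻ x, (normLE d).indicator (fun p => ENNReal.ofReal ((f p.1 - f p.2) ^ 2))
        (y, x) ∂μ ∂μ := by
  set F : EuclideanSpace ℝ (Fin d) × EuclideanSpace ℝ (Fin d) → ℝ≥0∞ :=
    (normLE d).indicator (fun p => ENNReal.ofReal ((f p.1 - f p.2) ^ 2)) with hF
  have hFm : Measurable F := Measurable.indicator (by fun_prop) measurableSet_normLE
  have h1 : ∫⁻ y, ∫⁻ x, F (y, x) ∂μ ∂μ = ∫⁻ y, ∫⁻ x, F (x, y) ∂μ ∂μ :=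
    lintegral_lintegral_swap hFm.aemeasurable
  calc ∫⁻ y, ∫⁻ x, ENNReal.ofReal ((f y - f x) ^ 2) ∂μ ∂μ ≤
      ∫⁻ y, ∫⁻ x, (F (y, x) + F (x, y)) ∂μ ∂μ := by
        refine lintegral_mono fun y => lintegral_mono fun x => ?_
        rcases le_total ‖y‖ ‖x‖ with h | h
        · rw [hF, indicator_of_mem (show (y, x) ∈ normLE d from h)]
          exact le_self_add
        · rw [hF, indicator_of_mem (show (x, y) ∈ normLE d from h)]
          refine le_add_of_le_right (ENNReal.ofReal_le_ofReal (le_of_eq ?_))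
          ring
    _ = ∫⁻ y, (∫⁻ x, F (y, x) ∂μ + ∫⁻ x, F (x, y) ∂μ) ∂μ := by
        refine lintegral_congr fun y => lintegral_add_left (hFm.comp (by fun_prop)) _
    _ = _ := by
        rw [lintegral_add_left hFm.lintegral_prod_right', ← h1, two_mul]

/-- Reduction of a property of functions in the form domain to measurable functions. -/
theorem FormDomain.exists_measurable {V : EuclideanSpace ℝ (Fin d) → ℝ} (hV : volume ≪ gibbs V)
    {f : EuclideanSpace ℝ (Fin d) → ℝ} (hf : FormDomain α V f) :
    ∃ g, Measurable g ∧ FormDomain α V g ∧ f =ᵐ[gibbs V] g ∧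
      stableForm α V f f = stableForm α V g g :=
  ⟨hf.1.1.mk f, hf.1.1.stronglyMeasurable_mk.measurable,
    (formDomain_congr hV hf.1.1.ae_eq_mk).1 hf, hf.1.1.ae_eq_mk,
    stableForm_congr hV hf.1.1.ae_eq_mk hf.1.1.ae_eq_mk⟩

theorem integral_sq_le_pair {V : EuclideanSpace ℝ (Fin d) → ℝ} [IsProbabilityMeasure (gibbs V)]
    {f : EuclideanSpace ℝ (Fin d) → ℝ} (hfm : Measurable f) (hf : MemLp f 2 (gibbs V))
    (hf0 : ∫ x, f x ∂(gibbs V) = 0) :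
    ENNReal.ofReal (∫ x, f x ^ 2 ∂(gibbs V)) ≤ ∫⁻ y, ∫⁻ x, (normLE d).indicator
      (fun p => ENNReal.ofReal ((f p.1 - f p.2) ^ 2)) (y, x) ∂(gibbs V) ∂(gibbs V) := by
  have h1 := lintegral_sub_sq_le_two_mul (μ := gibbs V) hfm
  rw [lintegral_lintegral_sub_sq hf hf0, ENNReal.ofReal_mul zero_le_two,
    ENNReal.ofReal_ofNat] at h1
  exact (ENNReal.mul_le_mul_iff_right (by simp) (by simp)).1 h1

theorem poincareIneq_of_nonneg (hα0 : 0 < α) (hε : 0 ≤ ε) :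
    PoincareIneq α (potential d α ε) (pairConst d α ε) := by
  intro f hf hf0
  have hprob := isProbabilityMeasure_gibbs (d := d) (ε := ε) hα0
  have hV := volume_absolutelyContinuous_gibbs (d := d) (ε := ε) hα0
  obtain ⟨g, hgm, hg, hfg, he⟩ := hf.exists_measurable hV
  rw [he, integral_congr_ae (hfg.mono fun x hx => by simp only [hx] : (fun x => f x ^ 2) =ᵐ[_]
    fun x => g x ^ 2)]
  rw [integral_congr_ae hfg] at hf0
  have hC := pairConst_pos (d := d) (ε := ε) hα0
  have h0 := stableForm_self_nonneg (α := α) (V := potential d α ε) g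
  rw [← ENNReal.ofReal_le_ofReal_iff (by positivity), ENNReal.ofReal_mul hC.le,
    hg.ofReal_stableForm hV]
  refine (integral_sq_le_pair hgm hg.1 hf0).trans (le_trans ?_ (lintegral_pair_le hα0 hgm))
  refine lintegral_mono fun y => lintegral_mono fun x => indicator_le_indicator ?_
  exact ENNReal.ofReal_le_ofReal (le_mul_of_one_le_left (sq_nonneg _)
    (one_le_rpow (one_le_ell x) hε))

/-- The weak Poincaré estimate with an explicit cutoff radius. -/
theorem integral_sq_le_of_radius (hα0 : 0 < α) (hε : ε < 0) {C : ℝ}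
    (hC : ∀ R : ℝ, 0 < R →
      gibbs (potential d α ε) {x | R ≤ ‖x‖} ≤ ENNReal.ofReal (C * R ^ (-(α / 2))))
    (hC0 : 0 < C) {R : ℝ} (hR : 0 < R)
    {f : EuclideanSpace ℝ (Fin d) → ℝ} (hf : FormDomain α (potential d α ε) f)
    (hfb : MemLp f ∞ (gibbs (potential d α ε)))
    (hf0 : ∫ x, f x ∂(gibbs (potential d α ε)) = 0) :
    ∫ x, f x ^ 2 ∂(gibbs (potential d α ε)) ≤
      pairConst d α ε * log (exp 1 + R ^ 2) ^ (-ε) * stableForm α (potential d α ε) f f +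
        4 * (C * R ^ (-(α / 2))) * (eLpNorm f ∞ (gibbs (potential d α ε))).toReal ^ 2 := by
  have hprob := isProbabilityMeasure_gibbs (d := d) (ε := ε) hα0
  have hV := volume_absolutelyContinuous_gibbs (d := d) (ε := ε) hα0
  obtain ⟨g, hgm, hg, hfg, he⟩ := hf.exists_measurable hV
  set μ := gibbs (potential d α ε) with hμ
  set M := (eLpNorm f ∞ μ).toReal with hM
  have hgM : ∀ᵐ x ∂μ, |g x| ≤ M := by
    have h1 := ae_le_eLpNormEssSup (f := f) (μ := μ)
    rw [← eLpNorm_exponent_top] at h1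
    filter_upwards [h1, hfg] with x hx hx2
    rw [← ofReal_norm, ENNReal.ofReal_le_iff_le_toReal hfb.2.ne, hx2] at hx
    exact hx
  rw [he, integral_congr_ae (hfg.mono fun x hx => by simp only [hx] : (fun x => f x ^ 2) =ᵐ[_]
    fun x => g x ^ 2)]
  rw [integral_congr_ae hfg] at hf0
  have hP := pairConst_pos (d := d) (ε := ε) hα0
  have h0 := stableForm_self_nonneg (α := α) (V := potential d α ε) g
  set T := log (exp 1 + R ^ 2) with hT
  have hT1 : 1 ≤ T := by
    rw [hT, le_log_iff_exp_le (by positivity)]; exact le_add_of_nonneg_right (sq_nonneg _)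
  have hT0 : 0 < T := by linarith
  have hTε := rpow_pos_of_pos hT0 (-ε)
  have hA : MeasurableSet {x : EuclideanSpace ℝ (Fin d) | R ≤ ‖x‖} :=
    measurableSet_le measurable_const measurable_norm
  set F : EuclideanSpace ℝ (Fin d) × EuclideanSpace ℝ (Fin d) → ℝ≥0∞ := (normLE d).indicator
    (fun p => ENNReal.ofReal (ell p.2 ^ ε * (g p.1 - g p.2) ^ 2)) with hF
  have hFm : Measurable F := Measurable.indicator
    (by have := measurable_ell (d := d); fun_prop) measurableSet_normLE
  have hRα := rpow_pos_of_pos hR (-(α / 2))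
  rw [← ENNReal.ofReal_le_ofReal_iff (by positivity), ENNReal.ofReal_add (by positivity)
    (by positivity)]
  refine (integral_sq_le_pair hgm hg.1 hf0).trans ?_
  calc _ ≤ ∫⁻ y, ∫⁻ x, (ENNReal.ofReal (T ^ (-ε)) * F (y, x) +
        {x : EuclideanSpace ℝ (Fin d) | R ≤ ‖x‖}.indicator
          (fun _ => ENNReal.ofReal (4 * M ^ 2)) x) ∂μ ∂μ := by
        refine lintegral_mono_ae ?_
        filter_upwards [hgM] with y hy
        refine lintegral_mono_ae ?_
        filter_upwards [hgM] with x hx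
        by_cases hxy : ‖y‖ ≤ ‖x‖
        · rw [hF, indicator_of_mem (show (y, x) ∈ normLE d from hxy),
            indicator_of_mem (show (y, x) ∈ normLE d from hxy)]
          by_cases hxR : R ≤ ‖x‖
          · rw [indicator_of_mem (by exact hxR)]
            refine le_add_of_le_right (ENNReal.ofReal_le_ofReal ?_)
            rw [abs_le] at hx hy
            simp only
            nlinarith [hx.1, hx.2, hy.1, hy.2]
          · refine le_add_of_le_left ?_
            rw [← ENNReal.ofReal_mul hTε.le]
            refine ENNReal.ofReal_le_ofReal ?_
            rw [← mul_assoc]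
            refine le_mul_of_one_le_left (sq_nonneg _) ?_
            have h1 : ell x ≤ T := by
              refine log_le_log (by positivity) ?_
              have := not_le.1 hxR
              gcongr
            have h2 : T ^ ε ≤ ell x ^ ε := rpow_le_rpow_of_nonpos (ell_pos x) h1 hε.le
            calc (1 : ℝ) = T ^ (-ε) * T ^ ε := by rw [← rpow_add hT0]; simp
              _ ≤ _ := by gcongr
        · rw [indicator_of_notMem (show (y, x) ∉ normLE d from hxy)]; exact zero_le
    _ = ENNReal.ofReal (T ^ (-ε)) * ∫⁻ y, ∫⁻ x, F (y, x) ∂μ ∂μ +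
        ENNReal.ofReal (4 * M ^ 2) * μ {x | R ≤ ‖x‖} := by
        have h1 : ∀ y, ∫⁻ x, (ENNReal.ofReal (T ^ (-ε)) * F (y, x) +
            {x : EuclideanSpace ℝ (Fin d) | R ≤ ‖x‖}.indicator
            (fun _ => ENNReal.ofReal (4 * M ^ 2)) x) ∂μ =
            ENNReal.ofReal (T ^ (-ε)) * ∫⁻ x, F (y, x) ∂μ +
              ENNReal.ofReal (4 * M ^ 2) * μ {x | R ≤ ‖x‖} := fun y => by
          have hFy : Measurable fun x => F (y, x) := hFm.comp measurable_prodMk_left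
          rw [lintegral_add_left (hFy.const_mul _), lintegral_const_mul _ hFy,
            lintegral_indicator_const hA]
        simp_rw [h1]
        rw [lintegral_add_left (hFm.lintegral_prod_right'.const_mul _),
          lintegral_const_mul _ hFm.lintegral_prod_right']
        simp
    _ ≤ ENNReal.ofReal (T ^ (-ε)) * (ENNReal.ofReal (pairConst d α ε) *
          energy α (potential d α ε) g) +
        ENNReal.ofReal (4 * M ^ 2) * ENNReal.ofReal (C * R ^ (-(α / 2))) := by
        gcongr
        · exact lintegral_pair_le hα0 hgm
        · exact hC R hR
    _ = _ := by
        rw [← hg.ofReal_stableForm hV, ← ENNReal.ofReal_mul hP.le, ← ENNReal.ofReal_mul hTε.le,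
          ← ENNReal.ofReal_mul (by positivity)]
        congr 2 <;> ring

theorem exists_weakPoincareIneq (hα0 : 0 < α) (hε : ε < 0) : ∃ c : ℝ, 0 < c ∧
    WeakPoincareIneq α (potential d α ε) (fun r => c * (1 + log (1 + r⁻¹) ^ (-ε))) := by
  obtain ⟨C, hC0, hC⟩ := exists_gibbs_tail_le d hα0 ε
  have hP := pairConst_pos (d := d) (ε := ε) hα0
  set κ := -ε with hκ
  have hκ0 : 0 < κ := by linarith
  set A := 4 * C + 1 with hA
  have hA1 : 1 ≤ A := by linarith
  set D := log (exp 1 + 1) + 4 / α * (log A + 1) with hD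
  have hl1 : 0 ≤ log (exp 1 + 1) := log_nonneg (by linarith [exp_pos (1 : ℝ)])
  have hlA : 0 ≤ log A := log_nonneg hA1
  have hD0 : 0 < D := by positivity
  refine ⟨pairConst d α ε * D ^ κ * 2 ^ κ, by positivity, fun r hr f hf hfb hf0 => ?_⟩
  set R := (4 * C / r) ^ (2 / α) with hR
  have hR0 : 0 < R := by positivity
  have h1 := integral_sq_le_of_radius hα0 hε hC hC0 hR0 hf hfb hf0
  have h2 : 4 * (C * R ^ (-(α / 2))) = r := by
    rw [hR, ← rpow_mul (by positivity), show 2 / α * -(α / 2) = -1 by field_simp, rpow_neg_one]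
    field_simp
  rw [h2] at h1
  refine h1.trans (add_le_add_left (mul_le_mul_of_nonneg_right ?_
    (stableForm_self_nonneg _)) _)
  have hri : 0 < r⁻¹ := inv_pos.2 hr
  set L := log (1 + r⁻¹) with hL
  have hL0 : 0 < L := log_pos (by linarith)
  have h3 : log (exp 1 + R ^ 2) ≤ D * (1 + L) := by
    have e1 : R ^ 2 = (4 * C / r) ^ (4 / α) := by
      rw [hR, ← rpow_natCast, ← rpow_mul (by positivity)]; congr 1; push_cast; ring
    have e2 : (4 * C / r) ^ (4 / α) ≤ (A * (1 + r⁻¹)) ^ (4 / α) := by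
      refine rpow_le_rpow (by positivity) ?_ (by positivity)
      rw [div_eq_mul_inv]
      nlinarith
    have e3 : 1 ≤ (A * (1 + r⁻¹)) ^ (4 / α) := one_le_rpow (by nlinarith) (by positivity)
    have e4 : exp 1 + R ^ 2 ≤ (exp 1 + 1) * (A * (1 + r⁻¹)) ^ (4 / α) := by
      rw [e1]; nlinarith [exp_pos (1 : ℝ)]
    have e5 := log_le_log (by positivity) e4
    rw [log_mul (by positivity) (by positivity), log_rpow (by positivity),
      log_mul (by positivity) (by positivity), ← hL] at e5
    refine e5.trans ?_
    have : 0 ≤ 4 / α := by positivity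
    rw [hD]
    nlinarith [mul_nonneg hl1 hL0.le, mul_nonneg (mul_nonneg this hlA) hL0.le]
  have hT0 : 0 ≤ log (exp 1 + R ^ 2) := log_nonneg (by
    have := add_one_le_exp (1 : ℝ)
    nlinarith [sq_nonneg R])
  have h4 : (1 + L) ^ κ ≤ 2 ^ κ * (1 + L ^ κ) := by
    have hLκ := rpow_pos_of_pos hL0 κ
    have h2κ := rpow_pos_of_pos (two_pos : (0 : ℝ) < 2) κ
    rcases le_total L 1 with h | h
    · calc (1 + L) ^ κ ≤ 2 ^ κ := rpow_le_rpow (by positivity) (by linarith) hκ0.le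
        _ ≤ _ := by nlinarith
    · calc (1 + L) ^ κ ≤ (2 * L) ^ κ := rpow_le_rpow (by positivity) (by linarith) hκ0.le
        _ = 2 ^ κ * L ^ κ := mul_rpow zero_le_two hL0.le
        _ ≤ _ := by nlinarith
  calc pairConst d α ε * log (exp 1 + R ^ 2) ^ κ ≤ pairConst d α ε * (D * (1 + L)) ^ κ := by
        gcongr
    _ = pairConst d α ε * (D ^ κ * (1 + L) ^ κ) := by rw [mul_rpow hD0.le (by positivity)]
    _ ≤ pairConst d α ε * (D ^ κ * (2 ^ κ * (1 + L ^ κ))) := by gcongr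
    _ = _ := by ring

end Inequalities

section SuperPoincare

variable {d : ℕ} {α ε : ℝ}

/-- The volume of the unit ball. -/
noncomputable def unitVolume (d : ℕ) : ℝ :=
  (volume (Metric.ball (0 : EuclideanSpace ℝ (Fin d)) 1)).toReal

theorem unitVolume_pos : 0 < unitVolume d :=
  ENNReal.toReal_pos (Metric.measure_ball_pos _ _ one_pos).ne' measure_ball_lt_top.ne

theorem volume_ball_eq (x : EuclideanSpace ℝ (Fin d)) {δ : ℝ} (hδ : 0 < δ) :
    volume (Metric.ball x δ) = ENNReal.ofReal (δ ^ d * unitVolume d) := by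
  rw [Measure.addHaar_ball_of_pos _ _ hδ, finrank_euclideanSpace_fin, unitVolume,
    ENNReal.ofReal_mul (by positivity), ENNReal.ofReal_toReal measure_ball_lt_top.ne]

theorem inv_gibbsDensity_le (hα0 : 0 < α) (hε : 0 ≤ ε) {x y : EuclideanSpace ℝ (Fin d)}
    (h : ‖y‖ ≤ ‖x‖ + 1) : (gibbsDensity d α ε y)⁻¹ ≤
      gibbsMass d α ε * exp ((d + α + 2 * ε) * ell x) := by
  have hZ := gibbsMass_pos (d := d) (ε := ε) hα0
  have he := add_one_le_exp (1 : ℝ)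
  have hl := one_le_ell x
  have hx := norm_nonneg x
  have hy := norm_nonneg y
  have hexp : exp (ell x) = exp 1 + ‖x‖ ^ 2 := exp_log (by positivity)
  have h2 : 2 * exp (ell x) ≤ exp (2 * ell x) := by
    rw [two_mul (ell x), exp_add]
    have := exp_le_exp.2 hl
    gcongr; linarith
  have h1 : 1 + ‖y‖ ^ 2 ≤ exp (2 * ell x) := by
    refine le_trans ?_ h2; rw [hexp]; nlinarith [sq_nonneg (‖x‖ - 1)]
  have h3 : ell y ≤ exp (2 * ell x) := by
    have h4 : ell y ≤ 2 * ell x := by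
      rw [ell, log_le_iff_le_exp (by positivity)]
      refine le_trans ?_ h2; rw [hexp]; nlinarith [sq_nonneg (‖x‖ - 1)]
    linarith [add_one_le_exp (2 * ell x)]
  rw [inv_gibbsDensity]
  gcongr
  calc (1 + ‖y‖ ^ 2) ^ (((d : ℝ) + α) / 2) * ell y ^ ε ≤
        exp (2 * ell x) ^ (((d : ℝ) + α) / 2) * exp (2 * ell x) ^ ε := by
        have := ell_pos y
        gcongr
    _ = _ := by rw [← exp_mul, ← exp_mul, ← exp_add]; congr 1; ring

/-- Integrals over small balls are controlled by the Gibbs measure. -/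
theorem setLIntegral_ball_le (hα0 : 0 < α) (hε : 0 ≤ ε) (x : EuclideanSpace ℝ (Fin d)) {δ : ℝ}
    (hδ : δ ≤ 1) {g : EuclideanSpace ℝ (Fin d) → ℝ≥0∞} (hg : Measurable g) :
    ∫⁻ y in Metric.ball x δ, g y ≤
      ENNReal.ofReal (gibbsMass d α ε * exp ((d + α + 2 * ε) * ell x)) *
        ∫⁻ y, g y ∂(gibbs (potential d α ε)) := by
  rw [← lintegral_indicator Metric.isOpen_ball.measurableSet,
    lintegral_volume hα0 (ε := ε) (hg.indicator Metric.isOpen_ball.measurableSet),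
    ← lintegral_const_mul _ hg]
  refine lintegral_mono fun y => ?_
  by_cases hy : y ∈ Metric.ball x δ
  · rw [indicator_of_mem hy]
    gcongr
    refine inv_gibbsDensity_le hα0 hε ?_
    rw [mem_ball_iff_norm] at hy
    linarith [norm_sub_norm_le y x]
  · rw [indicator_of_notMem hy]; simp

theorem setLIntegral_ball_sub_sq_le (hα0 : 0 < α) {f : EuclideanSpace ℝ (Fin d) → ℝ}
    (hf : Measurable f) (x : EuclideanSpace ℝ (Fin d)) {δ : ℝ} (hδ : 0 < δ) :
    ∫⁻ y in Metric.ball x δ, ENNReal.ofReal ((f x - f y) ^ 2) ≤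
      ENNReal.ofReal (δ ^ ((d : ℝ) + α)) * carre α f x := by
  rw [carre, ← lintegral_const_mul _ (by fun_prop),
    ← lintegral_indicator Metric.isOpen_ball.measurableSet]
  refine lintegral_mono fun y => ?_
  by_cases hy : y ∈ Metric.ball x δ
  · rw [indicator_of_mem hy, ← ENNReal.ofReal_mul (by positivity)]
    refine ENNReal.ofReal_le_ofReal ?_
    by_cases hxy : x = y
    · simp [hxy]
    have hn : 0 < ‖x - y‖ := norm_pos_iff.2 (sub_ne_zero.2 hxy)
    rw [mem_ball_iff_norm, norm_sub_rev] at hy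
    rw [mul_div_left_comm]
    refine le_mul_of_one_le_right (sq_nonneg _) ((one_le_div (by positivity)).2 ?_)
    gcongr
  · rw [indicator_of_notMem hy]; exact zero_le

/-- The inner integral of the weighted mean field energy. -/
noncomputable def pairField (α ε : ℝ) (f : EuclideanSpace ℝ (Fin d) → ℝ)
    (x : EuclideanSpace ℝ (Fin d)) : ℝ≥0∞ :=
  ∫⁻ y, (normLE d).indicator (fun p => ENNReal.ofReal (ell p.2 ^ ε * (f p.1 - f p.2) ^ 2))
    (y, x) ∂(gibbs (potential d α ε))

theorem measurable_pairField_integrand {f : EuclideanSpace ℝ (Fin d) → ℝ} (hf : Measurable f) :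
    Measurable ((normLE d).indicator
      (fun p => ENNReal.ofReal (ell p.2 ^ ε * (f p.1 - f p.2) ^ 2))) :=
  Measurable.indicator (by have := measurable_ell (d := d); fun_prop) measurableSet_normLE

theorem measurable_pairField (hα0 : 0 < α) {f : EuclideanSpace ℝ (Fin d) → ℝ}
    (hf : Measurable f) : Measurable (pairField α ε f) := by
  have hprob := isProbabilityMeasure_gibbs (d := d) (ε := ε) hα0
  exact (measurable_pairField_integrand hf).lintegral_prod_left'

theorem lintegral_pairField_le (hα0 : 0 < α) {f : EuclideanSpace ℝ (Fin d) → ℝ}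
    (hf : Measurable f) : ∫⁻ x, pairField α ε f x ∂(gibbs (potential d α ε)) ≤
      ENNReal.ofReal (pairConst d α ε) * energy α (potential d α ε) f := by
  have hprob := isProbabilityMeasure_gibbs (d := d) (ε := ε) hα0
  refine le_trans (le_of_eq ?_) (lintegral_pair_le hα0 hf)
  exact lintegral_lintegral_swap (f := fun x y => (normLE d).indicator
    (fun p => ENNReal.ofReal (ell p.2 ^ ε * (f p.1 - f p.2) ^ 2)) (y, x))
    ((measurable_pairField_integrand hf).comp measurable_swap).aemeasurable

theorem setLIntegral_unitBall_le_pairField {f : EuclideanSpace ℝ (Fin d) → ℝ}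
    (hf : Measurable f) {x : EuclideanSpace ℝ (Fin d)} (hx : 1 ≤ ‖x‖) :
    ENNReal.ofReal (ell x ^ ε) * ∫⁻ y in Metric.ball 0 1, ENNReal.ofReal ((f x - f y) ^ 2)
      ∂(gibbs (potential d α ε)) ≤ pairField α ε f x := by
  rw [← lintegral_const_mul _ (by fun_prop), pairField,
    ← lintegral_indicator Metric.isOpen_ball.measurableSet]
  refine lintegral_mono fun y => ?_
  by_cases hy : y ∈ Metric.ball (0 : EuclideanSpace ℝ (Fin d)) 1
  · rw [indicator_of_mem hy, indicator_of_mem (show (y, x) ∈ normLE d from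
      (mem_ball_zero_iff.1 hy).le.trans hx),
      ← ENNReal.ofReal_mul (rpow_nonneg (ell_pos x).le _)]
    refine ENNReal.ofReal_le_ofReal (le_of_eq ?_)
    ring
  · rw [indicator_of_notMem hy]; exact zero_le

/-- The mass of the unit ball. -/
noncomputable def unitMass (d : ℕ) (α ε : ℝ) : ℝ :=
  (gibbs (potential d α ε) (Metric.ball 0 1)).toReal

theorem ofReal_unitMass (hα0 : 0 < α) :
    ENNReal.ofReal (unitMass d α ε) = gibbs (potential d α ε) (Metric.ball 0 1) := by
  have hprob := isProbabilityMeasure_gibbs (d := d) (ε := ε) hα0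
  exact ENNReal.ofReal_toReal (measure_ne_top _ _)

theorem unitMass_pos (hα0 : 0 < α) : 0 < unitMass d α ε := by
  have hprob := isProbabilityMeasure_gibbs (d := d) (ε := ε) hα0
  refine ENNReal.toReal_pos (fun h => ?_) (measure_ne_top _ _)
  exact (Metric.measure_ball_pos volume (0 : EuclideanSpace ℝ (Fin d)) one_pos).ne'
    (volume_absolutelyContinuous_gibbs (ε := ε) hα0 h)

theorem ofReal_sq_le_carre (hα0 : 0 < α) (hε : 0 ≤ ε) {f : EuclideanSpace ℝ (Fin d) → ℝ}
    (hf : Measurable f) {m : ℝ} (hm : 0 ≤ m)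
    (hfm : ∫⁻ y, ENNReal.ofReal |f y| ∂(gibbs (potential d α ε)) ≤ ENNReal.ofReal m)
    (x : EuclideanSpace ℝ (Fin d)) {δ : ℝ} (hδ : 0 < δ) (hδ1 : δ ≤ 1) :
    ENNReal.ofReal (f x ^ 2) ≤ ENNReal.ofReal (2 / unitVolume d * δ ^ α) * carre α f x +
      ENNReal.ofReal (4 * (gibbsMass d α ε * exp ((d + α + 2 * ε) * ell x) * m /
        (δ ^ d * unitVolume d)) ^ 2) := by
  have hv := unitVolume_pos (d := d)
  have hZ := gibbsMass_pos (d := d) (ε := ε) hα0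
  have h1 := ofReal_sq_le_average (ν := volume.restrict (Metric.ball x δ))
    (v := δ ^ d * unitVolume d) (σ := gibbsMass d α ε * exp ((d + α + 2 * ε) * ell x) * m)
    (by positivity) (by rw [Measure.restrict_apply_univ, volume_ball_eq x hδ]) (by positivity)
    (f x) hf (by
      rw [ENNReal.ofReal_mul (by positivity)]
      exact (setLIntegral_ball_le hα0 hε x hδ1 (by fun_prop)).trans (by gcongr))
  refine h1.trans (add_le_add_left ?_ _)
  calc _ ≤ ENNReal.ofReal (2 / (δ ^ d * unitVolume d)) *
        (ENNReal.ofReal (δ ^ ((d : ℝ) + α)) * carre α f x) := by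
        gcongr; exact setLIntegral_ball_sub_sq_le hα0 hf x hδ
    _ = _ := by
        rw [← mul_assoc, ← ENNReal.ofReal_mul (by positivity), rpow_add hδ, rpow_natCast]
        congr 2; field_simp

theorem ofReal_sq_le_pairField (hα0 : 0 < α) (hε : 0 ≤ ε) {f : EuclideanSpace ℝ (Fin d) → ℝ}
    (hf : Measurable f) {m : ℝ} (hm : 0 ≤ m)
    (hfm : ∫⁻ y, ENNReal.ofReal |f y| ∂(gibbs (potential d α ε)) ≤ ENNReal.ofReal m)
    {T : ℝ} (hT : 2 ≤ T) {x : EuclideanSpace ℝ (Fin d)} (hx : T ≤ ell x) :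
    ENNReal.ofReal (f x ^ 2) ≤ ENNReal.ofReal (2 / unitMass d α ε * T ^ (-ε)) * pairField α ε f x +
      ENNReal.ofReal (4 * (m / unitMass d α ε) ^ 2) := by
  have hp := unitMass_pos (d := d) (ε := ε) hα0
  have hT0 : 0 < T := by linarith
  have hTε := rpow_pos_of_pos hT0 (-ε)
  have hx1 : 1 ≤ ‖x‖ := by
    have h1 := hT.trans hx
    rw [ell, le_log_iff_exp_le (by positivity)] at h1
    have h2 : exp 2 = exp 1 * exp 1 := by rw [← exp_add]; norm_num
    have h3 := add_one_le_exp (1 : ℝ)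
    by_contra! h
    nlinarith [norm_nonneg x]
  have h1 := ofReal_sq_le_average (ν := (gibbs (potential d α ε)).restrict (Metric.ball 0 1))
    hp (by rw [Measure.restrict_apply_univ, ofReal_unitMass hα0]) hm (f x) hf
    ((setLIntegral_le_lintegral _ _).trans hfm)
  refine h1.trans (add_le_add_left ?_ _)
  rw [ENNReal.ofReal_mul (by positivity), mul_assoc]
  gcongr
  refine le_trans ?_ (mul_le_mul_right (setLIntegral_unitBall_le_pairField (ε := ε) hf hx1) _)
  rw [← mul_assoc, ← ENNReal.ofReal_mul hTε.le]
  refine le_mul_of_one_le_left zero_le (ENNReal.one_le_ofReal.2 ?_)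
  calc (1 : ℝ) = T ^ (-ε) * T ^ ε := by rw [← rpow_add hT0]; simp
    _ ≤ _ := by gcongr

theorem integral_sq_le_of_scales (hα0 : 0 < α) (hε : 0 ≤ ε)
    {f : EuclideanSpace ℝ (Fin d) → ℝ} (hf : FormDomain α (potential d α ε) f) {T δ : ℝ}
    (hT : 2 ≤ T) (hδ : 0 < δ) (hδ1 : δ ≤ 1) :
    ∫ x, f x ^ 2 ∂(gibbs (potential d α ε)) ≤
      (2 / unitVolume d * δ ^ α + 2 / unitMass d α ε * pairConst d α ε * T ^ (-ε)) *
        stableForm α (potential d α ε) f f +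
      4 * ((gibbsMass d α ε / unitVolume d) ^ 2 + (1 / unitMass d α ε) ^ 2) *
        (exp ((d + α + 2 * ε) * T) * δ⁻¹ ^ d) ^ 2 *
        (∫ x, |f x| ∂(gibbs (potential d α ε))) ^ 2 := by
  have hprob := isProbabilityMeasure_gibbs (d := d) (ε := ε) hα0
  have hV := volume_absolutelyContinuous_gibbs (d := d) (ε := ε) hα0
  have hv := unitVolume_pos (d := d)
  have hZ := gibbsMass_pos (d := d) (ε := ε) hα0
  have hp := unitMass_pos (d := d) (ε := ε) hα0
  have hC := pairConst_pos (d := d) (ε := ε) hα0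
  obtain ⟨g, hgm, hg, hfg, he⟩ := hf.exists_measurable hV
  have hT0 : 0 < T := by linarith
  set μ := gibbs (potential d α ε) with hμ
  rw [he, integral_congr_ae (hfg.mono fun x hx => by simp only [hx] : (fun x => f x ^ 2) =ᵐ[_]
    fun x => g x ^ 2), integral_congr_ae (hfg.mono fun x hx => by simp only [hx] :
    (fun x => |f x|) =ᵐ[_] fun x => |g x|)]
  set m := ∫ x, |g x| ∂μ with hm
  have hm0 : 0 ≤ m := integral_nonneg fun x => abs_nonneg _
  have hgi : Integrable g μ := hg.1.integrable one_le_two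
  have hgm1 : ∫⁻ y, ENNReal.ofReal |g y| ∂μ ≤ ENNReal.ofReal m :=
    (ofReal_integral_eq_lintegral_ofReal hgi.abs
      (Eventually.of_forall fun x => abs_nonneg _)).ge
  have h0 := stableForm_self_nonneg (α := α) (V := potential d α ε) g
  set B := (d : ℝ) + α + 2 * ε with hB
  have hB0 : 0 ≤ B := by positivity
  set K := 4 * ((gibbsMass d α ε / unitVolume d) ^ 2 + (1 / unitMass d α ε) ^ 2) *
        (exp (B * T) * δ⁻¹ ^ d) ^ 2 * m ^ 2 with hK
  set a₁ := 2 / unitVolume d * δ ^ α with ha₁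
  set a₂ := 2 / unitMass d α ε * T ^ (-ε) with ha₂
  have hpt : ∀ x, ENNReal.ofReal (g x ^ 2) ≤ ENNReal.ofReal a₁ * carre α g x +
      ENNReal.ofReal a₂ * pairField α ε g x + ENNReal.ofReal K := fun x => by
    rcases le_total (ell x) T with h | h
    · refine (ofReal_sq_le_carre hα0 hε hgm hm0 hgm1 x hδ hδ1).trans ?_
      refine add_le_add le_self_add (ENNReal.ofReal_le_ofReal ?_)
      calc 4 * (gibbsMass d α ε * exp (B * ell x) * m / (δ ^ d * unitVolume d)) ^ 2 ≤
            4 * (gibbsMass d α ε * exp (B * T) * m / (δ ^ d * unitVolume d)) ^ 2 := by gcongr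
        _ = 4 * (gibbsMass d α ε / unitVolume d) ^ 2 * (exp (B * T) * δ⁻¹ ^ d) ^ 2 * m ^ 2 := by
            rw [inv_pow]; field_simp
        _ ≤ _ := by rw [hK]; gcongr; exact le_add_of_nonneg_right (sq_nonneg _)
    · refine (ofReal_sq_le_pairField hα0 hε hgm hm0 hgm1 hT h).trans ?_
      refine add_le_add le_add_self (ENNReal.ofReal_le_ofReal ?_)
      have h1 : 1 ≤ (exp (B * T) * δ⁻¹ ^ d) ^ 2 :=
        one_le_pow₀ (one_le_mul_of_one_le_of_one_le (one_le_exp (by positivity))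
          (one_le_pow₀ ((one_le_inv₀ hδ).2 hδ1)))
      calc 4 * (m / unitMass d α ε) ^ 2 = 4 * (1 / unitMass d α ε) ^ 2 * 1 * m ^ 2 := by ring
        _ ≤ _ := by rw [hK]; gcongr; exact le_add_of_nonneg_left (sq_nonneg _)
  have hcm := measurable_carre (α := α) hgm
  have hpm := measurable_pairField (ε := ε) hα0 hgm
  have hi : Integrable (fun x => g x ^ 2) μ := (memLp_two_iff_integrable_sq hg.1.1).1 hg.1
  have ha₁0 : 0 ≤ a₁ := by positivity
  have ha₂0 : 0 ≤ a₂ := by positivity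
  have hK0 : 0 ≤ K := by positivity
  rw [← ENNReal.ofReal_le_ofReal_iff (by positivity),
    ofReal_integral_eq_lintegral_ofReal hi (Eventually.of_forall fun x => sq_nonneg _)]
  calc _ ≤ ∫⁻ x, (ENNReal.ofReal a₁ * carre α g x +
        ENNReal.ofReal a₂ * pairField α ε g x + ENNReal.ofReal K) ∂μ := lintegral_mono hpt
    _ = ENNReal.ofReal a₁ * energy α (potential d α ε) g +
        ENNReal.ofReal a₂ * ∫⁻ x, pairField α ε g x ∂μ + ENNReal.ofReal K := by
        rw [lintegral_add_right _ measurable_const, lintegral_add_left (hcm.const_mul _),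
          lintegral_const_mul _ hcm, lintegral_const_mul _ hpm, lintegral_carre hgm]
        simp
    _ ≤ ENNReal.ofReal a₁ * energy α (potential d α ε) g +
        ENNReal.ofReal a₂ * (ENNReal.ofReal (pairConst d α ε) * energy α (potential d α ε) g) +
        ENNReal.ofReal K := by gcongr; exact lintegral_pairField_le hα0 hgm
    _ = _ := by
        rw [← hg.ofReal_stableForm hV, ← ENNReal.ofReal_mul hC.le, ← ENNReal.ofReal_mul ha₁0,
          ← ENNReal.ofReal_mul ha₂0, ← ENNReal.ofReal_add (by positivity) (by positivity),
          ← ENNReal.ofReal_add (by positivity) hK0]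
        congr 2; rw [ha₂]; ring

theorem exists_superPoincareIneq (hα0 : 0 < α) (hε : 0 < ε) : ∃ c : ℝ, 0 < c ∧
    SuperPoincareIneq α (potential d α ε) (fun r => exp (c * (1 + r ^ (-1 / ε)))) := by
  have hv := unitVolume_pos (d := d)
  have hZ := gibbsMass_pos (d := d) (ε := ε) hα0
  have hp := unitMass_pos (d := d) (ε := ε) hα0
  have hC := pairConst_pos (d := d) (ε := ε) hα0
  set A₁ := 2 / unitVolume d with hA₁
  set A₂ := 2 / unitMass d α ε * pairConst d α ε with hA₂
  set A₃ := 4 * ((gibbsMass d α ε / unitVolume d) ^ 2 + (1 / unitMass d α ε) ^ 2) with hA₃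
  set B := (d : ℝ) + α + 2 * ε with hB
  set a := (2 * A₁) ^ (1 / α) with ha
  set b := (2 * A₂) ^ (1 / ε) with hb
  set q := ε / α with hq
  have hA₁0 : 0 < A₁ := by positivity
  have hA₂0 : 0 < A₂ := by positivity
  have hA₃0 : 0 < A₃ := by positivity
  have hB0 : 0 < B := by positivity
  have ha0 : 0 < a := by positivity
  have hb0 : 0 < b := by positivity
  have hq0 : 0 < q := by positivity
  set K := A₃ * ((1 + a) ^ d) ^ 2 with hK
  have hK0 : 0 < K := by positivity
  refine ⟨|log K| + 4 * B + 2 * B * b + 2 * d * q + 1, by positivity, fun r hr f hf => ?_⟩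
  set x := r ^ (-1 / ε) with hx
  have hx0 : 0 < x := rpow_pos_of_pos hr _
  have hrx : ∀ p : ℝ, x ^ (ε * p) = r ^ (-p) := fun p => by
    rw [hx, ← rpow_mul hr.le]; congr 1; field_simp
  set δ := min 1 (a * x ^ q)⁻¹ with hδ
  have hxq : 0 < x ^ q := rpow_pos_of_pos hx0 _
  have hδ0 : 0 < δ := lt_min one_pos (by positivity)
  have h := integral_sq_le_of_scales hα0 hε.le hf (T := 2 + b * x) (δ := δ)
    (by linarith [mul_pos hb0 hx0]) hδ0 (min_le_left _ _)
  refine h.trans (add_le_add (mul_le_mul_of_nonneg_right ?_ (stableForm_self_nonneg _))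
    (mul_le_mul_of_nonneg_right ?_ (sq_nonneg _)))
  · have h1 : A₁ * δ ^ α ≤ r / 2 := by
      calc A₁ * δ ^ α ≤ A₁ * ((a * x ^ q)⁻¹) ^ α := by
            gcongr; exact min_le_right _ _
        _ = r / 2 := by
            rw [inv_rpow (by positivity), mul_rpow ha0.le hxq.le, ha, ← rpow_mul (by positivity),
              ← rpow_mul hx0.le, one_div_mul_cancel hα0.ne', rpow_one,
              show q * α = ε * 1 by rw [hq]; field_simp, hrx, rpow_neg_one]
            field_simp
    have h2 : A₂ * (2 + b * x) ^ (-ε) ≤ r / 2 := by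
      calc A₂ * (2 + b * x) ^ (-ε) ≤ A₂ * (b * x) ^ (-ε) := by
            gcongr A₂ * ?_
            exact rpow_le_rpow_of_nonpos (by positivity) (by linarith) (by linarith)
        _ = r / 2 := by
            rw [mul_rpow hb0.le hx0.le, hb, ← rpow_mul (by positivity),
              show 1 / ε * -ε = -1 by field_simp, show -ε = ε * (-1) by ring, hrx, rpow_neg_one]
            simp only [neg_neg, rpow_one]
            field_simp
    linarith
  · have h1 : δ⁻¹ ≤ (1 + a) * exp (q * x) := by
      have e1 : 1 ≤ exp (q * x) := one_le_exp (by positivity)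
      have e2 : x ^ q ≤ exp (q * x) := by
        rw [mul_comm, exp_mul]
        exact rpow_le_rpow hx0.le (by linarith [add_one_le_exp x]) hq0.le
      rcases min_choice 1 (a * x ^ q)⁻¹ with h1 | h1
      · rw [hδ, h1, inv_one]; nlinarith
      · rw [hδ, h1, inv_inv]; nlinarith
    calc A₃ * (exp (B * (2 + b * x)) * δ⁻¹ ^ d) ^ 2 ≤
          A₃ * (exp (B * (2 + b * x)) * ((1 + a) * exp (q * x)) ^ d) ^ 2 := by gcongr
      _ = K * exp (4 * B + (2 * B * b + 2 * d * q) * x) := by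
          have e : exp (4 * B + (2 * B * b + 2 * d * q) * x) =
              (exp (B * (2 + b * x)) * exp (q * x) ^ d) ^ 2 := by
            rw [← exp_nat_mul, ← exp_add, ← exp_nat_mul]; congr 1; push_cast; ring
          rw [hK, e, mul_pow (1 + a)]; ring
      _ = exp (log K + (4 * B + (2 * B * b + 2 * d * q) * x)) := by
          rw [exp_add (log K), exp_log hK0]
      _ ≤ _ := by
          rw [exp_le_exp]
          have := le_abs_self (log K)
          have h3 : 0 ≤ |log K| * x := by positivity
          have h4 : 0 ≤ B * x := by positivity
          have h5 : 0 ≤ B * b := by positivity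
          have h6 : 0 ≤ (d : ℝ) * q := by positivity
          linarith

end SuperPoincare

section LogSobolev

variable {d : ℕ} {α ε : ℝ}

theorem exists_lintegral_ell_rpow_le (hα0 : 0 < α) : ∃ M : ℝ, 0 < M ∧
    ∫⁻ x, ENNReal.ofReal (ell x ^ ε) ∂(gibbs (potential d α ε)) ≤ ENNReal.ofReal M := by
  obtain ⟨C, hC, h⟩ := exists_ell_rpow_le (d := d) ε (η := α / 4) (by positivity)
  have hZ := gibbsMass_pos (d := d) (ε := ε) hα0
  have hi := (integrable_rpow_mul_exp_neg_potential (d := d) (ε := ε) hα0).const_mul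
    ((gibbsMass d α ε)⁻¹ * C)
  set M := ∫ x : EuclideanSpace ℝ (Fin d), (gibbsMass d α ε)⁻¹ * C *
    ((1 + ‖x‖ ^ 2) ^ (α / 4) * exp (-potential d α ε x)) with hM
  have h0 : ∀ x : EuclideanSpace ℝ (Fin d), 0 ≤ (gibbsMass d α ε)⁻¹ * C *
    ((1 + ‖x‖ ^ 2) ^ (α / 4) * exp (-potential d α ε x)) := fun x => by positivity
  have hM0 : 0 ≤ M := integral_nonneg h0
  refine ⟨M + 1, by positivity, ?_⟩
  have := measurable_ell (d := d)
  rw [lintegral_gibbs hα0 (by fun_prop)]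
  refine le_trans ?_ (ENNReal.ofReal_le_ofReal (by linarith : M ≤ M + 1))
  rw [hM, ofReal_integral_eq_lintegral_ofReal hi (Eventually.of_forall h0)]
  refine lintegral_mono fun x => ?_
  rw [← ENNReal.ofReal_mul (gibbsDensity_pos hα0 x).le]
  refine ENNReal.ofReal_le_ofReal ?_
  rw [gibbsDensity]
  calc _ ≤ (gibbsMass d α ε)⁻¹ * exp (-potential d α ε x) * (C * (1 + ‖x‖ ^ 2) ^ (α / 4)) := by
        gcongr; exact h x
    _ = _ := by ring

/-- The weighted `L²` estimate away from the origin. -/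
theorem lintegral_ell_mul_sq_le (hα0 : 0 < α) (hε : 1 ≤ ε) {M s e : ℝ} (hM0 : 0 < M)
    (hM : ∫⁻ x, ENNReal.ofReal (ell x ^ ε) ∂(gibbs (potential d α ε)) ≤ ENNReal.ofReal M)
    {h : EuclideanSpace ℝ (Fin d) → ℝ} (hh : Measurable h) (hs0 : 0 ≤ s) (he0 : 0 ≤ e)
    (hs : ∫⁻ x, ENNReal.ofReal (h x ^ 2) ∂(gibbs (potential d α ε)) ≤ ENNReal.ofReal s)
    (he : energy α (potential d α ε) h ≤ ENNReal.ofReal e) :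
    ∫⁻ x, ENNReal.ofReal (ell x * h x ^ 2) ∂(gibbs (potential d α ε)) ≤
      ENNReal.ofReal (2 * s + 2 / unitMass d α ε * (pairConst d α ε * e + M * s)) := by
  have hprob := isProbabilityMeasure_gibbs (d := d) (ε := ε) hα0
  have hp := unitMass_pos (d := d) (ε := ε) hα0
  have hC := pairConst_pos (d := d) (ε := ε) hα0
  have hlm := measurable_ell (d := d)
  have hpm := measurable_pairField (ε := ε) hα0 hh
  set μ := gibbs (potential d α ε) with hμ
  have hpt : ∀ x, ENNReal.ofReal (ell x * h x ^ 2) ≤ ENNReal.ofReal 2 * ENNReal.ofReal (h x ^ 2) +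
      ENNReal.ofReal (2 / unitMass d α ε) * (pairField α ε h x +
        ENNReal.ofReal (ell x ^ ε) * ENNReal.ofReal s) := fun x => by
    rcases lt_or_ge ‖x‖ 1 with hx | hx
    · refine le_add_of_le_left ?_
      rw [← ENNReal.ofReal_mul zero_le_two]
      refine ENNReal.ofReal_le_ofReal ?_
      have h1 : ell x ≤ 2 := by
        rw [ell, log_le_iff_le_exp (by positivity)]
        have h2 : exp 2 = exp 1 * exp 1 := by rw [← exp_add]; norm_num
        have h3 := add_one_le_exp (1 : ℝ)
        nlinarith [norm_nonneg x]
      gcongr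
    · refine le_add_of_le_right ?_
      have h1 := ofReal_sq_le_average_sq (ν := μ.restrict (Metric.ball 0 1)) hp
        (by rw [Measure.restrict_apply_univ, ofReal_unitMass hα0]) (h x) hh
      calc ENNReal.ofReal (ell x * h x ^ 2) ≤
            ENNReal.ofReal (ell x ^ ε) * ENNReal.ofReal (h x ^ 2) := by
            rw [← ENNReal.ofReal_mul (rpow_nonneg (ell_pos x).le _)]
            refine ENNReal.ofReal_le_ofReal ?_
            gcongr
            simpa using rpow_le_rpow_of_exponent_le (one_le_ell x) hε
        _ ≤ ENNReal.ofReal (ell x ^ ε) * (ENNReal.ofReal (2 / unitMass d α ε) *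
            (∫⁻ y in Metric.ball 0 1, ENNReal.ofReal ((h x - h y) ^ 2) ∂μ + ENNReal.ofReal s)) := by
            refine mul_le_mul_right (h1.trans ?_) _
            gcongr
            exact (setLIntegral_le_lintegral _ _).trans hs
        _ = ENNReal.ofReal (2 / unitMass d α ε) * (ENNReal.ofReal (ell x ^ ε) *
            ∫⁻ y in Metric.ball 0 1, ENNReal.ofReal ((h x - h y) ^ 2) ∂μ +
              ENNReal.ofReal (ell x ^ ε) * ENNReal.ofReal s) := by ring
        _ ≤ _ := by gcongr; exact setLIntegral_unitBall_le_pairField hh hx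
  calc _ ≤ ∫⁻ x, (ENNReal.ofReal 2 * ENNReal.ofReal (h x ^ 2) +
      ENNReal.ofReal (2 / unitMass d α ε) * (pairField α ε h x +
        ENNReal.ofReal (ell x ^ ε) * ENNReal.ofReal s)) ∂μ := lintegral_mono hpt
    _ = ENNReal.ofReal 2 * ∫⁻ x, ENNReal.ofReal (h x ^ 2) ∂μ +
        ENNReal.ofReal (2 / unitMass d α ε) * (∫⁻ x, pairField α ε h x ∂μ +
          (∫⁻ x, ENNReal.ofReal (ell x ^ ε) ∂μ) * ENNReal.ofReal s) := by
        rw [lintegral_add_left (by fun_prop), lintegral_const_mul _ (by fun_prop),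
          lintegral_const_mul _ (by fun_prop), lintegral_add_left hpm,
          lintegral_mul_const _ (by fun_prop)]
    _ ≤ ENNReal.ofReal 2 * ENNReal.ofReal s + ENNReal.ofReal (2 / unitMass d α ε) *
        (ENNReal.ofReal (pairConst d α ε) * ENNReal.ofReal e +
          ENNReal.ofReal M * ENNReal.ofReal s) := by
        gcongr
        exact (lintegral_pairField_le hα0 hh).trans (by gcongr)
    _ = _ := by
        rw [← ENNReal.ofReal_mul zero_le_two, ← ENNReal.ofReal_mul hC.le,
          ← ENNReal.ofReal_mul hM0.le, ← ENNReal.ofReal_add (by positivity) (by positivity),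
          ← ENNReal.ofReal_mul (by positivity), ← ENNReal.ofReal_add (by positivity)
          (by positivity)]

theorem log_one_add_le_rpow {k p : ℝ} (hk : 1 ≤ k) (hp : 0 < p) :
    log (1 + k) ≤ (1 + 1 / p) * k ^ p := by
  have hk0 : 0 < k := by linarith
  have h1 : log (1 + k) ≤ log 2 + log k := by
    rw [← log_mul two_ne_zero hk0.ne']; exact log_le_log (by positivity) (by linarith)
  have h2 := log_le_rpow_div hk0.le hp
  have h3 := log_two_lt_d9
  have h4 := one_le_rpow hk hp.le
  have : (1 + 1 / p) * k ^ p = k ^ p + k ^ p / p := by ring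
  linarith

/-- The local Sobolev type estimate. -/
theorem ofReal_rpow_mul_sq_le_carre (hd : 1 ≤ d) (hα0 : 0 < α) (hε : 0 ≤ ε)
    {h : EuclideanSpace ℝ (Fin d) → ℝ} (hh : Measurable h)
    (hs : ∫⁻ x, ENNReal.ofReal (h x ^ 2) ∂(gibbs (potential d α ε)) ≤ ENNReal.ofReal 2)
    (x : EuclideanSpace ℝ (Fin d)) {Q : ℝ} (hQ0 : 0 < Q)
    (hQ : 8 / unitVolume d * (gibbsMass d α ε * exp ((d + α + 2 * ε) * ell x)) ≤ Q)
    (hx : Q ≤ h x ^ 2) :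
    ENNReal.ofReal (h x ^ 2 * (h x ^ 2 / Q) ^ (α / d)) ≤
      ENNReal.ofReal (4 / unitVolume d) * carre α h x := by
  have hv := unitVolume_pos (d := d)
  have hZ := gibbsMass_pos (d := d) (ε := ε) hα0
  have hd0 : (0 : ℝ) < d := by exact_mod_cast hd
  set k := h x ^ 2 / Q with hk
  have hk1 : 1 ≤ k := (one_le_div hQ0).2 hx
  have hk0 : 0 < k := by linarith
  set δ := k ^ (-(1 / (d : ℝ))) with hδ
  have hδ0 : 0 < δ := rpow_pos_of_pos hk0 _
  have hδ1 : δ ≤ 1 := rpow_le_one_of_one_le_of_nonpos hk1 (by simp)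
  have hδd : δ ^ d = k⁻¹ := by
    rw [hδ, ← rpow_natCast, ← rpow_mul hk0.le, ← rpow_neg_one]; congr 1; field_simp
  have hδα : k ^ (α / d) * δ ^ α = 1 := by
    rw [hδ, ← rpow_mul hk0.le, ← rpow_add hk0]
    convert rpow_zero k using 2; field_simp; ring
  set W := gibbsMass d α ε * exp ((d + α + 2 * ε) * ell x) with hW
  have hW0 : 0 < W := by positivity
  have h1 := ofReal_sq_le_average_sq (ν := volume.restrict (Metric.ball x δ))
    (v := δ ^ d * unitVolume d) (by positivity)
    (by rw [Measure.restrict_apply_univ, volume_ball_eq x hδ0]) (h x) hh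
  have h2 : ∫⁻ y in Metric.ball x δ, ENNReal.ofReal (h y ^ 2) ≤
      ENNReal.ofReal W * ENNReal.ofReal 2 :=
    (setLIntegral_ball_le hα0 hε x hδ1 (by fun_prop)).trans (by gcongr)
  have h3 : ENNReal.ofReal (h x ^ 2) ≤
      ENNReal.ofReal (2 / unitVolume d * δ ^ α) * carre α h x + ENNReal.ofReal (h x ^ 2 / 2) := by
    calc _ ≤ ENNReal.ofReal (2 / (δ ^ d * unitVolume d)) *
          (ENNReal.ofReal (δ ^ ((d : ℝ) + α)) * carre α h x +
            ENNReal.ofReal W * ENNReal.ofReal 2) := by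
          refine h1.trans ?_
          gcongr
          exact setLIntegral_ball_sub_sq_le hα0 hh x hδ0
      _ = ENNReal.ofReal (2 / unitVolume d * δ ^ α) * carre α h x +
          ENNReal.ofReal (4 / unitVolume d * W * k) := by
          rw [mul_add, ← mul_assoc, ← ENNReal.ofReal_mul (by positivity),
            ← ENNReal.ofReal_mul (by positivity), ← ENNReal.ofReal_mul (by positivity),
            rpow_add hδ0, rpow_natCast, hδd,
            show 2 / (k⁻¹ * unitVolume d) * (k⁻¹ * δ ^ α) = 2 / unitVolume d * δ ^ α by field_simp,
            show 2 / (k⁻¹ * unitVolume d) * (W * 2) = 4 / unitVolume d * W * k by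
              field_simp; norm_num]
      _ ≤ _ := by
          gcongr
          have : h x ^ 2 = Q * k := by rw [hk]; field_simp
          rw [this]
          have h4 := mul_le_mul_of_nonneg_right hQ hk0.le
          have h5 : 8 / unitVolume d * W * k = 2 * (4 / unitVolume d * W * k) := by ring
          linarith
  have h4 : ENNReal.ofReal (h x ^ 2 / 2) ≤
      ENNReal.ofReal (2 / unitVolume d * δ ^ α) * carre α h x := by
    have e : ENNReal.ofReal (h x ^ 2) = ENNReal.ofReal (h x ^ 2 / 2) +
        ENNReal.ofReal (h x ^ 2 / 2) := by
      rw [← ENNReal.ofReal_add (by positivity) (by positivity)]; congr 1; ring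
    rw [e] at h3
    exact (ENNReal.add_le_add_iff_right ENNReal.ofReal_ne_top).1 h3
  calc ENNReal.ofReal (h x ^ 2 * k ^ (α / d)) =
        ENNReal.ofReal (2 * k ^ (α / d)) * ENNReal.ofReal (h x ^ 2 / 2) := by
        rw [← ENNReal.ofReal_mul (by positivity)]; congr 1; ring
    _ ≤ ENNReal.ofReal (2 * k ^ (α / d)) *
        (ENNReal.ofReal (2 / unitVolume d * δ ^ α) * carre α h x) := by gcongr
    _ = _ := by
        rw [← mul_assoc, ← ENNReal.ofReal_mul (by positivity)]
        congr 2
        calc _ = 4 / unitVolume d * (k ^ (α / d) * δ ^ α) := by ring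
          _ = _ := by rw [hδα, mul_one]

/-- The pointwise entropy estimate. -/
theorem exists_ofReal_sq_mul_log_le (hd : 1 ≤ d) (hα0 : 0 < α) (hε : 0 ≤ ε) :
    ∃ C C' : ℝ, 0 < C ∧ 0 < C' ∧ ∀ h : EuclideanSpace ℝ (Fin d) → ℝ, Measurable h →
      ∫⁻ x, ENNReal.ofReal (h x ^ 2) ∂(gibbs (potential d α ε)) ≤ ENNReal.ofReal 2 → ∀ x,
      ENNReal.ofReal (h x ^ 2 * log (1 + h x ^ 2)) ≤
        ENNReal.ofReal C * ENNReal.ofReal (ell x * h x ^ 2) +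
          ENNReal.ofReal C' * carre α h x := by
  have hv := unitVolume_pos (d := d)
  have hZ := gibbsMass_pos (d := d) (ε := ε) hα0
  have hd0 : (0 : ℝ) < d := by exact_mod_cast hd
  set B := (d : ℝ) + α + 2 * ε with hB
  have hB0 : 0 < B := by positivity
  set A := 8 / unitVolume d * gibbsMass d α ε with hA
  have hA0 : 0 < A := by positivity
  have hlA : 0 < log (1 + A) := log_pos (by linarith)
  refine ⟨log (1 + A) + B, (1 + 1 / (α / d)) * (4 / unitVolume d), by positivity, by positivity,
    fun h hh hs x => ?_⟩
  have hl := one_le_ell x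
  set Q := A * exp (B * ell x) with hQ
  have hQ0 : 0 < Q := by positivity
  have h1 : log (1 + Q) ≤ (log (1 + A) + B) * ell x := by
    have e1 : 1 ≤ exp (B * ell x) := one_le_exp (by positivity)
    have e2 : log (1 + Q) ≤ log ((1 + A) * exp (B * ell x)) :=
      log_le_log (by positivity) (by rw [hQ]; linarith)
    rw [log_mul (by positivity) (exp_pos _).ne', log_exp] at e2
    nlinarith
  have h2 : h x ^ 2 * log (1 + Q) ≤ (log (1 + A) + B) * (ell x * h x ^ 2) := by
    have := mul_le_mul_of_nonneg_left h1 (sq_nonneg (h x))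
    linarith
  rw [← ENNReal.ofReal_mul (by positivity : 0 ≤ log (1 + A) + B)]
  rcases le_total (h x ^ 2) Q with hx | hx
  · refine le_add_of_le_left (ENNReal.ofReal_le_ofReal (le_trans ?_ h2))
    gcongr
  · have h3 := ofReal_rpow_mul_sq_le_carre hd hα0 hε hh hs x hQ0
      (by rw [hQ, hA, mul_assoc]) hx
    have hk : 1 ≤ h x ^ 2 / Q := (one_le_div hQ0).2 hx
    have h4 := log_one_add_le_rpow hk (p := α / d) (by positivity)
    have h5 : log (1 + h x ^ 2) ≤ log (1 + Q) + log (1 + h x ^ 2 / Q) := by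
      rw [← log_mul (by positivity) (by positivity)]
      refine log_le_log (by positivity) ?_
      have : (1 + Q) * (1 + h x ^ 2 / Q) = 1 + Q + h x ^ 2 / Q + h x ^ 2 := by field_simp; ring
      linarith
    calc ENNReal.ofReal (h x ^ 2 * log (1 + h x ^ 2)) ≤
          ENNReal.ofReal ((log (1 + A) + B) * (ell x * h x ^ 2) +
            (1 + 1 / (α / d)) * (h x ^ 2 * (h x ^ 2 / Q) ^ (α / d))) := by
          refine ENNReal.ofReal_le_ofReal ?_
          have := mul_le_mul_of_nonneg_left (h5.trans (add_le_add_right h4 _)) (sq_nonneg (h x))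
          linarith
      _ = ENNReal.ofReal ((log (1 + A) + B) * (ell x * h x ^ 2)) +
          ENNReal.ofReal (1 + 1 / (α / d)) *
            ENNReal.ofReal (h x ^ 2 * (h x ^ 2 / Q) ^ (α / d)) := by
          rw [ENNReal.ofReal_add (by positivity) (by positivity),
            ENNReal.ofReal_mul (by positivity : 0 ≤ 1 + 1 / (α / d))]
      _ ≤ _ := by
          rw [ENNReal.ofReal_mul (by positivity : 0 ≤ 1 + 1 / (α / d)), mul_assoc]
          gcongr

theorem sq_mul_log_sq_le {u : ℝ} (hu : 0 ≤ u) : u ^ 2 * log (u ^ 2) ≤ u ^ 2 - 1 +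
    8 * ((u - 1) ^ 2 + (u - 1) ^ 2 * log (1 + (u - 1) ^ 2)) := by
  have hl : 0 ≤ log (1 + (u - 1) ^ 2) := log_nonneg (by linarith [sq_nonneg (u - 1)])
  have hm : 0 ≤ (u - 1) ^ 2 * log (1 + (u - 1) ^ 2) := mul_nonneg (sq_nonneg _) hl
  rcases hu.eq_or_lt with rfl | hu0
  · norm_num at hm ⊢
    linarith
  rcases le_total u 2 with h | h
  · rw [log_pow]
    have h1 := mul_le_mul_of_nonneg_left (log_le_sub_one_of_pos hu0) (sq_nonneg u)
    push_cast
    nlinarith [mul_nonneg (sq_nonneg (u - 1)) (by linarith : 0 ≤ 2 - u)]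
  · have h1 : u ^ 2 ≤ 4 * (u - 1) ^ 2 := by nlinarith
    have h2 : log (u ^ 2) ≤ 2 + log (1 + (u - 1) ^ 2) := by
      have e1 : log (u ^ 2) ≤ log (exp 1 * exp 1 * (1 + (u - 1) ^ 2)) := by
        refine log_le_log (by positivity) (h1.trans ?_)
        have := add_one_le_exp (1 : ℝ)
        have : 4 ≤ exp 1 * exp 1 := by nlinarith
        nlinarith [sq_nonneg (u - 1)]
      rw [← exp_add, log_mul (exp_pos _).ne' (by positivity), log_exp] at e1
      linarith
    have h3 : u ^ 2 * log (u ^ 2) ≤ 4 * (u - 1) ^ 2 * (2 + log (1 + (u - 1) ^ 2)) := by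
      have h0 : 0 ≤ log (u ^ 2) := log_nonneg (by nlinarith)
      gcongr
    nlinarith

/-- The deviation of a normalised function from one is controlled by its variance. -/
theorem integral_abs_sub_one_sq_le (hα0 : 0 < α) (hε : 0 ≤ ε)
    {f : EuclideanSpace ℝ (Fin d) → ℝ} (hf : FormDomain α (potential d α ε) f)
    (hf1 : ∫ x, f x ^ 2 ∂(gibbs (potential d α ε)) = 1) :
    ∫ x, (|f x| - 1) ^ 2 ∂(gibbs (potential d α ε)) ≤ 2 ∧
      ∫ x, (|f x| - 1) ^ 2 ∂(gibbs (potential d α ε)) ≤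
        2 * pairConst d α ε * stableForm α (potential d α ε) f f := by
  have hprob := isProbabilityMeasure_gibbs (d := d) (ε := ε) hα0
  have hV := volume_absolutelyContinuous_gibbs (d := d) (ε := ε) hα0
  have hC := pairConst_pos (d := d) (ε := ε) hα0
  have hab : FormDomain α (potential d α ε) fun x => |f x| :=
    hf.comp (φ := abs) continuous_abs (fun a b => abs_abs_sub_abs_le_abs_sub a b) abs_zero
  have hle : stableForm α (potential d α ε) (fun x => |f x|) (fun x => |f x|) ≤
      stableForm α (potential d α ε) f f := by
    rw [← ENNReal.ofReal_le_ofReal_iff (stableForm_self_nonneg _), hab.ofReal_stableForm hV,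
      hf.ofReal_stableForm hV]
    exact energy_comp_le (φ := abs) (fun a b => abs_abs_sub_abs_le_abs_sub a b) f
  set μ := gibbs (potential d α ε) with hμ
  set m := ∫ x, |f x| ∂μ with hm
  have hm0 : 0 ≤ m := integral_nonneg fun x => abs_nonneg _
  have hsq : ∫ x, |f x| ^ 2 ∂μ = 1 := by simp_rw [sq_abs]; exact hf1
  have h1 := integral_sub_mean_sq hab.1
  rw [hsq, ← hm] at h1
  have h2 := poincareIneq_of_nonneg hα0 hε _ (formDomain_sub_const hab m) (integral_sub_mean hab.1)
  rw [← hμ, h1, stableForm_sub_const] at h2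
  have hm1 : m ^ 2 ≤ 1 := by
    have : 0 ≤ ∫ x, (|f x| - m) ^ 2 ∂μ := integral_nonneg fun x => sq_nonneg _
    linarith
  have hm2 : m ≤ 1 := by nlinarith
  have i0 : Integrable (fun x => |f x|) μ := hab.1.integrable one_le_two
  have i1 : Integrable (fun x => |f x| ^ 2) μ := (memLp_two_iff_integrable_sq hab.1.1).1 hab.1
  have h3 : ∫ x, (|f x| - 1) ^ 2 ∂μ = 2 - 2 * m := by
    have e : ∀ x, (|f x| - 1) ^ 2 = |f x| ^ 2 - 2 * |f x| + 1 := fun x => by ring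
    have i2 : Integrable (fun x => 2 * |f x|) μ := i0.const_mul _
    have i3 : Integrable (fun x => |f x| ^ 2 - 2 * |f x|) μ := i1.sub i2
    simp_rw [e]
    rw [integral_add i3 (integrable_const _), integral_sub i1 i2, integral_const_mul, hsq, ← hm]
    simp; ring
  rw [h3]
  refine ⟨by linarith, ?_⟩
  have h4 := mul_le_mul_of_nonneg_left hle hC.le
  nlinarith

theorem exists_logSobolevIneq (hd : 1 ≤ d) (hα0 : 0 < α) (hε : 1 ≤ ε) :
    ∃ C : ℝ, 0 < C ∧ LogSobolevIneq α (potential d α ε) C := by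
  have hε0 : 0 ≤ ε := by linarith
  have hprob := isProbabilityMeasure_gibbs (d := d) (ε := ε) hα0
  have hV := volume_absolutelyContinuous_gibbs (d := d) (ε := ε) hα0
  have hC := pairConst_pos (d := d) (ε := ε) hα0
  have hp := unitMass_pos (d := d) (ε := ε) hα0
  obtain ⟨M, hM0, hM⟩ := exists_lintegral_ell_rpow_le (d := d) (ε := ε) hα0
  obtain ⟨C₁, C₂, hC₁, hC₂, hlog⟩ := exists_ofReal_sq_mul_log_le hd hα0 hε0
  set P := pairConst d α ε with hP
  set S := 2 * P with hS
  have hS0 : 0 < S := by positivity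
  set L := 2 * S + 2 / unitMass d α ε * (P + M * S) with hL
  have hL0 : 0 < L := by positivity
  refine ⟨8 * (S + (C₁ * L + C₂)), by positivity, fun f hf hf1 => ?_⟩
  obtain ⟨g, hgm, hg, hfg, he⟩ := hf.exists_measurable hV
  have hsq : (fun x => f x ^ 2) =ᵐ[gibbs (potential d α ε)] fun x => g x ^ 2 :=
    hfg.mono fun x hx => by simp only [hx]
  have hlg : (fun x => f x ^ 2 * log (f x ^ 2)) =ᵐ[gibbs (potential d α ε)]
      fun x => g x ^ 2 * log (g x ^ 2) := hfg.mono fun x hx => by simp only [hx]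
  rw [he, integrable_congr hlg, integral_congr_ae hlg]
  rw [integral_congr_ae hsq] at hf1
  have hg2 := integral_abs_sub_one_sq_le hα0 hε0 hg hf1
  set μ := gibbs (potential d α ε) with hμ
  set E := stableForm α (potential d α ε) g g with hE
  have hE0 : 0 ≤ E := stableForm_self_nonneg _
  set h : EuclideanSpace ℝ (Fin d) → ℝ := fun x => |g x| - 1 with hh
  have hhm : Measurable h := by rw [hh]; fun_prop
  have hh2 : MemLp h 2 μ := hg.1.abs.sub (memLp_const 1)
  have ihs : Integrable (fun x => h x ^ 2) μ := (memLp_two_iff_integrable_sq hh2.1).1 hh2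
  have hhE : energy α (potential d α ε) h ≤ ENNReal.ofReal E := by
    rw [hg.ofReal_stableForm hV]
    refine energy_comp_le (φ := fun a => |a| - 1) (fun a b => ?_) g
    rw [sub_sub_sub_cancel_right]
    exact abs_abs_sub_abs_le_abs_sub a b
  have hls : ∫⁻ x, ENNReal.ofReal (h x ^ 2) ∂μ = ENNReal.ofReal (∫ x, h x ^ 2 ∂μ) :=
    (ofReal_integral_eq_lintegral_ofReal ihs (Eventually.of_forall fun x => sq_nonneg _)).symm
  have hlS : ∫⁻ x, ENNReal.ofReal (h x ^ 2) ∂μ ≤ ENNReal.ofReal (S * E) := by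
    rw [hls]; exact ENNReal.ofReal_le_ofReal hg2.2
  have hl2 : ∫⁻ x, ENNReal.ofReal (h x ^ 2) ∂μ ≤ ENNReal.ofReal 2 := by
    rw [hls]; exact ENNReal.ofReal_le_ofReal hg2.1
  have hell := lintegral_ell_mul_sq_le hα0 hε hM0 hM hhm (by positivity) hE0 hlS hhE
  have hlm := measurable_ell (d := d)
  have hcm := measurable_carre (α := α) hhm
  have hentropy : ∫⁻ x, ENNReal.ofReal (h x ^ 2 * log (1 + h x ^ 2)) ∂μ ≤
      ENNReal.ofReal ((C₁ * L + C₂) * E) := by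
    calc _ ≤ ∫⁻ x, (ENNReal.ofReal C₁ * ENNReal.ofReal (ell x * h x ^ 2) +
          ENNReal.ofReal C₂ * carre α h x) ∂μ := lintegral_mono (hlog h hhm hl2)
      _ = ENNReal.ofReal C₁ * ∫⁻ x, ENNReal.ofReal (ell x * h x ^ 2) ∂μ +
          ENNReal.ofReal C₂ * energy α (potential d α ε) h := by
          rw [lintegral_add_left (by fun_prop), lintegral_const_mul _ (by fun_prop),
            lintegral_const_mul _ hcm, lintegral_carre hhm]
      _ ≤ ENNReal.ofReal C₁ * ENNReal.ofReal (L * E) + ENNReal.ofReal C₂ * ENNReal.ofReal E := by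
          gcongr
          refine hell.trans (ENNReal.ofReal_le_ofReal (le_of_eq ?_))
          rw [hL]; ring
      _ = _ := by
          rw [← ENNReal.ofReal_mul hC₁.le, ← ENNReal.ofReal_mul hC₂.le,
            ← ENNReal.ofReal_add (by positivity) (by positivity)]
          congr 1; ring
  have hlog0 : ∀ x, 0 ≤ h x ^ 2 * log (1 + h x ^ 2) := fun x =>
    mul_nonneg (sq_nonneg _) (log_nonneg (by linarith [sq_nonneg (h x)]))
  have ilog : Integrable (fun x => h x ^ 2 * log (1 + h x ^ 2)) μ :=
    ⟨Measurable.aestronglyMeasurable (by fun_prop),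
      (hasFiniteIntegral_iff_ofReal (Eventually.of_forall hlog0)).2
        (hentropy.trans_lt ENNReal.ofReal_lt_top)⟩
  rw [← ofReal_integral_eq_lintegral_ofReal ilog (Eventually.of_forall hlog0),
    ENNReal.ofReal_le_ofReal_iff (by positivity)] at hentropy
  have igs : Integrable (fun x => g x ^ 2) μ := (memLp_two_iff_integrable_sq hg.1.1).1 hg.1
  have i1 : Integrable (fun x => g x ^ 2 - 1) μ := igs.sub (integrable_const _)
  have i2 : Integrable (fun x => 8 * (h x ^ 2 + h x ^ 2 * log (1 + h x ^ 2))) μ :=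
    (ihs.add ilog).const_mul 8
  have i3 : Integrable (fun x => g x ^ 2 - 1 + 8 * (h x ^ 2 + h x ^ 2 * log (1 + h x ^ 2))) μ :=
    i1.add i2
  have hup : ∀ x, g x ^ 2 * log (g x ^ 2) ≤
      g x ^ 2 - 1 + 8 * (h x ^ 2 + h x ^ 2 * log (1 + h x ^ 2)) := fun x => by
    have := sq_mul_log_sq_le (abs_nonneg (g x))
    rwa [sq_abs] at this
  have hlow : ∀ x, -1 ≤ g x ^ 2 * log (g x ^ 2) := fun x => by
    have := mul_log_ge (sq_nonneg (g x)) one_pos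
    rw [log_one, mul_zero] at this
    linarith [sq_nonneg (g x)]
  have i4 : Integrable (fun x => g x ^ 2 * log (g x ^ 2)) μ := by
    refine (i3.add (integrable_const (2 : ℝ))).mono'
      (Measurable.aestronglyMeasurable (by fun_prop)) (Eventually.of_forall fun x => ?_)
    simp only [Pi.add_apply]
    rw [norm_eq_abs, abs_le]
    have := hlog0 x
    constructor <;> nlinarith [hlow x, hup x, sq_nonneg (g x), sq_nonneg (h x)]
  refine ⟨i4, (integral_mono i4 i3 hup).trans ?_⟩
  rw [integral_add i1 i2, integral_sub igs (integrable_const _), hf1, integral_const_mul,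
    integral_add ihs ilog]
  have := hg2.2
  simp only [integral_const, probReal_univ, smul_eq_mul, mul_one, sub_self, zero_add]
  have e : 8 * (S + (C₁ * L + C₂)) * E = 8 * (S * E + (C₁ * L + C₂) * E) := by ring
  rw [e]
  gcongr

end LogSobolev

theorem corollary1p3 (d : ℕ) (hd : 1 ≤ d) (α : ℝ) (hα0 : 0 < α) (hα2 : α < 2) (ε : ℝ) :
    -- the measure and the semigroup are well defined
    IsProbabilityMeasure (gibbs (potential d α ε)) ∧
    (∃ P, IsFormSemigroup α (potential d α ε) P) ∧
    -- (1) super Poincaré inequality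
    ((∃ β : ℝ → ℝ, (∀ r, 0 < r → 0 < β r) ∧ SuperPoincareIneq α (potential d α ε) β) ↔ 0 < ε) ∧
    (0 < ε → ∃ c : ℝ, 0 < c ∧
      SuperPoincareIneq α (potential d α ε) (fun r => exp (c * (1 + r ^ (-1 / ε))))) ∧
    (1 < ε → ∃ l : ℝ, 0 < l ∧ ∀ P, IsFormSemigroup α (potential d α ε) P → ∀ t : ℝ, 0 < t →
      mixedNorm (gibbs (potential d α ε)) 1 ∞ (fun f => P t f) ≤
        ENNReal.ofReal (exp (l * (1 + t ^ (-1 / (ε - 1)))))) ∧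
    -- (2) sharpness of the super Poincaré inequality
    (0 < ε → ∀ β : ℝ → ℝ, (∀ r, 0 < r → 0 < β r) →
      Tendsto (fun r : ℝ => r ^ (1 / ε) * log (β r)) (𝓝[>] 0) (𝓝 0) →
      ¬ SuperPoincareIneq α (potential d α ε) β) ∧
    -- (3) log-Sobolev inequality
    ((∃ C : ℝ, 0 < C ∧ LogSobolevIneq α (potential d α ε) C) ↔ 1 ≤ ε) ∧
    -- (4) Poincaré and weak Poincaré inequalities
    ((∃ C : ℝ, 0 < C ∧ PoincareIneq α (potential d α ε) C) ↔ 0 ≤ ε) ∧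
    (ε < 0 → ∃ c : ℝ, 0 < c ∧
      WeakPoincareIneq α (potential d α ε) (fun r => c * (1 + log (1 + r⁻¹) ^ (-ε)))) ∧
    (ε < 0 → ∃ l₁ l₂ : ℝ, 0 < l₁ ∧ 0 < l₂ ∧
      ∀ P, IsFormSemigroup α (potential d α ε) P → ∀ t : ℝ, 0 < t →
        mixedNorm (gibbs (potential d α ε)) ∞ 2
            (fun f x => P t f x - ∫ y, f y ∂(gibbs (potential d α ε))) ≤
          ENNReal.ofReal (exp (l₁ - l₂ * t ^ (1 / (1 - ε))))) ∧
    (ε < 0 → ∀ β : ℝ → ℝ, (∀ r, 0 < r → 0 < β r) →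
      Tendsto (fun r : ℝ => β r * log (1 + r⁻¹) ^ ε) (𝓝[>] 0) (𝓝 0) →
      ¬ WeakPoincareIneq α (potential d α ε) β) := by
  have hprob := isProbabilityMeasure_gibbs (d := d) (ε := ε) hα0
  have hV := volume_absolutelyContinuous_gibbs (d := d) (ε := ε) hα0
  refine ⟨hprob, ?_, ⟨?_, fun hε => ?_⟩, exists_superPoincareIneq hα0, fun hε => ?_,
    fun hε β hβ hlim => not_superPoincareIneq_of_tendsto hd hα0 hα2 hε hβ hlim,
    ⟨?_, exists_logSobolevIneq hd hα0⟩, ⟨?_, fun hε => ?_⟩, exists_weakPoincareIneq hα0,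
    fun hε => ?_, fun hε β _ hlim => not_weakPoincareIneq_of_tendsto hd hα0 hα2 hε hlim⟩
  · exact ⟨_, (isFormSemigroup_iff hV _).2
      (isClosedForm_stableForm hV hd hα0 hα2).isSemigroupOf_semigroup⟩
  · rintro ⟨β, hβ, h⟩
    by_contra! hε
    exact not_superPoincareIneq hd hα0 hα2 hε hβ h
  · obtain ⟨c, -, h⟩ := exists_superPoincareIneq (d := d) hα0 hε
    exact ⟨_, fun r _ => exp_pos _, h⟩
  · obtain ⟨c, hc, h⟩ := exists_superPoincareIneq (d := d) hα0 (one_pos.trans hε)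
    exact exists_mixedNorm_one_top_le hV hd hα0 hα2 hε hc h
  · rintro ⟨C, hC, h⟩
    by_contra! hε
    exact not_logSobolevIneq hd hα0 hα2 hε hC h
  · rintro ⟨C, -, h⟩
    by_contra! hε
    exact not_poincareIneq hd hα0 hα2 hε C h
  · exact ⟨_, pairConst_pos hα0, poincareIneq_of_nonneg hα0 hε⟩
  · obtain ⟨c, hc, h⟩ := exists_weakPoincareIneq (d := d) hα0 hε
    exact exists_mixedNorm_top_two_le hV hd hα0 hα2 hε hc h
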